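/- **Setting.** Let $N\in\mathbb N$, $1<p<N$, $p^*=\frac{Np}{N-p}$, $\mu>0$, $\max\{p,p^*-1\}<r<q<p^*$, $1<\beta<r/p$, and $\beta\le\frac1{2-p}$ if $p<2$. Let $V\in C^1(\mathbb R^N)$ satisfy $\tilde a\le V\le\tilde b$ for some constants $0<\tilde a<\tilde b$, and let $\mathcal M\subset\mathbb R^N$ be a bounded domain with smooth boundary such that $\vec n(x)\cdot\nabla V(x)>0$ for all $x\in\partial\mathcal M$, where $\vec n$ is the outward unit normal. For $B\subset\mathbb R^N$, $\delta,\epsilon>0$ write $B^\delta=\{x:\operatorname{dist}(x,B)<\delta\}$ and $B_\epsilon=\{x:\epsilon x\in B\}$. Let $\varphi\in C_0^\infty(\mathbb R)$ be even with $\varphi=1$ on $[-1,1]$, $\varphi(s)=0$ for $|s|\ge2$, $|\varphi'|\le2$, and $\varphi$ decreasing on $[1,2]$. Let $\zeta\in C^1(\mathbb R)$ satisfy $0\le\zeta\le1$, $\zeta'\ge0$, $\zeta(t)=0$ for $t\le0$, $\zeta(t)>0$ for $t>0$, $\zeta(t)=1$ for $t\ge1$, and, for some constants $c,a,\rho>0$,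 $t\zeta'(t)\ge c\,\zeta(t)$ and $\zeta(t)\ge c\,t^a$ for $0\le t\le\rho$. Let $$\gamma>\max\Big\{\frac{(p+a)p}{N-p},\ \frac{p^2r}{(r-p)(N-p)}\Big\}.$$ For $\epsilon\in(0,1]$ put $$b_\epsilon(x,t)=\varphi\big(\epsilon e^{\operatorname{dist}(\epsilon x,\mathcal M)}t\big),\qquad m_\epsilon(x,t)=\int_0^t b_\epsilon(x,\tau)\,d\tau,$$ $$F_\epsilon(x,t)=\frac1{p^*}|t|^r|m_\epsilon(x,t)|^{p^*-r}+\frac\mu q|t|^r|m_\epsilon(x,t)|^{q-r},\qquad f_\epsilon=\partial_tF_\epsilon,$$ $\xi_\epsilon(x)=0$ for $x\in\mathcal M_\epsilon$, $\xi_\epsilon(x)=\epsilon^{-\gamma}\zeta(\operatorname{dist}(x,\mathcal M_\epsilon))$ for $x\notin\mathcal M_\epsilon$, and for $u\in W^{1,p}(\mathbb R^N)$ $$I_\epsilon(u)=\frac1p\int_{\mathbb R^N}\big(|\nabla u|^p+V(\epsilon x)|u|^p\big)dx+\frac1{p\beta}\Big(\int_{\mathbb R^N}\xi_\epsilon|u|^p\,dx-1\Big)_+^\beta-\int_{\mathbb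 R^N}F_\epsilon(x,u)\,dx.$$ A function $u\in W^{1,p}(\mathbb R^N)$ is called a critical point of $I_\epsilon$ if for every $w\in W^{1,p}(\mathbb R^N)$ $$\int_{\mathbb R^N}\big(|\nabla u|^{p-2}\nabla u\cdot\nabla w+V(\epsilon x)|u|^{p-2}uw\big)dx+\Big(\int_{\mathbb R^N}\xi_\epsilon|u|^p\,dx-1\Big)_+^{\beta-1}\int_{\mathbb R^N}\xi_\epsilon|u|^{p-2}uw\,dx-\int_{\mathbb R^N}f_\epsilon(x,u)w\,dx=0.$$ **Lemma 4.2.** Fix all the data above. For every $\delta>0$ and every $M\in\mathbb R$ there is a constant $C=C(\delta,M)>0$ such that for every $\epsilon\in(0,1]$ and every critical point $u$ of $I_\epsilon$ with $I_\epsilon(u)\le M$, $$|u(x)|\le C\,\epsilon^{\gamma/p}\qquad\text{for almost every }x\in\mathbb R^N\setminus(\mathcal M_\epsilon)^\delta.$$ -/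

import Mathlib

open MeasureTheory Set
open scoped ContDiff RealInnerProductSpace

namespace PLap

/-- The Euclidean space `ℝ^N`. -/
abbrev E (N : ℕ) : Type := EuclideanSpace ℝ (Fin N)

/-! ### The Sobolev space `W^{1,p}(ℝ^N)` -/

/-- `G` is the weak gradient of `u` on `ℝ^N`: for every test function `η` and every direction `v`,
`∫ u ∂_v η = - ∫ η ⟨G, v⟩`. -/
def IsWeakGradient {N : ℕ} (u : E N → ℝ) (G : E N → E N) : Prop :=
  ∀ η : E N → ℝ, ContDiff ℝ ∞ η → HasCompactSupport η → ∀ v : E N,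
    ∫ x, u x * fderiv ℝ η x v = - ∫ x, η x * ⟪G x, v⟫

/-- A (representative of a) function in `W^{1,p}(ℝ^N)`, together with its weak gradient, which is
unique up to null sets. -/
structure SobolevFun (N : ℕ) (p : ℝ) where
  toFun : E N → ℝ
  grad : E N → E N
  memLp_toFun : MemLp toFun (ENNReal.ofReal p) volume
  memLp_grad : MemLp grad (ENNReal.ofReal p) volume
  isWeakGradient : IsWeakGradient toFun grad

/-! ### Hypotheses on the potential and the domain -/

/-- `V ∈ C¹(ℝ^N)` with `a₀ ≤ V ≤ b₀` for some constants `0 < a₀ < b₀`. -/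
def IsAdmissiblePotential {N : ℕ} (V : E N → ℝ) : Prop :=
  ContDiff ℝ 1 V ∧ ∃ a₀ b₀ : ℝ, 0 < a₀ ∧ a₀ < b₀ ∧ ∀ x, a₀ ≤ V x ∧ V x ≤ b₀

/-- `g` is a smooth local defining function of the open set `Ω` near `x`. -/
def IsLocalDefiningFun {N : ℕ} (Ω : Set (E N)) (x : E N) (g : E N → ℝ) : Prop :=
  gradient g x ≠ 0 ∧
    ∃ U : Set (E N), IsOpen U ∧ x ∈ U ∧ ContDiffOn ℝ ∞ g U ∧ ∀ y ∈ U, (y ∈ Ω ↔ g y < 0)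

/-- `Ω` is a bounded domain (nonempty, open, connected) with smooth boundary. -/
def IsSmoothBoundedDomain {N : ℕ} (Ω : Set (E N)) : Prop :=
  IsOpen Ω ∧ IsConnected Ω ∧ Bornology.IsBounded Ω ∧
    ∀ x ∈ frontier Ω, ∃ g : E N → ℝ, IsLocalDefiningFun Ω x g

/-- `n` is the outward unit normal of `Ω` at the boundary point `x`. -/
def IsOutwardNormal {N : ℕ} (Ω : Set (E N)) (x n : E N) : Prop :=
  ∃ g : E N → ℝ, IsLocalDefiningFun Ω x g ∧ n = ‖gradient g x‖⁻¹ • gradient g x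

/-- On `∂Ω` the potential strictly increases in the direction of the outward normal. -/
def IsTrapping {N : ℕ} (V : E N → ℝ) (Ω : Set (E N)) : Prop :=
  ∀ x ∈ frontier Ω, ∀ n : E N, IsOutwardNormal Ω x n → 0 < ⟪n, gradient V x⟫

/-! ### Cut-off functions -/

/-- The truncation cut-off `φ ∈ C_0^∞(ℝ)`: even, equal to `1` on `|s| ≤ 1` and to `0` on
`|s| ≥ 2`, decreasing on `[1, 2]`, with `|φ'| ≤ 2`. -/
structure IsTruncationCutoff (φ : ℝ → ℝ) : Prop where
  smooth : ContDiff ℝ ∞ φ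
  eq_one : ∀ s, |s| ≤ 1 → φ s = 1
  eq_zero : ∀ s, 2 ≤ |s| → φ s = 0
  abs_deriv_le : ∀ s, |deriv φ s| ≤ 2
  even : ∀ s, φ (-s) = φ s
  antitoneOn : AntitoneOn φ (Icc 1 2)

/-- The penalization profile `ζ`, with the exponent `a` of its lower bound near `0`. -/
structure IsPenalizationProfile (a : ℝ) (ζ : ℝ → ℝ) : Prop where
  contDiff : ContDiff ℝ 1 ζ
  nonneg : ∀ t, 0 ≤ ζ t
  le_one : ∀ t, ζ t ≤ 1
  deriv_nonneg : ∀ t, 0 ≤ deriv ζ t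
  eq_zero : ∀ t, t ≤ 0 → ζ t = 0
  pos : ∀ t, 0 < t → 0 < ζ t
  eq_one : ∀ t, 1 ≤ t → ζ t = 1
  lower_bounds : ∃ C > 0, ∃ ρ > 0, ∀ t, 0 ≤ t → t ≤ ρ →
    C * ζ t ≤ t * deriv ζ t ∧ C * t ^ a ≤ ζ t

/-! ### The penalized functional -/

/-- The critical Sobolev exponent `p^* = Np / (N - p)`. -/
noncomputable def critExp (N : ℕ) (p : ℝ) : ℝ := N * p / (N - p)

/-- The data from which the penalized functional is built. -/
structure Data (N : ℕ) where
  p : ℝ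
  q : ℝ
  r : ℝ
  μ : ℝ
  β : ℝ
  γ : ℝ
  V : E N → ℝ
  Ω : Set (E N)
  φ : ℝ → ℝ
  ζ : ℝ → ℝ

/-- The rescaled set `Ω_ε = {x | ε x ∈ Ω}`. -/
def rescale {N : ℕ} (ε : ℝ) (Ω : Set (E N)) : Set (E N) := {x | ε • x ∈ Ω}

namespace Data

variable {N : ℕ} (D : Data N)

/-- `b_ε(x, t) = φ(ε e^{dist(ε x, Ω)} t)`. -/
noncomputable def b (ε : ℝ) (x : E N) (t : ℝ) : ℝ :=
  D.φ (ε * Real.exp (Metric.infDist (ε • x) D.Ω) * t)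

/-- `m_ε(x, t) = ∫_0^t b_ε(x, τ) dτ`. -/
noncomputable def m (ε : ℝ) (x : E N) (t : ℝ) : ℝ := ∫ τ in (0 : ℝ)..t, D.b ε x τ

/-- `F_ε(x, t) = (1/p^*) |t|^r |m_ε(x, t)|^{p^* - r} + (μ/q) |t|^r |m_ε(x, t)|^{q - r}`. -/
noncomputable def F (ε : ℝ) (x : E N) (t : ℝ) : ℝ :=
  1 / critExp N D.p * |t| ^ D.r * |D.m ε x t| ^ (critExp N D.p - D.r)
    + D.μ / D.q * |t| ^ D.r * |D.m ε x t| ^ (D.q - D.r)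

/-- `f_ε = ∂F_ε/∂t`. -/
noncomputable def f (ε : ℝ) (x : E N) (t : ℝ) : ℝ := deriv (fun s => D.F ε x s) t

open scoped Classical in
/-- The penalization weight `ξ_ε`. -/
noncomputable def ξ (ε : ℝ) (x : E N) : ℝ :=
  if x ∈ rescale ε D.Ω then 0 else ε ^ (-D.γ) * D.ζ (Metric.infDist x (rescale ε D.Ω))

/-- `(∫ ξ_ε |u|^p - 1)_+`. -/
noncomputable def excess (ε : ℝ) (u : SobolevFun N D.p) : ℝ :=
  max ((∫ x, D.ξ ε x * |u.toFun x| ^ D.p) - 1) 0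

/-- The penalization term `Q_ε(u) = (1 / (p β)) (∫ ξ_ε |u|^p - 1)_+^β`. -/
noncomputable def Q (ε : ℝ) (u : SobolevFun N D.p) : ℝ :=
  1 / (D.p * D.β) * D.excess ε u ^ D.β

/-- The penalized functional `I_ε`. -/
noncomputable def I (ε : ℝ) (u : SobolevFun N D.p) : ℝ :=
  1 / D.p * (∫ x, (‖u.grad x‖ ^ D.p + D.V (ε • x) * |u.toFun x| ^ D.p))
    + D.Q ε u - ∫ x, D.F ε x (u.toFun x)

/-- The first variation `⟨I_ε'(u), w⟩`. -/
noncomputable def dI (ε : ℝ) (u w : SobolevFun N D.p) : ℝ :=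
  (∫ x, (‖u.grad x‖ ^ (D.p - 2) * ⟪u.grad x, w.grad x⟫
      + D.V (ε • x) * (|u.toFun x| ^ (D.p - 2) * u.toFun x * w.toFun x)))
    + D.excess ε u ^ (D.β - 1)
      * (∫ x, D.ξ ε x * (|u.toFun x| ^ (D.p - 2) * u.toFun x * w.toFun x))
    - ∫ x, D.f ε x (u.toFun x) * w.toFun x

/-- `u` is a critical point of `I_ε`. -/
def IsCriticalPoint (ε : ℝ) (u : SobolevFun N D.p) : Prop :=
  ∀ w : SobolevFun N D.p, D.dI ε u w = 0

/-- The standing assumptions; `a` is the exponent in the lower bound `ζ(t) ≥ C t^a`. -/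
structure Admissible (a : ℝ) : Prop where
  one_lt_p : 1 < D.p
  p_lt_dim : D.p < N
  μ_pos : 0 < D.μ
  r_lower : max D.p (critExp N D.p - 1) < D.r
  r_lt_q : D.r < D.q
  q_lt_crit : D.q < critExp N D.p
  one_lt_β : 1 < D.β
  β_lt : D.β < D.r / D.p
  β_le : D.p < 2 → D.β ≤ 1 / (2 - D.p)
  a_pos : 0 < a
  γ_lower : max ((D.p + a) * D.p / (N - D.p))
    (D.p ^ 2 * D.r / ((D.r - D.p) * (N - D.p))) < D.γ
  potential : IsAdmissiblePotential D.V
  domain : IsSmoothBoundedDomain D.Ω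
  trapping : IsTrapping D.V D.Ω
  cutoff : IsTruncationCutoff D.φ
  profile : IsPenalizationProfile a D.ζ

end Data

end PLap

/-! Write `S` for the critical exponent `critExp N D.p`. Testing the equation with `u` itself and
using `r F ≤ t f` bounds the norms of `u` and `∇u` in `L^p` and the integral of `ξ_ε |u|^p`,
uniformly in `ε`. Outside the `δ`-neighbourhood of `Ω_ε` the weight is at least a constant times
`ε^{-γ}` on balls of radius `δ/2`, so there `∫ |u|^p ≤ C ε^γ`. It remains to turn this decay of the
`L^p` mass into a pointwise bound at the matching rate `ε^{γ/p}`.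

The obstacle is that the nonlinearity is controlled only with a loss: since `|m_ε| ≤ 2/ε`, one has
`|f_ε(x,t)| ≤ K ε^{-(S-r)} |t|^{r-1}` (`Admissible.abs_f_le`). The potential and penalization terms
do no harm: tested with `η^m (u-k)_+`, `k ≥ 0`, they are nonnegative and can be dropped. What is
left is a Caccioppoli estimate combined with the Sobolev inequality for the truncations, with
constants depending on `ε` only through `ε^{-(S-r)}` (`Admissible.exists_level_estimate`).

This estimate is used twice, and the lower bounds on `γ` pay for the loss. First, at level zero, the
`L^r` mass is interpolated between the known `L^p` decay and the current `L^S` decay. Each passage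
to a smaller ball improves the `L^S` rate by a fixed power of `ε`, so finitely many passages give `∫
|u|^S ≤ C ε^{γS/p}` (`exists_exponent_gain`, `Admissible.exists_outer_crit_bound`). The gain is
affine in the current rate, and positive at both ends of its range exactly when `γ > S - p` and `γ
(r-p)/p > S - r`. Second, a De Giorgi iteration with levels increasing to `k = Λ ε^{γ/p}` gives `u ≤
k` on a smaller ball (`Admissible.exists_sup_bound`). At this level the lossy term is dominated by
the scaling of the other one, again by `γ (r-p)/p > S - r`, so `Λ` does not depend on `ε`.

The problem is odd in `u`, so the same bound holds for `-u`; the balls then cover the exterior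
region. -/

namespace PLap

/-! ### The truncation cut-off and its primitive -/

/-- The primitive `s ↦ ∫_0^s φ` of a cut-off. -/
noncomputable def truncPrimitive (φ : ℝ → ℝ) (s : ℝ) : ℝ := ∫ τ in (0 : ℝ)..s, φ τ

namespace IsTruncationCutoff

variable {φ : ℝ → ℝ} (h : IsTruncationCutoff φ)
include h

theorem apply_abs (s : ℝ) : φ |s| = φ s := by
  rcases abs_choice s with hs | hs <;> rw [hs]
  exact h.even s

theorem mem_Icc (s : ℝ) : φ s ∈ Icc (0 : ℝ) 1 := by
  rw [← h.apply_abs]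
  rcases le_total |s| 1 with h1 | h1
  · rw [h.eq_one _ (by rwa [abs_abs])]; simp
  rcases le_total 2 |s| with h2 | h2
  · rw [h.eq_zero _ (by rwa [abs_abs])]; simp
  constructor
  · rw [← h.eq_zero 2 (by norm_num)]
    exact h.antitoneOn ⟨h1, h2⟩ ⟨by norm_num, le_rfl⟩ h2
  · rw [← h.eq_one 1 (by norm_num)]
    exact h.antitoneOn ⟨le_rfl, by norm_num⟩ ⟨h1, h2⟩ h1

theorem continuous : Continuous φ := h.smooth.continuous

theorem antitone_of_nonneg {s t : ℝ} (hs : 0 ≤ s) (hst : s ≤ t) : φ t ≤ φ s := by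
  rcases le_total s 1 with h1 | h1
  · rw [h.eq_one s (abs_le.2 ⟨by linarith, h1⟩)]
    exact (h.mem_Icc t).2
  rcases le_total 2 t with h2 | h2
  · rw [h.eq_zero t (h2.trans (le_abs_self t))]
    exact (h.mem_Icc s).1
  exact h.antitoneOn ⟨h1, hst.trans h2⟩ ⟨h1.trans hst, h2⟩ hst

theorem hasDerivAt_primitive (s : ℝ) : HasDerivAt (truncPrimitive φ) (φ s) s :=
  intervalIntegral.integral_hasDerivAt_right (h.continuous.intervalIntegrable _ _)
    h.continuous.aestronglyMeasurable.stronglyMeasurableAtFilter h.continuous.continuousAt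

theorem continuous_primitive : Continuous (truncPrimitive φ) :=
  continuous_iff_continuousAt.2 fun s => (h.hasDerivAt_primitive s).continuousAt

theorem primitive_neg (s : ℝ) : truncPrimitive φ (-s) = -truncPrimitive φ s := by
  have := intervalIntegral.integral_comp_neg (a := 0) (b := s) φ
  simp only [h.even, neg_zero] at this
  rw [truncPrimitive, truncPrimitive, this, intervalIntegral.integral_symm]

/-- On the half line `φ` is decreasing, so its mean over `[0, s]` is at least its value at the
endpoint. This yields `t m'(t) ≤ m(t)` for the truncation. -/
theorem mul_le_primitive {s : ℝ} (hs : 0 ≤ s) : s * φ s ≤ truncPrimitive φ s := by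
  have : ∫ _ in (0 : ℝ)..s, φ s ≤ ∫ τ in (0 : ℝ)..s, φ τ :=
    intervalIntegral.integral_mono_on hs (by simp) (h.continuous.intervalIntegrable _ _)
      fun τ hτ => h.antitone_of_nonneg hτ.1 hτ.2
  simpa [truncPrimitive] using this

theorem primitive_le {s : ℝ} (hs : 0 ≤ s) : truncPrimitive φ s ≤ s := by
  have : ∫ τ in (0 : ℝ)..s, φ τ ≤ ∫ _ in (0 : ℝ)..s, (1 : ℝ) :=
    intervalIntegral.integral_mono_on hs (h.continuous.intervalIntegrable _ _) (by simp)
      fun τ _ => (h.mem_Icc τ).2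
  simpa [truncPrimitive] using this

theorem monotone_primitive : Monotone (truncPrimitive φ) :=
  monotone_of_deriv_nonneg (fun s => (h.hasDerivAt_primitive s).differentiableAt)
    fun s => by rw [(h.hasDerivAt_primitive s).deriv]; exact (h.mem_Icc s).1

theorem primitive_pos {s : ℝ} (hs : 0 < s) : 0 < truncPrimitive φ s := by
  have h0 : 0 < min s 1 := by positivity
  have h1 := h.mul_le_primitive h0.le
  rw [h.eq_one _ (abs_le.2 ⟨by linarith, min_le_right _ _⟩), mul_one] at h1
  exact h0.trans_le (h1.trans (h.monotone_primitive (min_le_left _ _)))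

theorem primitive_le_two (s : ℝ) : truncPrimitive φ s ≤ 2 := by
  have h2 : truncPrimitive φ 2 ≤ 2 := h.primitive_le (by norm_num)
  rcases le_total s 2 with hs | hs
  · exact (h.monotone_primitive hs).trans h2
  have h3 : truncPrimitive φ s = truncPrimitive φ 2 + ∫ τ in (2 : ℝ)..s, φ τ :=
    (intervalIntegral.integral_add_adjacent_intervals (h.continuous.intervalIntegrable _ _)
      (h.continuous.intervalIntegrable _ _)).symm
  have h4 : ∫ τ in (2 : ℝ)..s, φ τ = ∫ _ in (2 : ℝ)..s, (0 : ℝ) := by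
    refine intervalIntegral.integral_congr fun τ hτ => ?_
    rw [uIcc_of_le hs] at hτ
    exact h.eq_zero τ (hτ.1.trans (le_abs_self τ))
  rw [h3, h4]
  simpa using h2

/-- The logarithmic derivative of `t^r m(t)^κ`, with `m(t) = c⁻¹ ∫_0^{ct} φ`, lies between `r / t`
and `(r + κ) / t`. -/
theorem exists_hasDerivAt_rpow_mul {c r κ t : ℝ} (hc : 0 < c) (hκ : 0 ≤ κ) (ht : 0 < t) :
    ∃ d, HasDerivAt (fun s => |s| ^ r * |c⁻¹ * truncPrimitive φ (c * s)| ^ κ) d t ∧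
      r * (|t| ^ r * |c⁻¹ * truncPrimitive φ (c * t)| ^ κ) ≤ t * d ∧
      t * d ≤ (r + κ) * (|t| ^ r * |c⁻¹ * truncPrimitive φ (c * t)| ^ κ) := by
  set m : ℝ → ℝ := fun s => c⁻¹ * truncPrimitive φ (c * s) with hm
  have hmpos : ∀ s, 0 < s → 0 < m s := fun s hs =>
    mul_pos (inv_pos.2 hc) (h.primitive_pos (mul_pos hc hs))
  have hmd : HasDerivAt m (φ (c * t)) t := by
    have h1 := ((h.hasDerivAt_primitive (c * t)).comp t
      ((hasDerivAt_id t).const_mul c)).const_mul c⁻¹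
    refine h1.congr_deriv ?_
    rw [mul_one, mul_comm (φ (c * t)), inv_mul_cancel_left₀ hc.ne']
  have hb : 0 ≤ φ (c * t) := (h.mem_Icc _).1
  -- Together with `0 ≤ m'`, the inequality `t m' ≤ m` is what places the contribution of `m^κ` to
  -- `t d` between `0` and `κ t^r m^κ`.
  have hbm : t * φ (c * t) ≤ m t := by
    have := h.mul_le_primitive (mul_pos hc ht).le
    rw [hm]
    simp only
    rw [← div_eq_inv_mul, le_div_iff₀ hc]
    linarith
  have hd := (Real.hasDerivAt_rpow_const (p := r) (Or.inl ht.ne')).mul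
    (hmd.rpow_const (p := κ) (Or.inl (hmpos t ht).ne'))
  refine ⟨_, hd.congr_of_eventuallyEq ?_, ?_⟩
  · filter_upwards [lt_mem_nhds ht] with s hs
    simp only [Pi.mul_apply]
    rw [abs_of_pos hs, ← abs_of_pos (hmpos s hs)]
  · have e1 : |t| = t := abs_of_pos ht
    have e2 : |c⁻¹ * truncPrimitive φ (c * t)| = m t := abs_of_pos (hmpos t ht)
    rw [e1, e2]
    have e3 : t ^ r = t * t ^ (r - 1) := by
      rw [Real.rpow_sub_one ht.ne']; field_simp
    have e4 : m t ^ κ = m t * m t ^ (κ - 1) := by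
      rw [Real.rpow_sub_one (hmpos t ht).ne']
      have := (hmpos t ht).ne'
      field_simp
    have p1 : 0 < t ^ (r - 1) := Real.rpow_pos_of_pos ht _
    have p2 : 0 < m t ^ (κ - 1) := Real.rpow_pos_of_pos (hmpos t ht) _
    have key : t * (r * t ^ (r - 1) * m t ^ κ + t ^ r * (φ (c * t) * κ * m t ^ (κ - 1)))
        = r * (t ^ r * m t ^ κ) + κ * (t * φ (c * t)) * (t ^ r * m t ^ (κ - 1)) := by
      rw [e3]; ring
    have p3 : 0 < t ^ r * m t ^ (κ - 1) := mul_pos (Real.rpow_pos_of_pos ht _) p2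
    constructor
    · rw [key]
      have : 0 ≤ κ * (t * φ (c * t)) * (t ^ r * m t ^ (κ - 1)) := by positivity
      linarith
    · rw [key, add_mul]
      have : κ * (t * φ (c * t)) * (t ^ r * m t ^ (κ - 1)) ≤ κ * m t * (t ^ r * m t ^ (κ - 1)) :=
        mul_le_mul_of_nonneg_right (mul_le_mul_of_nonneg_left hbm hκ) p3.le
      have e5 : κ * m t * (t ^ r * m t ^ (κ - 1)) = κ * (t ^ r * m t ^ κ) := by
        rw [e4]; ring
      linarith

end IsTruncationCutoff

namespace Data

variable {N : ℕ} {D : Data N}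

/-! ### Elementary consequences of the standing assumptions -/

section Exponents

variable {a : ℝ} (hD : D.Admissible a)
include hD

theorem Admissible.dim_sub_pos : 0 < (N : ℝ) - D.p := sub_pos.2 hD.p_lt_dim

theorem Admissible.p_pos : 0 < D.p := zero_lt_one.trans hD.one_lt_p

theorem Admissible.p_lt_r : D.p < D.r := (le_max_left _ _).trans_lt hD.r_lower

theorem Admissible.one_lt_r : 1 < D.r := hD.one_lt_p.trans hD.p_lt_r

theorem Admissible.r_lt_crit : D.r < critExp N D.p := hD.r_lt_q.trans hD.q_lt_crit

theorem Admissible.crit_sub_p : critExp N D.p - D.p = D.p ^ 2 / (N - D.p) := by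
  have := hD.dim_sub_pos.ne'
  rw [critExp]
  field_simp
  ring

/-- Comes from the first lower bound on `γ`, since `a > 0`. It makes the bootstrap gain positive at
the start, where no `L^S` decay is known. -/
theorem Admissible.crit_sub_p_lt_γ : critExp N D.p - D.p < D.γ := by
  rw [hD.crit_sub_p]
  refine lt_of_le_of_lt ?_ ((le_max_left _ _).trans_lt hD.γ_lower)
  have := hD.a_pos
  have := hD.p_pos
  gcongr
  · exact hD.dim_sub_pos.le
  · nlinarith

theorem Admissible.γ_pos : 0 < D.γ := by
  have := hD.crit_sub_p_lt_γ
  have := hD.r_lt_crit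
  have := hD.p_lt_r
  linarith

/-- Comes from the second lower bound on `γ`. It makes the bootstrap gain positive at the final
rate, and controls the lossy term in the De Giorgi iteration. -/
theorem Admissible.crit_sub_r_lt : critExp N D.p - D.r < D.γ * (D.r - D.p) / D.p := by
  have h1 := hD.dim_sub_pos
  have h2 := hD.p_pos
  have h3 : 0 < D.r - D.p := sub_pos.2 hD.p_lt_r
  have h4 := (le_max_right _ _).trans_lt hD.γ_lower
  have h5 : D.p * D.r / (N - D.p) < D.γ * (D.r - D.p) / D.p := by
    rw [div_lt_iff₀ (mul_pos h3 h1)] at h4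
    rw [div_lt_div_iff₀ h1 h2]
    nlinarith
  have h6 := hD.crit_sub_p
  have h7 : D.p ^ 2 / (N - D.p) ≤ D.p * D.r / (N - D.p) := by
    gcongr
    nlinarith [hD.p_lt_r]
  linarith [hD.p_lt_r]

end Exponents

/-! ### The nonlinearity -/

/-- The frequency `ε e^{dist(ε x, Ω)}` of the truncation at `x`. -/
noncomputable def freq (D : Data N) (ε : ℝ) (x : E N) : ℝ :=
  ε * Real.exp (Metric.infDist (ε • x) D.Ω)

theorem freq_pos {ε : ℝ} (hε : 0 < ε) (x : E N) : 0 < D.freq ε x :=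
  mul_pos hε (Real.exp_pos _)

theorem le_freq {ε : ℝ} (hε : 0 < ε) (x : E N) : ε ≤ D.freq ε x :=
  le_mul_of_one_le_right hε.le (Real.one_le_exp Metric.infDist_nonneg)

theorem m_eq {ε : ℝ} (hε : 0 < ε) (x : E N) (t : ℝ) :
    D.m ε x t = (D.freq ε x)⁻¹ * truncPrimitive D.φ (D.freq ε x * t) := by
  have := intervalIntegral.integral_comp_mul_left (a := 0) (b := t) D.φ (freq_pos (D := D) hε x).ne'
  simp only [mul_zero, smul_eq_mul] at this
  rw [truncPrimitive, ← this]
  rfl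

variable {a : ℝ} (hD : D.Admissible a) {ε : ℝ} (hε : 0 < ε)
include hD hε

theorem Admissible.m_neg (x : E N) (t : ℝ) : D.m ε x (-t) = -D.m ε x t := by
  rw [m_eq hε, m_eq hε, mul_neg, hD.cutoff.primitive_neg, mul_neg]

/-- The primitive of the cut-off saturates at `2`, and the exponential factor in the frequency is at
least one. Only this uniform bound by `2 / ε` is used, not the spatial growth of the frequency. -/
theorem Admissible.abs_m_le (x : E N) (t : ℝ) : |D.m ε x t| ≤ 2 / ε := by
  wlog ht : 0 ≤ t generalizing t
  · have := this (-t) (by linarith)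
    rwa [hD.m_neg hε, abs_neg] at this
  have hc := freq_pos (D := D) hε x
  have h0 : 0 ≤ truncPrimitive D.φ (D.freq ε x * t) := by
    have := hD.cutoff.monotone_primitive (mul_nonneg hc.le ht)
    simpa [truncPrimitive] using this
  rw [m_eq hε, abs_of_nonneg (mul_nonneg (inv_nonneg.2 hc.le) h0), ← div_eq_inv_mul]
  gcongr
  · exact hD.cutoff.primitive_le_two _
  · exact le_freq hε x

theorem Admissible.F_neg (x : E N) (t : ℝ) : D.F ε x (-t) = D.F ε x t := by
  simp only [F, hD.m_neg hε, abs_neg]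

/-- The derivative of an even function is odd; `deriv_comp_neg` needs no differentiability. In
particular `f` vanishes at zero without a computation there. -/
theorem Admissible.f_neg (x : E N) (t : ℝ) : D.f ε x (-t) = -D.f ε x t := by
  have h1 : (fun s => D.F ε x s) = fun s => D.F ε x (-s) := by
    funext s; rw [hD.F_neg hε]
  simp only [f]
  conv_rhs => rw [h1]
  rw [deriv_comp_neg (fun s => D.F ε x s) t, neg_neg]

theorem Admissible.f_zero (x : E N) : D.f ε x 0 = 0 := by
  have := hD.f_neg hε x 0
  rw [neg_zero] at this
  linarith

omit hε in
theorem Admissible.coeffs_nonneg : 0 < 1 / critExp N D.p ∧ 0 < D.μ / D.q := by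
  have h1 := hD.r_lt_crit
  have h2 := hD.one_lt_r
  have h3 := hD.r_lt_q
  have := hD.μ_pos
  constructor
  · exact one_div_pos.2 (by linarith)
  · exact div_pos this (by linarith)

omit hε in
theorem Admissible.F_nonneg (x : E N) (t : ℝ) : 0 ≤ D.F ε x t := by
  obtain ⟨h1, h2⟩ := hD.coeffs_nonneg
  rw [F]
  positivity

omit hε in
theorem Admissible.F_zero (x : E N) : D.F ε x 0 = 0 := by
  have := hD.one_lt_r
  rw [F, abs_zero, Real.zero_rpow (by linarith)]
  simp

omit hD in
theorem F_eq (x : E N) (s : ℝ) : D.F ε x s =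
    1 / critExp N D.p * (|s| ^ D.r *
        |(D.freq ε x)⁻¹ * truncPrimitive D.φ (D.freq ε x * s)| ^ (critExp N D.p - D.r))
      + D.μ / D.q * (|s| ^ D.r *
        |(D.freq ε x)⁻¹ * truncPrimitive D.φ (D.freq ε x * s)| ^ (D.q - D.r)) := by
  rw [F, m_eq hε]; ring

/-- Both summands of `F` have the form `t^r m^κ`, with `κ = S - r` and `κ = q - r`, so their
logarithmic derivatives lie between `r/t` and `S/t` because `q < S`. The lower bound is the
Ambrosetti–Rabinowitz condition; the upper one converts growth of `F` into growth of `f`. -/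
theorem Admissible.mul_f_mem (x : E N) (t : ℝ) :
    t * D.f ε x t ∈ Icc (D.r * D.F ε x t) (critExp N D.p * D.F ε x t) := by
  wlog ht : 0 < t generalizing t
  · rcases eq_or_lt_of_le (not_lt.1 ht) with rfl | h
    · simp [hD.F_zero]
    · have := this (-t) (by linarith)
      rwa [hD.f_neg hε, hD.F_neg hε, neg_mul_neg] at this
  obtain ⟨c1, c2⟩ := hD.coeffs_nonneg
  have hc := freq_pos (D := D) hε x
  obtain ⟨d1, h1, l1, u1⟩ := hD.cutoff.exists_hasDerivAt_rpow_mul (r := D.r) hc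
    (sub_nonneg.2 hD.r_lt_crit.le) ht
  obtain ⟨d2, h2, l2, u2⟩ := hD.cutoff.exists_hasDerivAt_rpow_mul (r := D.r) hc
    (sub_nonneg.2 hD.r_lt_q.le) ht
  have hd := (h1.const_mul (1 / critExp N D.p)).add (h2.const_mul (D.μ / D.q))
  have hf : D.f ε x t = 1 / critExp N D.p * d1 + D.μ / D.q * d2 := by
    rw [f, ← hd.deriv]
    congr 1
    funext s
    rw [F_eq hε]; rfl
  rw [hf, F_eq hε]
  set g1 := |t| ^ D.r *
        |(D.freq ε x)⁻¹ * truncPrimitive D.φ (D.freq ε x * t)| ^ (critExp N D.p - D.r)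
  set g2 := |t| ^ D.r *
        |(D.freq ε x)⁻¹ * truncPrimitive D.φ (D.freq ε x * t)| ^ (D.q - D.r) with hg2
  have hg2' : 0 ≤ g2 := by positivity
  rw [add_sub_cancel] at u1 u2
  have u3 : D.q * g2 ≤ critExp N D.p * g2 := mul_le_mul_of_nonneg_right hD.q_lt_crit.le hg2'
  have a1 := mul_le_mul_of_nonneg_left l1 c1.le
  have a2 := mul_le_mul_of_nonneg_left l2 c2.le
  have a3 := mul_le_mul_of_nonneg_left u1 c1.le
  have a4 := mul_le_mul_of_nonneg_left (u2.trans u3) c2.le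
  constructor <;> nlinarith

omit hε in
/-- The constant in the growth bound of `F_ε`. -/
noncomputable def growthConst (D : Data N) : ℝ :=
  1 / critExp N D.p * 2 ^ (critExp N D.p - D.r) + D.μ / D.q * 2 ^ (D.q - D.r)

omit hε in
theorem Admissible.growthConst_pos : 0 < D.growthConst := by
  obtain ⟨h1, h2⟩ := hD.coeffs_nonneg
  rw [growthConst]
  positivity

/-- The power `|t|^r` is kept and the remaining powers of `m` are bounded by powers of `2 / ε`. As
`ε ≤ 1`, the exponent `S - r` is the worse of the two. -/
theorem Admissible.F_le (hε1 : ε ≤ 1) (x : E N) (t : ℝ) :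
    D.F ε x t ≤ D.growthConst * ε ^ (-(critExp N D.p - D.r)) * |t| ^ D.r := by
  obtain ⟨c1, c2⟩ := hD.coeffs_nonneg
  have h1 : 0 < critExp N D.p - D.r := sub_pos.2 hD.r_lt_crit
  have h2 : 0 < D.q - D.r := sub_pos.2 hD.r_lt_q
  have key : ∀ κ, 0 < κ → κ ≤ critExp N D.p - D.r →
      |D.m ε x t| ^ κ ≤ 2 ^ κ * ε ^ (-(critExp N D.p - D.r)) := by
    intro κ hκ hκ'
    calc |D.m ε x t| ^ κ ≤ (2 / ε) ^ κ :=
          Real.rpow_le_rpow (abs_nonneg _) (hD.abs_m_le hε x t) hκ.le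
      _ = 2 ^ κ * ε ^ (-κ) := by
          rw [Real.div_rpow (by norm_num) hε.le, Real.rpow_neg hε.le, div_eq_mul_inv]
      _ ≤ _ := by
          gcongr 2 ^ κ * ?_
          exact Real.rpow_le_rpow_of_exponent_ge hε hε1 (by linarith)
  have k1 := key _ h1 le_rfl
  have k2 := key _ h2 (by linarith [hD.q_lt_crit])
  have hr : 0 ≤ |t| ^ D.r := by positivity
  calc D.F ε x t ≤ 1 / critExp N D.p * |t| ^ D.r *
          (2 ^ (critExp N D.p - D.r) * ε ^ (-(critExp N D.p - D.r)))
        + D.μ / D.q * |t| ^ D.r * (2 ^ (D.q - D.r) * ε ^ (-(critExp N D.p - D.r))) := by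
        rw [F]; gcongr
    _ = _ := by rw [growthConst]; ring

theorem Admissible.abs_f_le (hε1 : ε ≤ 1) (x : E N) (t : ℝ) :
    |D.f ε x t| ≤ critExp N D.p * D.growthConst * ε ^ (-(critExp N D.p - D.r))
      * |t| ^ (D.r - 1) := by
  have hS : 0 < critExp N D.p := by linarith [hD.r_lt_crit, hD.one_lt_r]
  have hK := hD.growthConst_pos
  rcases eq_or_ne t 0 with rfl | ht
  · rw [hD.f_zero hε, abs_zero]; positivity
  have ht' : 0 < |t| := abs_pos.2 ht
  have h1 := (hD.mul_f_mem hε x t)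
  have h2 : 0 ≤ t * D.f ε x t :=
    (mul_nonneg (by linarith [hD.one_lt_r]) (hD.F_nonneg x t)).trans h1.1
  have h3 : |t| * |D.f ε x t| ≤ |t| * (critExp N D.p * D.growthConst *
      ε ^ (-(critExp N D.p - D.r)) * |t| ^ (D.r - 1)) := by
    rw [← abs_mul, abs_of_nonneg h2]
    refine h1.2.trans ?_
    have := mul_le_mul_of_nonneg_left (hD.F_le hε hε1 x t) hS.le
    refine this.trans_eq ?_
    rw [Real.rpow_sub_one ht'.ne']
    field_simp
  exact le_of_mul_le_mul_left h3 ht'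

theorem Admissible.continuous_F : Continuous fun z : E N × ℝ => D.F ε z.1 z.2 := by
  have h1 : Continuous fun z : E N × ℝ => D.freq ε z.1 := by
    unfold freq
    exact continuous_const.mul (Real.continuous_exp.comp
      ((Metric.continuous_infDist_pt _).comp (continuous_fst.const_smul ε)))
  have h2 : Continuous fun z : E N × ℝ => D.m ε z.1 z.2 := by
    simp only [m_eq hε]
    exact (h1.inv₀ fun z => (freq_pos hε _).ne').mul
      (hD.cutoff.continuous_primitive.comp (h1.mul continuous_snd))
  have hr := hD.one_lt_r
  have h3 : Continuous fun z : E N × ℝ => |z.2| ^ D.r :=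
    continuous_snd.abs.rpow_const fun _ => Or.inr (by linarith)
  have h4 : ∀ κ : ℝ, 0 ≤ κ → Continuous fun z : E N × ℝ => |D.m ε z.1 z.2| ^ κ := fun κ hκ =>
    h2.abs.rpow_const (p := κ) fun _ => Or.inr hκ
  unfold F
  exact ((continuous_const.mul h3).mul (h4 _ (sub_nonneg.2 hD.r_lt_crit.le))).add
    ((continuous_const.mul h3).mul (h4 _ (sub_nonneg.2 hD.r_lt_q.le)))

theorem Admissible.aestronglyMeasurable_F {u : E N → ℝ} (hu : AEStronglyMeasurable u volume) :
    AEStronglyMeasurable (fun x => D.F ε x (u x)) volume :=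
  (hD.continuous_F hε).comp_aestronglyMeasurable (aestronglyMeasurable_id.prodMk hu)

/-- Joint continuity of `F` makes its derivative in the parameter jointly measurable, so no explicit
formula for `f` is required. -/
theorem Admissible.aestronglyMeasurable_f {u : E N → ℝ} (hu : AEStronglyMeasurable u volume) :
    AEStronglyMeasurable (fun x => D.f ε x (u x)) volume := by
  have h1 : Measurable fun z : E N × ℝ => D.f ε z.1 z.2 :=
    measurable_deriv_with_param (f := fun x s => D.F ε x s) (hD.continuous_F hε)
  exact (h1.comp_aemeasurable (aemeasurable_id.prodMk hu.aemeasurable)).aestronglyMeasurable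

end Data

end PLap

namespace PLap
open Filter Topology ENNReal Convolution

/-! ### Mollification in `L^p` -/

section Mollify

variable {N : ℕ} {F : Type*} [NormedAddCommGroup F] [NormedSpace ℝ F]

omit [NormedSpace ℝ F] in
/-- Translations act continuously on `L^p`. -/
theorem exists_eLpNorm_translate_sub_le {P : ℝ≥0∞} (hP : 1 ≤ P) (hP' : P ≠ ⊤) {g : E N → F}
    (hg : MemLp g P volume) {κ : ℝ≥0∞} (hκ : 0 < κ) :
    ∃ ρ > 0, ∀ y : E N, ‖y‖ < ρ → eLpNorm (fun x => g (x - y) - g x) P volume ≤ κ := by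
  have : Fact (1 ≤ P) := ⟨hP⟩
  have : Fact (P ≠ ⊤) := ⟨hP'⟩
  let T : E N → Lp F P (volume : Measure (E N)) := fun y => DomAddAct.mk (-y) +ᵥ hg.toLp g
  have h1 : Continuous T :=
    (DomAddAct.continuous_mk.comp continuous_neg).vadd continuous_const
  have h2 : ∀ᶠ y in 𝓝 0, edist (T y) (T 0) < κ :=
    h1.continuousAt (Metric.eball_mem_nhds _ hκ)
  obtain ⟨ρ, hρ, h3⟩ := Metric.eventually_nhds_iff.1 h2
  refine ⟨ρ, hρ, fun y hy => ?_⟩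
  have h4 := h3 (y := y) (by simpa using hy)
  simp only [T] at h4
  rw [DomAddAct.mk_vadd_toLp, DomAddAct.mk_vadd_toLp, Lp.edist_toLp_toLp] at h4
  refine le_of_eq_of_le (congrArg (fun f => eLpNorm f P volume) ?_) h4.le
  funext x
  simp [sub_eq_neg_add]

/-- Mollification moves a function in `L^p` no further than small translations do. -/
theorem eLpNorm_mollify_sub_le {p : ℝ} (hp : 1 ≤ p) {g : E N → F} [CompleteSpace F]
    (hg : MemLp g (ENNReal.ofReal p) volume) (φ : ContDiffBump (0 : E N)) {κ : ℝ≥0∞}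
    (hκ : ∀ y : E N, ‖y‖ < φ.rOut →
      eLpNorm (fun x => g (x - y) - g x) (ENNReal.ofReal p) volume ≤ κ) :
    eLpNorm (fun x => (φ.normed volume ⋆[ContinuousLinearMap.lsmul ℝ ℝ, volume] g) x - g x)
      (ENNReal.ofReal p) volume ≤ κ := by
  have hp0 : 0 < p := by linarith
  have hP0 : ENNReal.ofReal p ≠ 0 := by simpa using hp0
  have hPt : ENNReal.ofReal p ≠ ⊤ := ENNReal.ofReal_ne_top
  have hP1 : 1 ≤ ENNReal.ofReal p := ENNReal.one_le_ofReal.2 hp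
  set ρ := φ.normed (volume : Measure (E N)) with hρ
  have hρc : Continuous ρ := φ.continuous_normed
  set w : E N → ℝ≥0∞ := fun y => ‖ρ y‖ₑ with hw
  have hwm : Measurable w := hρc.measurable.enorm
  have hw1 : ∫⁻ y, w y = 1 := by
    have h1 := φ.integral_normed (μ := (volume : Measure (E N)))
    have h2 := ofReal_integral_eq_lintegral_ofReal (μ := (volume : Measure (E N)))
      φ.integrable_normed (ae_of_all _ φ.nonneg_normed)
    rw [h1, ENNReal.ofReal_one] at h2
    rw [h2]
    refine lintegral_congr fun y => ?_
    exact Real.enorm_eq_ofReal (φ.nonneg_normed y)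
  -- With the bump as density `ν` is a probability measure, and Jensen's inequality takes the form
  -- of monotonicity of `eLpNorm'` in the exponent.
  set ν := (volume : Measure (E N)).withDensity w with hν
  have : IsProbabilityMeasure ν := ⟨by rw [hν, withDensity_apply _ .univ, setLIntegral_univ, hw1]⟩
  have hsub : AEStronglyMeasurable (fun z : E N × E N => g (z.1 - z.2) - g z.1)
      (volume.prod volume) :=
    (hg.1.comp_quasiMeasurePreserving
      (quasiMeasurePreserving_sub_of_right_invariant volume volume)).sub hg.1.comp_fst
  have hcl : ∀ᵐ x : E N, AEStronglyMeasurable (fun y => g (x - y) - g x) volume :=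
    hsub.prodMk_left
  have hpt : ∀ᵐ x : E N,
      ‖(ρ ⋆[ContinuousLinearMap.lsmul ℝ ℝ, volume] g) x - g x‖ₑ ^ p
        ≤ ∫⁻ y, w y * ‖g (x - y) - g x‖ₑ ^ p := by
    filter_upwards [hcl] with x hx
    have e1 : (ρ ⋆[ContinuousLinearMap.lsmul ℝ ℝ, volume] g) x - g x
        = ∫ y, ρ y • (g (x - y) - g x) := by
      have i1 : Integrable (fun y => ρ y • g (x - y)) volume :=
        φ.hasCompactSupport_normed.convolutionExists_left (ContinuousLinearMap.lsmul ℝ ℝ)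
          hρc (hg.locallyIntegrable hP1) x
      have i2 : Integrable (fun y => ρ y • g x) volume := φ.integrable_normed.smul_const _
      simp only [smul_sub]
      rw [integral_sub i1 i2, integral_smul_const, φ.integral_normed, one_smul]
      rfl
    have hxν : AEStronglyMeasurable (fun y => g (x - y) - g x) ν :=
      hx.mono_ac (withDensity_absolutelyContinuous _ _)
    have e2 := eLpNorm'_le_eLpNorm'_of_exponent_le one_pos hp ν hxν
    simp only [eLpNorm', ENNReal.rpow_one, div_one] at e2
    rw [one_div, ENNReal.le_rpow_inv_iff hp0,
      lintegral_withDensity_eq_lintegral_mul₀ hwm.aemeasurable hx.enorm,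
      lintegral_withDensity_eq_lintegral_mul₀ hwm.aemeasurable (hx.enorm.pow_const p)] at e2
    refine le_trans ?_ e2
    gcongr
    rw [e1]
    refine (enorm_integral_le_lintegral_enorm _).trans (le_of_eq ?_)
    refine lintegral_congr fun y => ?_
    rw [enorm_smul]; rfl
  have hint : ∀ y : E N, ‖y‖ < φ.rOut →
      ∫⁻ x, ‖g (x - y) - g x‖ₑ ^ p ≤ κ ^ p := by
    intro y hy
    have := hκ y hy
    rw [eLpNorm_eq_lintegral_rpow_enorm_toReal hP0 hPt, ENNReal.toReal_ofReal hp0.le, one_div,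
      ENNReal.rpow_inv_le_iff hp0] at this
    exact this
  rw [eLpNorm_eq_lintegral_rpow_enorm_toReal hP0 hPt, ENNReal.toReal_ofReal hp0.le, one_div,
    ENNReal.rpow_inv_le_iff hp0]
  calc ∫⁻ x, ‖(ρ ⋆[ContinuousLinearMap.lsmul ℝ ℝ, volume] g) x - g x‖ₑ ^ p
      ≤ ∫⁻ x, ∫⁻ y, w y * ‖g (x - y) - g x‖ₑ ^ p := lintegral_mono_ae hpt
    _ = ∫⁻ y, ∫⁻ x, w y * ‖g (x - y) - g x‖ₑ ^ p := by
        refine lintegral_lintegral_swap ?_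
        exact (hwm.comp measurable_snd).aemeasurable.mul (hsub.enorm.pow_const p)
    _ ≤ ∫⁻ y, w y * κ ^ p := by
        refine lintegral_mono fun y => ?_
        rw [lintegral_const_mul' _ _ enorm_ne_top]
        by_cases hy : ‖y‖ < φ.rOut
        · gcongr
          exact hint y hy
        · have : w y = 0 := by
            have : y ∉ Function.support ρ := by
              rw [hρ, φ.support_normed_eq]
              simpa using hy
            simp [hw, Function.notMem_support.1 this]
          refine (le_of_eq ?_).trans zero_le
          change w y * _ = 0
          rw [this, zero_mul]
    _ = κ ^ p := by rw [lintegral_mul_const _ hwm, hw1, one_mul]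

/-- A sequence of bump functions shrinking to the origin. -/
noncomputable def shrinkingBump (N : ℕ) (n : ℕ) : ContDiffBump (0 : E N) where
  rIn := 1 / (2 * (n + 1))
  rOut := 1 / (n + 1)
  rIn_pos := by positivity
  rIn_lt_rOut := by
    apply one_div_lt_one_div_of_lt <;> [positivity; linarith [n.cast_nonneg (α := ℝ)]]

/-- The mollifications of a function. -/
noncomputable def mollify (n : ℕ) (g : E N → F) : E N → F :=
  (shrinkingBump N n).normed volume ⋆[ContinuousLinearMap.lsmul ℝ ℝ, volume] g

theorem tendsto_mollify [CompleteSpace F] {p : ℝ} (hp : 1 ≤ p) {g : E N → F}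
    (hg : MemLp g (ENNReal.ofReal p) volume) :
    Tendsto (fun n => eLpNorm (mollify n g - g) (ENNReal.ofReal p) volume) atTop (𝓝 0) := by
  rw [ENNReal.tendsto_nhds_zero]
  intro κ hκ
  obtain ⟨ρ, hρ, h⟩ := exists_eLpNorm_translate_sub_le (ENNReal.one_le_ofReal.2 hp)
    ENNReal.ofReal_ne_top hg hκ
  have h1 : Tendsto (fun n : ℕ => 1 / ((n : ℝ) + 1)) atTop (𝓝 0) :=
    tendsto_one_div_add_atTop_nhds_zero_nat
  filter_upwards [h1.eventually_lt_const hρ] with n hn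
  exact eLpNorm_mollify_sub_le hp hg (shrinkingBump N n) fun y hy => h y (hy.trans hn)

/-- By translation invariance every translate of `g` differs from `g` by at most twice the norm of
`g`. With that crude bound, `eLpNorm_mollify_sub_le` puts `mollify n g - g` in `L^p`. -/
theorem memLp_mollify [CompleteSpace F] {p : ℝ} (hp : 1 ≤ p) {g : E N → F}
    (hg : MemLp g (ENNReal.ofReal p) volume) (n : ℕ) :
    MemLp (mollify n g) (ENNReal.ofReal p) volume := by
  have hP1 : 1 ≤ ENNReal.ofReal p := ENNReal.one_le_ofReal.2 hp
  have hc : Continuous (mollify n g) :=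
    (shrinkingBump N n).hasCompactSupport_normed.continuous_convolution_left _
      (shrinkingBump N n).continuous_normed (hg.locallyIntegrable hP1)
  have h1 : MemLp (mollify n g - g) (ENNReal.ofReal p) volume := by
    refine ⟨hc.aestronglyMeasurable.sub hg.1, ?_⟩
    refine lt_of_le_of_lt (eLpNorm_mollify_sub_le hp hg (shrinkingBump N n) fun y _ => ?_)
      (ENNReal.add_lt_top.2 ⟨hg.2, hg.2⟩)
    have hmp : MeasurePreserving (fun x : E N => x - y) volume volume :=
      measurePreserving_sub_right volume y
    refine (eLpNorm_sub_le (hg.1.comp_measurePreserving hmp) hg.1 hP1).trans ?_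
    gcongr
    exact (eLpNorm_comp_measurePreserving hg.1 hmp).le
  simpa using h1.add hg

theorem contDiff_mollify [CompleteSpace F] {g : E N → F} (hg : LocallyIntegrable g volume) (n : ℕ) :
    ContDiff ℝ ∞ (mollify n g) :=
  (shrinkingBump N n).hasCompactSupport_normed.contDiff_convolution_left _
    (shrinkingBump N n).contDiff_normed hg

/-- The derivative of the mollification is the mollification of the weak gradient. -/
theorem fderiv_mollify {u : E N → ℝ} {G : E N → E N} (hu : LocallyIntegrable u volume)
    (hG : LocallyIntegrable G volume) (h : IsWeakGradient u G) (n : ℕ) (x v : E N) :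
    fderiv ℝ (mollify n u) x v = ⟪mollify n G x, v⟫ := by
  set φ := shrinkingBump N n
  set ρ := φ.normed (volume : Measure (E N)) with hρ
  have hρs : ContDiff ℝ ∞ ρ := φ.contDiff_normed
  have hρ1 : ContDiff ℝ 1 ρ := φ.contDiff_normed
  have hρk : HasCompactSupport ρ := φ.hasCompactSupport_normed
  have hd := hρk.hasFDerivAt_convolution_left (ContinuousLinearMap.lsmul ℝ ℝ) hρ1 hu x
  have e1 : fderiv ℝ (mollify n u) x v = ∫ y, u (x - y) * fderiv ℝ ρ y v := by
    have : fderiv ℝ (mollify n u) x = _ := hd.fderiv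
    rw [this, convolution_def, ContinuousLinearMap.integral_apply]
    · refine integral_congr_ae (ae_of_all _ fun y => ?_)
      simp [mul_comm]
    · exact (hρk.fderiv ℝ).convolutionExists_left _ (hρ1.continuous_fderiv one_ne_zero) hu x
  have e2 : ⟪mollify n G x, v⟫ = ∫ y, ρ y * ⟪G (x - y), v⟫ := by
    have i1 : Integrable (fun y => ρ y • G (x - y)) volume :=
      hρk.convolutionExists_left (ContinuousLinearMap.lsmul ℝ ℝ) hρ1.continuous hG x
    have : mollify n G x = ∫ y, ρ y • G (x - y) := rfl
    rw [this, real_inner_comm, ← integral_inner i1]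
    refine integral_congr_ae (ae_of_all _ fun y => ?_)
    simp only
    rw [inner_smul_right, real_inner_comm]
  -- The weak gradient identity is tested with the reflected bump centred at `x`.
  have hη : ContDiff ℝ ∞ fun y => ρ (x - y) := hρs.comp (contDiff_const.sub contDiff_id)
  have hηk : HasCompactSupport fun y => ρ (x - y) :=
    hρk.comp_homeomorph (Homeomorph.subLeft x)
  have h1 := h _ hη hηk v
  have e3 : ∀ y, fderiv ℝ (fun y => ρ (x - y)) y v = -(fderiv ℝ ρ (x - y) v) := by
    intro y
    have hd1 : HasFDerivAt (fun y : E N => x - y) (-ContinuousLinearMap.id ℝ (E N)) y :=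
      (hasFDerivAt_id y).const_sub x
    have hd2 := ((hρ1.differentiable one_ne_zero) (x - y)).hasFDerivAt.comp y hd1
    have : fderiv ℝ (fun y => ρ (x - y)) y = _ := hd2.fderiv
    rw [this]
    simp
  simp only [e3, mul_neg, integral_neg, neg_inj] at h1
  rw [e1, e2, ← integral_sub_left_eq_self (fun y => u (x - y) * fderiv ℝ ρ y v) volume x,
    ← integral_sub_left_eq_self (fun y => ρ y * ⟪G (x - y), v⟫) volume x]
  simpa using h1

end Mollify

end PLap

namespace PLap
open Filter Topology

/-! ### Chain rule for weak gradients -/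

section Chain

variable {N : ℕ} {p : ℝ}

theorem one_le_exponent (hp : 1 ≤ p) : 1 ≤ ENNReal.ofReal p := ENNReal.one_le_ofReal.2 hp

theorem exponent_ne_zero (hp : 1 ≤ p) : ENNReal.ofReal p ≠ 0 :=
  (zero_lt_one.trans_le (one_le_exponent hp)).ne'

theorem SobolevFun.locallyIntegrable (hp : 1 ≤ p) (u : SobolevFun N p) :
    LocallyIntegrable u.toFun volume := u.memLp_toFun.locallyIntegrable (one_le_exponent hp)

theorem SobolevFun.locallyIntegrable_grad (hp : 1 ≤ p) (u : SobolevFun N p) :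
    LocallyIntegrable u.grad volume := u.memLp_grad.locallyIntegrable (one_le_exponent hp)

/-- Convergence in `L^p` implies convergence of integrals against a fixed test function. -/
theorem tendsto_integral_mul_of_tendsto_eLpNorm (hp : 1 ≤ p) {f : ℕ → E N → ℝ} {g h : E N → ℝ}
    (hf : ∀ n, MemLp (f n) (ENNReal.ofReal p) volume) (hg : MemLp g (ENNReal.ofReal p) volume)
    (hfg : Tendsto (fun n => eLpNorm (f n - g) (ENNReal.ofReal p) volume) atTop (𝓝 0))
    (hh : Continuous h) (hhk : HasCompactSupport h) :
    Tendsto (fun n => ∫ x, h x * f n x) atTop (𝓝 (∫ x, h x * g x)) := by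
  have := (ENNReal.HolderConjugate.conjExponent (one_le_exponent hp)).symm
  have hhL : MemLp h (ENNReal.ofReal p).conjExponent volume := hh.memLp_of_hasCompactSupport hhk
  refine tendsto_integral_of_L1' _ (hh.aestronglyMeasurable.mul hg.1)
    (Eventually.of_forall fun n => hhL.integrable_mul (hf n)) ?_
  have hb : Tendsto (fun n => eLpNorm h (ENNReal.ofReal p).conjExponent volume *
      eLpNorm (f n - g) (ENNReal.ofReal p) volume) atTop (𝓝 0) := by
    simpa using ENNReal.Tendsto.const_mul hfg (Or.inr hhL.eLpNorm_ne_top)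
  refine tendsto_of_tendsto_of_tendsto_of_le_of_le tendsto_const_nhds hb (fun n => zero_le)
    fun n => ?_
  refine le_trans (le_of_eq ?_) (eLpNorm_smul_le_mul_eLpNorm (r := 1) ((hf n).1.sub hg.1)
    hhL.1)
  congr 1
  funext x
  simp [mul_sub]

/-- Integration by parts for a `C^1` function against a test function. -/
theorem integral_mul_fderiv_of_contDiff {w η : E N → ℝ} (hw : ContDiff ℝ 1 w)
    (hη : ContDiff ℝ ∞ η) (hηk : HasCompactSupport η) (v : E N) :
    ∫ x, w x * fderiv ℝ η x v = -∫ x, η x * fderiv ℝ w x v := by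
  have hη1 : ContDiff ℝ 1 η := hη.of_le (by exact_mod_cast le_top)
  have c1 : Continuous fun x => fderiv ℝ w x v :=
    (hw.continuous_fderiv one_ne_zero).clm_apply continuous_const
  have c2 : Continuous fun x => fderiv ℝ η x v :=
    (hη1.continuous_fderiv one_ne_zero).clm_apply continuous_const
  have k2 : HasCompactSupport fun x => fderiv ℝ η x v :=
    (hηk.fderiv ℝ).comp_left (g := fun L : E N →L[ℝ] ℝ => L v) rfl
  rw [integral_mul_fderiv_eq_neg_fderiv_mul_of_integrable]
  · simp only [mul_comm]
  · exact (c1.mul hη1.continuous).integrable_of_hasCompactSupport hηk.mul_left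
  · exact (hw.continuous.mul c2).integrable_of_hasCompactSupport k2.mul_left
  · exact (hw.continuous.mul hη1.continuous).integrable_of_hasCompactSupport hηk.mul_left
  · exact fun x _ => hw.differentiable one_ne_zero x
  · exact fun x _ => hη1.differentiable one_ne_zero x

/-- The classical chain rule holds for mollifications, and one passes to the limit along a
subsequence converging almost everywhere. The gradient is split as `∇u` plus an error: the error
tends to zero in `L^p` and is multiplied by the bounded factor `Φ'`, while the factor in front of
the fixed `∇u` converges pointwise and is handled by dominated convergence. -/
theorem SobolevFun.isWeakGradient_comp (hp : 1 ≤ p) (u : SobolevFun N p) {Φ : ℝ → ℝ}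
    (hΦ : ContDiff ℝ 1 Φ) (hΦ0 : Φ 0 = 0) (hΦ' : ∀ t, |deriv Φ t| ≤ 1) :
    IsWeakGradient (fun x => Φ (u.toFun x)) fun x => deriv Φ (u.toFun x) • u.grad x := by
  intro η hη hηk v
  have hlip : ∀ s t, |Φ s - Φ t| ≤ |s - t| := by
    intro s t
    have := Convex.norm_image_sub_le_of_norm_deriv_le (f := Φ) (C := 1) (s := univ)
      (fun x _ => hΦ.differentiable one_ne_zero x) (fun x _ => hΦ' x) convex_univ
      (mem_univ t) (mem_univ s)
    simpa using this
  have hcΦ' : Continuous (deriv Φ) := hΦ.continuous_deriv_one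
  have hul := u.locallyIntegrable hp
  have hGl := u.locallyIntegrable_grad hp
  obtain ⟨ns, hns, hae⟩ := (tendstoInMeasure_of_tendsto_eLpNorm (exponent_ne_zero hp)
    (fun n => (contDiff_mollify hul n).continuous.aestronglyMeasurable) u.memLp_toFun.1
    (tendsto_mollify hp u.memLp_toFun)).exists_seq_tendsto_ae
  set s : ℕ → E N → ℝ := fun n => mollify (ns n) u.toFun with hs
  set G : ℕ → E N → E N := fun n => mollify (ns n) u.grad with hG
  have hsu : Tendsto (fun n => eLpNorm (s n - u.toFun) (ENNReal.ofReal p) volume) atTop (𝓝 0) :=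
    (tendsto_mollify hp u.memLp_toFun).comp hns.tendsto_atTop
  have hGu : Tendsto (fun n => eLpNorm (G n - u.grad) (ENNReal.ofReal p) volume) atTop (𝓝 0) :=
    (tendsto_mollify hp u.memLp_grad).comp hns.tendsto_atTop
  have hs1 : ∀ n, ContDiff ℝ 1 (s n) := fun n =>
    (contDiff_mollify hul _).of_le (by exact_mod_cast le_top)
  have hGc : ∀ n, Continuous (G n) := fun n => (contDiff_mollify hGl _).continuous
  have hΦu : MemLp (fun x => Φ (u.toFun x)) (ENNReal.ofReal p) volume := by
    refine u.memLp_toFun.of_le (hΦ.continuous.comp_aestronglyMeasurable u.memLp_toFun.1)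
      (ae_of_all _ fun x => ?_)
    simpa [hΦ0] using hlip (u.toFun x) 0
  have hη1 : ContDiff ℝ 1 η := hη.of_le (by exact_mod_cast le_top)
  have c2 : Continuous fun x => fderiv ℝ η x v :=
    (hη1.continuous_fderiv one_ne_zero).clm_apply continuous_const
  have k2 : HasCompactSupport fun x => fderiv ℝ η x v :=
    (hηk.fderiv ℝ).comp_left (g := fun L : E N →L[ℝ] ℝ => L v) rfl
  have hsL : ∀ n, MemLp (fun x => Φ (s n x)) (ENNReal.ofReal p) volume := fun n =>
    (memLp_mollify hp u.memLp_toFun (ns n)).of_le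
      (hΦ.continuous.comp (hs1 n).continuous).aestronglyMeasurable
      (ae_of_all _ fun x => by simpa [hΦ0] using hlip (s n x) 0)
  have hdL : ∀ n, MemLp (fun x => deriv Φ (s n x) * ⟪G n x - u.grad x, v⟫)
      (ENNReal.ofReal p) volume ∧
      eLpNorm (fun x => deriv Φ (s n x) * ⟪G n x - u.grad x, v⟫) (ENNReal.ofReal p) volume ≤
        ENNReal.ofReal ‖v‖ * eLpNorm (G n - u.grad) (ENNReal.ofReal p) volume := by
    intro n
    have hm : MemLp (G n - u.grad) (ENNReal.ofReal p) volume :=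
      (memLp_mollify hp u.memLp_grad (ns n)).sub u.memLp_grad
    have hb : ∀ x, ‖deriv Φ (s n x) * ⟪G n x - u.grad x, v⟫‖ ≤ ‖v‖ * ‖(G n - u.grad) x‖ := by
      intro x
      rw [norm_mul]
      calc _ ≤ 1 * (‖G n x - u.grad x‖ * ‖v‖) := by
            gcongr
            · exact hΦ' _
            · exact norm_inner_le_norm _ _
        _ = _ := by simp [mul_comm]
    exact ⟨hm.of_le_mul ((hcΦ'.comp (hs1 n).continuous).aestronglyMeasurable.mul
      (hm.1.inner aestronglyMeasurable_const)) (ae_of_all _ hb),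
      eLpNorm_le_mul_eLpNorm_of_ae_le_mul (ae_of_all _ hb) _⟩
  have hdom : Integrable (fun x => ‖v‖ * ‖η x • u.grad x‖) volume :=
    (hGl.integrable_smul_left_of_hasCompactSupport hη.continuous hηk).norm.const_mul _
  have hm2 : ∀ n, AEStronglyMeasurable
      (fun x => η x * (deriv Φ (s n x) * ⟪u.grad x, v⟫)) volume := fun n =>
    hη.continuous.aestronglyMeasurable.mul
      ((hcΦ'.comp (hs1 n).continuous).aestronglyMeasurable.mul
        (u.memLp_grad.1.inner aestronglyMeasurable_const))
  have hb2 : ∀ n, ∀ x, ‖η x * (deriv Φ (s n x) * ⟪u.grad x, v⟫)‖ ≤ ‖v‖ * ‖η x • u.grad x‖ := by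
    intro n x
    rw [norm_mul, norm_mul, norm_smul]
    calc _ ≤ ‖η x‖ * (1 * (‖u.grad x‖ * ‖v‖)) := by
          gcongr
          · exact hΦ' _
          · exact norm_inner_le_norm _ _
      _ = _ := by ring
  have hid : ∀ n, ∫ x, fderiv ℝ η x v * Φ (s n x) =
      -(∫ x, η x * (deriv Φ (s n x) * ⟪G n x - u.grad x, v⟫)) -
        ∫ x, η x * (deriv Φ (s n x) * ⟪u.grad x, v⟫) := by
    intro n
    have h1 := integral_mul_fderiv_of_contDiff (hΦ.comp (hs1 n)) hη hηk v
    have h2 : ∀ x, fderiv ℝ (Φ ∘ s n) x v = deriv Φ (s n x) * ⟪G n x, v⟫ := by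
      intro x
      have hd := ((hΦ.differentiable one_ne_zero (s n x)).hasDerivAt.hasFDerivAt).comp x
        ((hs1 n).differentiable one_ne_zero x).hasFDerivAt
      rw [hd.fderiv, ← fderiv_mollify hul hGl u.isWeakGradient]
      simp [hs, mul_comm]
    simp only [h2, Function.comp] at h1
    simp only [mul_comm (Φ _)] at h1
    have := (ENNReal.HolderConjugate.conjExponent (one_le_exponent hp)).symm
    have i1 : Integrable (fun x => η x * (deriv Φ (s n x) * ⟪G n x - u.grad x, v⟫)) volume :=
      (hη.continuous.memLp_of_hasCompactSupport
        (p := (ENNReal.ofReal p).conjExponent) hηk).integrable_mul (hdL n).1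
    have i2 := hdom.mono' (hm2 n) (ae_of_all _ (hb2 n))
    rw [h1, ← neg_add', ← integral_add i1 i2]
    congr 2
    funext x
    rw [inner_sub_left]
    ring
  have l1 : Tendsto (fun n => ∫ x, fderiv ℝ η x v * Φ (s n x)) atTop
      (𝓝 (∫ x, fderiv ℝ η x v * Φ (u.toFun x))) := by
    refine tendsto_integral_mul_of_tendsto_eLpNorm hp hsL hΦu ?_ c2 k2
    exact tendsto_of_tendsto_of_tendsto_of_le_of_le tendsto_const_nhds hsu (fun n => zero_le)
      fun n => eLpNorm_mono fun x => hlip _ _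
  have l2 : Tendsto (fun n => ∫ x, η x * (deriv Φ (s n x) * ⟪G n x - u.grad x, v⟫)) atTop
      (𝓝 0) := by
    have := tendsto_integral_mul_of_tendsto_eLpNorm hp (fun n => (hdL n).1)
      (MemLp.zero' (α := E N) (ε := ℝ)) ?_ hη.continuous hηk
    · simpa using this
    · have hb : Tendsto (fun n => ENNReal.ofReal ‖v‖ *
          eLpNorm (G n - u.grad) (ENNReal.ofReal p) volume) atTop (𝓝 0) := by
        simpa only [mul_zero] using
          ENNReal.Tendsto.const_mul hGu (Or.inr (ENNReal.ofReal_ne_top (r := ‖v‖)))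
      refine tendsto_of_tendsto_of_tendsto_of_le_of_le tendsto_const_nhds hb
        (fun n => zero_le) fun n => ?_
      refine le_trans (le_of_eq ?_) (hdL n).2
      congr 1
      funext x
      simp
  have l3 : Tendsto (fun n => ∫ x, η x * (deriv Φ (s n x) * ⟪u.grad x, v⟫)) atTop
      (𝓝 (∫ x, η x * (deriv Φ (u.toFun x) * ⟪u.grad x, v⟫))) := by
    refine tendsto_integral_of_dominated_convergence _ hm2 hdom
      (fun n => ae_of_all _ (hb2 n)) ?_
    filter_upwards [hae] with x hx
    exact (((hcΦ'.tendsto _).comp hx).mul_const _).const_mul _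
  have := tendsto_nhds_unique l1 (((l2.neg).sub l3).congr fun n => (hid n).symm)
  rw [neg_zero, zero_sub] at this
  simp only [real_inner_smul_left]
  rw [← this]
  simp only [mul_comm]

/-- The weak gradient of `∫_0^u ψ` is `ψ(u) ∇u` for every pointwise limit `ψ` of continuous
functions bounded by one. -/
theorem SobolevFun.isWeakGradient_primitive (hp : 1 ≤ p) (u : SobolevFun N p) {ψ : ℝ → ℝ}
    {ψs : ℕ → ℝ → ℝ} (hc : ∀ n, Continuous (ψs n)) (hb : ∀ n t, |ψs n t| ≤ 1)
    (hlim : ∀ t, Tendsto (fun n => ψs n t) atTop (𝓝 (ψ t))) :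
    IsWeakGradient (fun x => ∫ τ in (0 : ℝ)..u.toFun x, ψ τ)
      fun x => ψ (u.toFun x) • u.grad x := by
  intro η hη hηk v
  have hd : ∀ n t, HasDerivAt (fun t => ∫ τ in (0 : ℝ)..t, ψs n τ) (ψs n t) t := fun n t =>
    intervalIntegral.integral_hasDerivAt_right ((hc n).intervalIntegrable _ _)
      (hc n).aestronglyMeasurable.stronglyMeasurableAtFilter (hc n).continuousAt
  have hderiv : ∀ n, deriv (fun t => ∫ τ in (0 : ℝ)..t, ψs n τ) = ψs n := fun n =>
    funext fun t => (hd n t).deriv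
  have hC1 : ∀ n, ContDiff ℝ 1 fun t => ∫ τ in (0 : ℝ)..t, ψs n τ := fun n =>
    contDiff_one_iff_deriv.2 ⟨fun t => (hd n t).differentiableAt, by rw [hderiv]; exact hc n⟩
  have hid : ∀ n, ∫ x, (∫ τ in (0 : ℝ)..u.toFun x, ψs n τ) * fderiv ℝ η x v =
      -∫ x, η x * ⟪ψs n (u.toFun x) • u.grad x, v⟫ := by
    intro n
    have := u.isWeakGradient_comp hp (hC1 n) (by simp) (by rw [hderiv]; exact hb n) η hη hηk v
    simpa only [hderiv] using this
  have hη1 : ContDiff ℝ 1 η := hη.of_le (by exact_mod_cast le_top)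
  have c2 : Continuous fun x => fderiv ℝ η x v :=
    (hη1.continuous_fderiv one_ne_zero).clm_apply continuous_const
  have k2 : HasCompactSupport fun x => fderiv ℝ η x v :=
    (hηk.fderiv ℝ).comp_left (g := fun L : E N →L[ℝ] ℝ => L v) rfl
  have hΦlim : ∀ t, Tendsto (fun n => ∫ τ in (0 : ℝ)..t, ψs n τ) atTop
      (𝓝 (∫ τ in (0 : ℝ)..t, ψ τ)) := fun t =>
    intervalIntegral.tendsto_integral_filter_of_dominated_convergence (fun _ => 1)
      (Eventually.of_forall fun n => (hc n).aestronglyMeasurable)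
      (Eventually.of_forall fun n => ae_of_all _ fun τ _ => hb n τ) (by simp)
      (ae_of_all _ fun τ _ => hlim τ)
  have hΦb : ∀ n t, |∫ τ in (0 : ℝ)..t, ψs n τ| ≤ |t| := by
    intro n t
    have := intervalIntegral.norm_integral_le_of_norm_le_const (a := 0) (b := t) (f := ψs n)
      (C := 1) fun τ _ => hb n τ
    simpa using this
  have l1 : Tendsto (fun n => ∫ x, (∫ τ in (0 : ℝ)..u.toFun x, ψs n τ) * fderiv ℝ η x v) atTop
      (𝓝 (∫ x, (∫ τ in (0 : ℝ)..u.toFun x, ψ τ) * fderiv ℝ η x v)) := by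
    refine tendsto_integral_of_dominated_convergence (fun x => ‖fderiv ℝ η x v • u.toFun x‖)
      (fun n => ((hC1 n).continuous.comp_aestronglyMeasurable u.memLp_toFun.1).mul
        c2.aestronglyMeasurable)
      ((u.locallyIntegrable hp).integrable_smul_left_of_hasCompactSupport c2 k2).norm
      (fun n => ae_of_all _ fun x => ?_) (ae_of_all _ fun x => (hΦlim _).mul_const _)
    rw [norm_mul, norm_smul, mul_comm]
    exact mul_le_mul_of_nonneg_left (hΦb n _) (norm_nonneg _)
  have l2 : Tendsto (fun n => ∫ x, η x * ⟪ψs n (u.toFun x) • u.grad x, v⟫) atTop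
      (𝓝 (∫ x, η x * ⟪ψ (u.toFun x) • u.grad x, v⟫)) := by
    simp only [real_inner_smul_left]
    refine tendsto_integral_of_dominated_convergence (fun x => ‖v‖ * ‖η x • u.grad x‖)
      (fun n => hη.continuous.aestronglyMeasurable.mul
        (((hc n).comp_aestronglyMeasurable u.memLp_toFun.1).mul
          (u.memLp_grad.1.inner aestronglyMeasurable_const)))
      (((u.locallyIntegrable_grad hp).integrable_smul_left_of_hasCompactSupport
        hη.continuous hηk).norm.const_mul _)
      (fun n => ae_of_all _ fun x => ?_)
      (ae_of_all _ fun x => ((hlim _).mul_const _).const_mul _)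
    rw [norm_mul, norm_mul, norm_smul]
    calc _ ≤ ‖η x‖ * (1 * (‖u.grad x‖ * ‖v‖)) := by
          gcongr
          · exact hb n _
          · exact norm_inner_le_norm _ _
      _ = _ := by ring
  exact tendsto_nhds_unique l1 ((l2.neg).congr fun n => (hid n).symm)

/-- The base point `0` lies to the left of the jump because `k ≥ 0`, so the primitive is exactly the
truncation, also for negative `t`. -/
theorem integral_indicator_Ioi {k : ℝ} (hk : 0 ≤ k) (t : ℝ) :
    ∫ τ in (0 : ℝ)..t, (Ioi k).indicator (fun _ => (1 : ℝ)) τ = max (t - k) 0 := by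
  have h0 : ∀ t ≤ k, ∫ τ in (0 : ℝ)..t, (Ioi k).indicator (fun _ => (1 : ℝ)) τ = 0 := by
    intro t ht
    refine intervalIntegral.integral_zero_ae (ae_of_all _ fun τ hτ => ?_)
    refine indicator_of_notMem (fun h => ?_) _
    rw [mem_uIoc] at hτ
    rcases hτ with hτ | hτ <;> exact absurd (mem_Ioi.1 h) (by linarith [hτ.2])
  rcases le_or_gt t k with ht | ht
  · rw [h0 t ht, max_eq_right (by linarith)]
  have hi : ∀ a b, IntervalIntegrable ((Ioi k).indicator fun _ => (1 : ℝ)) volume a b :=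
    fun a b => (intervalIntegrable_const (c := (1 : ℝ))).mono_fun
      ((aestronglyMeasurable_const).indicator measurableSet_Ioi)
      (ae_of_all _ fun τ => norm_indicator_le_norm_self _ _)
  rw [← intervalIntegral.integral_add_adjacent_intervals (hi 0 k) (hi k t), h0 k le_rfl, zero_add,
    max_eq_left (by linarith)]
  have : ∫ τ in k..t, (Ioi k).indicator (fun _ => (1 : ℝ)) τ = ∫ _ in k..t, (1 : ℝ) := by
    refine intervalIntegral.integral_congr_ae (ae_of_all _ fun τ hτ => ?_)
    rw [uIoc_of_le ht.le] at hτ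
    exact indicator_of_mem (mem_Ioi.2 hτ.1) _
  rw [this]
  simp

/-- The truncation `(u - k)_+`, `k ≥ 0`. -/
noncomputable def SobolevFun.posPart (u : SobolevFun N p) (hp : 1 ≤ p) (k : ℝ) (hk : 0 ≤ k) :
    SobolevFun N p where
  toFun x := max (u.toFun x - k) 0
  grad x := (Ioi k).indicator (fun _ => (1 : ℝ)) (u.toFun x) • u.grad x
  memLp_toFun := by
    refine u.memLp_toFun.of_le (((continuous_id.sub continuous_const).max
      continuous_const).comp_aestronglyMeasurable u.memLp_toFun.1) (ae_of_all _ fun x => ?_)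
    rw [Real.norm_of_nonneg (le_max_right _ _)]
    exact max_le (by linarith [le_abs_self (u.toFun x), Real.norm_eq_abs (u.toFun x)])
      (norm_nonneg _)
  memLp_grad := by
    have hm : AEStronglyMeasurable
        (fun x => (Ioi k).indicator (fun _ => (1 : ℝ)) (u.toFun x)) volume :=
      ((measurable_const.indicator measurableSet_Ioi).comp_aemeasurable
        u.memLp_toFun.1.aemeasurable).aestronglyMeasurable
    refine u.memLp_grad.of_le (hm.smul u.memLp_grad.1) (ae_of_all _ fun x => ?_)
    rw [norm_smul]
    refine mul_le_of_le_one_left (norm_nonneg _) ?_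
    exact (norm_indicator_le_norm_self _ _).trans (by simp)
  isWeakGradient := by
    -- Steepening ramps converge to the indicator of `(k, ∞)` at every point, including `k`, where
    -- all of them vanish. Everywhere convergence avoids having to show that `∇u` vanishes almost
    -- everywhere on `{u = k}`.
    have := u.isWeakGradient_primitive hp (ψ := (Ioi k).indicator fun _ => (1 : ℝ))
      (ψs := fun n t => min 1 ((n : ℝ) * max (t - k) 0)) (fun n => by fun_prop) (fun n t => ?_)
      (fun t => ?_)
    · simpa only [integral_indicator_Ioi hk] using this
    · rw [abs_of_nonneg (by positivity)]
      exact min_le_left _ _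
    · rcases le_or_gt t k with ht | ht
      · rw [indicator_of_notMem (by simpa using ht), max_eq_right (by linarith)]
        simp
      · rw [indicator_of_mem (by simpa using ht), max_eq_left (by linarith)]
        have h1 : Tendsto (fun n : ℕ => (n : ℝ) * (t - k)) atTop atTop :=
          tendsto_natCast_atTop_atTop.atTop_mul_const (sub_pos.2 ht)
        refine tendsto_const_nhds.congr' ?_
        filter_upwards [h1.eventually_ge_atTop 1] with n hn
        rw [min_eq_left hn]

/-- The opposite of a Sobolev function. -/
def SobolevFun.neg (u : SobolevFun N p) : SobolevFun N p where
  toFun x := -u.toFun x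
  grad x := -u.grad x
  memLp_toFun := u.memLp_toFun.neg
  memLp_grad := u.memLp_grad.neg
  isWeakGradient η hη hηk v := by
    simp only [neg_mul, inner_neg_left, mul_neg, integral_neg]
    rw [u.isWeakGradient η hη hηk v]

theorem inner_gradient (η : E N → ℝ) (x v : E N) : ⟪gradient η x, v⟫ = fderiv ℝ η x v := by
  rw [gradient, InnerProductSpace.toDual_symm_apply]

theorem norm_gradient (η : E N → ℝ) (x : E N) : ‖gradient η x‖ = ‖fderiv ℝ η x‖ :=
  LinearIsometryEquiv.norm_map _ _

/-- The product of a Sobolev function with a test function. -/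
noncomputable def SobolevFun.mulSmooth (u : SobolevFun N p) (hp : 1 ≤ p) (ψ : E N → ℝ)
    (hψ : ContDiff ℝ ∞ ψ) (hψk : HasCompactSupport ψ) : SobolevFun N p where
  toFun x := ψ x * u.toFun x
  grad x := ψ x • u.grad x + u.toFun x • gradient ψ x
  memLp_toFun := by
    obtain ⟨C, hC⟩ := hψ.continuous.bounded_above_of_compact_support hψk
    refine u.memLp_toFun.of_le_mul (hψ.continuous.aestronglyMeasurable.mul u.memLp_toFun.1)
      (c := C) (ae_of_all _ fun x => ?_)
    rw [norm_mul]
    exact mul_le_mul_of_nonneg_right (hC x) (norm_nonneg _)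
  memLp_grad := by
    have hg : Continuous (fderiv ℝ ψ) := hψ.continuous_fderiv (by simp)
    obtain ⟨C, hC⟩ := hψ.continuous.bounded_above_of_compact_support hψk
    obtain ⟨C', hC'⟩ := hg.bounded_above_of_compact_support (hψk.fderiv ℝ)
    have hgc : Continuous (gradient ψ) :=
      (InnerProductSpace.toDual ℝ (E N)).symm.continuous.comp hg
    refine MemLp.add ?_ ?_
    · refine u.memLp_grad.of_le_mul (hψ.continuous.aestronglyMeasurable.smul u.memLp_grad.1)
        (c := C) (ae_of_all _ fun x => ?_)
      rw [norm_smul]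
      exact mul_le_mul_of_nonneg_right (hC x) (norm_nonneg _)
    · refine u.memLp_toFun.of_le_mul (u.memLp_toFun.1.smul hgc.aestronglyMeasurable)
        (c := C') (ae_of_all _ fun x => ?_)
      rw [norm_smul, norm_gradient, mul_comm]
      exact mul_le_mul_of_nonneg_right (hC' x) (norm_nonneg _)
  isWeakGradient η hη hηk v := by
    have hψ1 : ContDiff ℝ 1 ψ := hψ.of_le (by exact_mod_cast le_top)
    have hη1 : ContDiff ℝ 1 η := hη.of_le (by exact_mod_cast le_top)
    have h1 := u.isWeakGradient (fun x => ψ x * η x) (hψ.mul hη) hηk.mul_left v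
    have h2 : ∀ x, fderiv ℝ (fun x => ψ x * η x) x v
        = ψ x * fderiv ℝ η x v + η x * fderiv ℝ ψ x v := by
      intro x
      rw [fderiv_fun_mul (hψ1.differentiable one_ne_zero x) (hη1.differentiable one_ne_zero x)]
      simp
    have cη : Continuous fun x => fderiv ℝ η x v :=
      (hη1.continuous_fderiv one_ne_zero).clm_apply continuous_const
    have cψ : Continuous fun x => fderiv ℝ ψ x v :=
      (hψ1.continuous_fderiv one_ne_zero).clm_apply continuous_const
    have kη : HasCompactSupport fun x => fderiv ℝ η x v :=
      (hηk.fderiv ℝ).comp_left (g := fun L : E N →L[ℝ] ℝ => L v) rfl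
    have hul := u.locallyIntegrable hp
    have i1 : Integrable (fun x => u.toFun x * (ψ x * fderiv ℝ η x v)) volume := by
      simpa [mul_comm] using hul.integrable_smul_left_of_hasCompactSupport
        (hψ.continuous.mul cη) kη.mul_left
    have i2 : Integrable (fun x => u.toFun x * (η x * fderiv ℝ ψ x v)) volume := by
      simpa [mul_comm] using hul.integrable_smul_left_of_hasCompactSupport
        (hη.continuous.mul cψ) hηk.mul_right
    have i3 : Integrable (fun x => η x * (ψ x * ⟪u.grad x, v⟫)) volume := by
      have := (((u.locallyIntegrable_grad hp).integrable_smul_left_of_hasCompactSupport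
        (hψ.continuous.mul hη.continuous) hηk.mul_left).inner_const (𝕜 := ℝ) v)
      refine this.congr (ae_of_all _ fun x => ?_)
      simp only [real_inner_smul_left, Pi.mul_apply]
      ring
    simp only [h2, mul_add] at h1
    rw [integral_add i1 i2] at h1
    simp only [inner_add_left, real_inner_smul_left, inner_gradient, mul_add]
    rw [integral_add i3]
    · have e1 : ∀ x, ψ x * u.toFun x * fderiv ℝ η x v = u.toFun x * (ψ x * fderiv ℝ η x v) :=
        fun x => by ring
      have e2 : ∀ x, η x * (u.toFun x * fderiv ℝ ψ x v) = u.toFun x * (η x * fderiv ℝ ψ x v) :=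
        fun x => by ring
      have e3 : ∀ x, ψ x * η x * ⟪u.grad x, v⟫ = η x * (ψ x * ⟪u.grad x, v⟫) := fun x => by ring
      simp only [e1, e2]
      simp only [e3] at h1
      linarith
    · refine i2.congr (ae_of_all _ fun x => ?_)
      simp only
      ring

end Chain

end PLap

namespace PLap
open Filter Topology

/-! ### Radial cut-offs -/

theorem exists_deriv_smoothTransition_le : ∃ L > 0, ∀ t, |deriv Real.smoothTransition t| ≤ L := by
  have hc : Continuous (deriv Real.smoothTransition) :=
    (Real.smoothTransition.contDiff (n := 1)).continuous_deriv_one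
  obtain ⟨L, hL⟩ := isCompact_Icc.exists_bound_of_continuousOn (s := Icc (0 : ℝ) 1) hc.continuousOn
  refine ⟨max L 1, by positivity, fun t => ?_⟩
  rcases lt_or_ge t 0 with ht | ht
  · have : Real.smoothTransition =ᶠ[𝓝 t] fun _ => 0 := by
      filter_upwards [gt_mem_nhds ht] with s hs
      exact Real.smoothTransition.zero_of_nonpos hs.le
    rw [this.deriv_eq]
    simp
  rcases lt_or_ge 1 t with ht' | ht'
  · have : Real.smoothTransition =ᶠ[𝓝 t] fun _ => 1 := by
      filter_upwards [lt_mem_nhds ht'] with s hs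
      exact Real.smoothTransition.one_of_one_le hs.le
    rw [this.deriv_eq]
    simp
  exact (hL t ⟨ht, ht'⟩).trans (le_max_left _ _)

/-- A smooth cut-off between the balls of radii `s < R` about `y`. -/
structure IsBallCutoff {N : ℕ} (η : E N → ℝ) (y : E N) (s R L : ℝ) : Prop where
  contDiff : ContDiff ℝ ∞ η
  hasCompactSupport : HasCompactSupport η
  nonneg : ∀ x, 0 ≤ η x
  le_one : ∀ x, η x ≤ 1
  eq_one : ∀ x, ‖x - y‖ ≤ s → η x = 1
  eq_zero : ∀ x, R ≤ ‖x - y‖ → η x = 0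
  norm_fderiv_le : ∀ x, ‖fderiv ℝ η x‖ ≤ L / (R - s)

/-- The profile is composed with the squared distance, hence is smooth at the centre. Its slope is
at most a constant times `2R / (R² - s²)`, which is at most `2 / (R - s)`, so `L` is independent of
centre and radii. -/
theorem exists_isBallCutoff (N : ℕ) : ∃ L > 0, ∀ (y : E N) (s R : ℝ), 0 ≤ s → s < R →
    ∃ η, IsBallCutoff η y s R L := by
  obtain ⟨L, hL0, hL⟩ := exists_deriv_smoothTransition_le
  refine ⟨2 * L, by positivity, fun y s R hs hsR => ?_⟩
  have hR : 0 < R := by linarith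
  have hw : 0 < R ^ 2 - s ^ 2 := by nlinarith
  set g : E N → ℝ := fun x => (R ^ 2 - s ^ 2)⁻¹ * (R ^ 2 - ‖x - y‖ ^ 2) with hg
  have hgs : ContDiff ℝ ∞ g :=
    contDiff_const.mul (contDiff_const.sub ((contDiff_id.sub contDiff_const).norm_sq ℝ))
  have hTs : ContDiff ℝ ∞ Real.smoothTransition := Real.smoothTransition.contDiff (n := ⊤)
  have hzero : ∀ x, R ≤ ‖x - y‖ → g x ≤ 0 := by
    intro x hx
    refine mul_nonpos_of_nonneg_of_nonpos (inv_nonneg.2 hw.le) ?_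
    nlinarith
  refine ⟨fun x => Real.smoothTransition (g x), hTs.comp hgs, ?_, fun x =>
    Real.smoothTransition.nonneg _, fun x => Real.smoothTransition.le_one _, fun x hx => ?_,
    fun x hx => Real.smoothTransition.zero_of_nonpos (hzero x hx), fun x => ?_⟩
  · refine HasCompactSupport.intro (isCompact_closedBall y R) fun x hx => ?_
    rw [Metric.mem_closedBall, not_le, dist_eq_norm] at hx
    exact Real.smoothTransition.zero_of_nonpos (hzero x hx.le)
  · refine Real.smoothTransition.one_of_one_le ?_
    rw [hg]
    simp only
    rw [← div_eq_inv_mul, le_div_iff₀ hw]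
    nlinarith [norm_nonneg (x - y)]
  · have hd1 : HasFDerivAt g ((R ^ 2 - s ^ 2)⁻¹ •
        (-((2 : ℕ) • (innerSL ℝ (x - y) : E N →L[ℝ] ℝ)) : E N →L[ℝ] ℝ)) x := by
      have h0 : HasFDerivAt (fun x : E N => x - y) (ContinuousLinearMap.id ℝ (E N)) x :=
        (hasFDerivAt_id x).sub_const y
      have h1 := ((h0.norm_sq).const_sub (R ^ 2)).const_mul (R ^ 2 - s ^ 2)⁻¹
      simpa using h1
    have hd2 := ((hTs.differentiable (by simp) (g x)).hasDerivAt.hasFDerivAt).comp x hd1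
    have hpos : 0 ≤ 2 * L / (R - s) := div_nonneg (by positivity) (by linarith)
    rcases lt_or_ge R ‖x - y‖ with hx | hx
    · have : (fun x => Real.smoothTransition (g x)) =ᶠ[𝓝 x] fun _ => 0 := by
        have : ∀ᶠ z in 𝓝 x, R < ‖z - y‖ :=
          (continuous_id.sub continuous_const).norm.continuousAt.eventually_const_lt hx
        filter_upwards [this] with z hz
        exact Real.smoothTransition.zero_of_nonpos (hzero z hz.le)
      rw [this.fderiv_eq]
      simpa using hpos
    · have : fderiv ℝ (fun x => Real.smoothTransition (g x)) x = _ := hd2.fderiv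
      rw [this]
      refine (ContinuousLinearMap.opNorm_comp_le _ _).trans ?_
      have n1 : ‖ContinuousLinearMap.toSpanSingleton ℝ (deriv Real.smoothTransition (g x))‖ ≤ L := by
        simpa using hL (g x)
      have n2 : ‖(R ^ 2 - s ^ 2)⁻¹ •
          (-((2 : ℕ) • (innerSL ℝ (x - y) : E N →L[ℝ] ℝ)) : E N →L[ℝ] ℝ)‖ ≤ (R ^ 2 - s ^ 2)⁻¹ * (2 * R) := by
        rw [norm_smul, norm_neg, Real.norm_of_nonneg (inv_nonneg.2 hw.le)]
        gcongr
        refine (norm_nsmul_le).trans ?_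
        rw [innerSL_apply_norm]
        norm_num
        exact hx
      calc _ ≤ L * ((R ^ 2 - s ^ 2)⁻¹ * (2 * R)) := by gcongr
        _ ≤ 2 * L / (R - s) := by
          rw [le_div_iff₀ (by linarith), ← mul_assoc, mul_comm L, mul_assoc, mul_assoc,
            inv_mul_le_iff₀ hw]
          have : 0 ≤ L * s * (R - s) := mul_nonneg (mul_nonneg hL0.le hs) (by linarith)
          nlinarith

/-! ### The Sobolev inequality -/

section Sobolev

variable {N : ℕ} {p : ℝ}

theorem critExp_pos (hp : 1 ≤ p) (hpN : p < N) : 0 < critExp N p :=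
  div_pos (mul_pos (by linarith) (by linarith)) (by linarith)

theorem lt_critExp (hp : 1 ≤ p) (hpN : p < N) : p < critExp N p := by
  rw [critExp, lt_div_iff₀ (by linarith)]
  nlinarith

/-- The Gagliardo–Nirenberg–Sobolev inequality for compactly supported `C^1` functions is applied to
cut-off mollifications, and Fatou's lemma gives the limit. The derivative of the cut-off is not made
small; it costs the `L^p` norm of `u`, which is admissible on the right-hand side. -/
theorem SobolevFun.eLpNorm_critExp_le (hp : 1 ≤ p) (hpN : p < N) {L : ℝ}
    (hL0 : 0 < L) (hL : ∀ (y : E N) (s R : ℝ), 0 ≤ s → s < R → ∃ η, IsBallCutoff η y s R L)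
    (u : SobolevFun N p) :
    eLpNorm u.toFun (ENNReal.ofReal (critExp N p)) volume ≤
      SNormLESNormFDerivOfEqConst ℝ (volume : Measure (E N)) p *
        (eLpNorm u.grad (ENNReal.ofReal p) volume +
          ENNReal.ofReal L * eLpNorm u.toFun (ENNReal.ofReal p) volume) := by
  have hul := u.locallyIntegrable hp
  have hGl := u.locallyIntegrable_grad hp
  have hP1 := one_le_exponent hp
  have hp0 : 0 < p := by linarith
  set C := SNormLESNormFDerivOfEqConst ℝ (volume : Measure (E N)) p with hC
  obtain ⟨ns, hns, hae⟩ := (tendstoInMeasure_of_tendsto_eLpNorm (exponent_ne_zero hp)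
    (fun n => (contDiff_mollify hul n).continuous.aestronglyMeasurable) u.memLp_toFun.1
    (tendsto_mollify hp u.memLp_toFun)).exists_seq_tendsto_ae
  -- The transition layer has width one, so the gradients of these cut-offs are bounded by `L` for
  -- every `n`.
  choose χ hχ using fun n : ℕ => hL 0 (n : ℝ) (n + 1) n.cast_nonneg (by linarith)
  set s : ℕ → E N → ℝ := fun n x => χ n x * mollify (ns n) u.toFun x with hs
  have hu1 : ∀ n, ContDiff ℝ 1 (mollify n u.toFun) := fun n =>
    (contDiff_mollify hul _).of_le (by exact_mod_cast le_top)
  have hχ1 : ∀ n, ContDiff ℝ 1 (χ n) := fun n =>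
    (hχ n).contDiff.of_le (by exact_mod_cast le_top)
  have hs1 : ∀ n, ContDiff ℝ 1 (s n) := fun n => (hχ1 n).mul (hu1 _)
  have hlim : ∀ᵐ x, Tendsto (fun n => s n x) atTop (𝓝 (u.toFun x)) := by
    filter_upwards [hae] with x hx
    refine hx.congr' ?_
    filter_upwards [tendsto_natCast_atTop_atTop.eventually_ge_atTop ‖x‖] with n hn
    rw [hs]
    simp only
    rw [(hχ n).eq_one x (by simpa using hn), one_mul]
  have hbound : ∀ n, eLpNorm (s n) (ENNReal.ofReal (critExp N p)) volume ≤
      C * ((eLpNorm (mollify (ns n) u.grad - u.grad) (ENNReal.ofReal p) volume +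
          eLpNorm u.grad (ENNReal.ofReal p) volume) +
        ENNReal.ofReal L * (eLpNorm (mollify (ns n) u.toFun - u.toFun) (ENNReal.ofReal p) volume +
          eLpNorm u.toFun (ENNReal.ofReal p) volume)) := by
    intro n
    have e1 : ((critExp N p).toNNReal : ℝ)⁻¹ = ((p.toNNReal : NNReal) : ℝ)⁻¹ -
        (Module.finrank ℝ (E N) : ℝ)⁻¹ := by
      rw [Real.coe_toNNReal _ (critExp_pos hp hpN).le, Real.coe_toNNReal _ hp0.le,
        finrank_euclideanSpace_fin, critExp]
      have : (N : ℝ) ≠ 0 := by linarith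
      have : (N : ℝ) - p ≠ 0 := by linarith
      field_simp
    have hfin : 0 < Module.finrank ℝ (E N) := by
      rw [finrank_euclideanSpace_fin]
      exact_mod_cast (hp0.trans hpN)
    have h1 := eLpNorm_le_eLpNorm_fderiv_of_eq (volume : Measure (E N)) (hs1 n)
      (hχ n).hasCompactSupport.mul_right (p := p.toNNReal)
      (by rw [← NNReal.coe_le_coe, Real.coe_toNNReal _ hp0.le]; simpa using hp) hfin e1
    rw [Real.coe_toNNReal _ hp0.le] at h1
    refine h1.trans ?_
    gcongr
    have hc1 := (contDiff_mollify hul (ns n)).continuous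
    have hc2 := (contDiff_mollify hGl (ns n)).continuous
    have h2 : ∀ x, ‖fderiv ℝ (s n) x‖ ≤
        ‖(‖mollify (ns n) u.grad x‖ + L * ‖mollify (ns n) u.toFun x‖ : ℝ)‖ := by
      intro x
      have hnorm : ‖fderiv ℝ (mollify (ns n) u.toFun) x‖ ≤ ‖mollify (ns n) u.grad x‖ := by
        refine ContinuousLinearMap.opNorm_le_bound _ (norm_nonneg _) fun v => ?_
        rw [fderiv_mollify hul hGl u.isWeakGradient]
        exact norm_inner_le_norm _ _
      rw [hs, Real.norm_of_nonneg (by positivity),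
        fderiv_fun_mul ((hχ1 n).differentiable one_ne_zero x) ((hu1 _).differentiable one_ne_zero x)]
      refine (norm_add_le _ _).trans ?_
      rw [norm_smul, norm_smul]
      have h3 := (hχ n).norm_fderiv_le x
      have h4 : ‖χ n x‖ ≤ 1 := by
        rw [Real.norm_of_nonneg ((hχ n).nonneg x)]; exact (hχ n).le_one x
      rw [add_sub_cancel_left, div_one] at h3
      calc _ ≤ 1 * ‖mollify (ns n) u.grad x‖ + ‖mollify (ns n) u.toFun x‖ * L := by gcongr
        _ = _ := by ring
    refine (eLpNorm_mono h2).trans ?_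
    refine (eLpNorm_add_le hc2.norm.aestronglyMeasurable
      (continuous_const.mul hc1.norm).aestronglyMeasurable hP1).trans ?_
    gcongr
    · rw [eLpNorm_norm]
      have := eLpNorm_add_le (hc2.aestronglyMeasurable.sub u.memLp_grad.1) u.memLp_grad.1
        (μ := volume) hP1
      rwa [sub_add_cancel] at this
    · have h5 := eLpNorm_const_smul L (fun x => ‖mollify (ns n) u.toFun x‖) (ENNReal.ofReal p)
        (volume : Measure (E N))
      refine h5.le.trans ?_
      rw [eLpNorm_norm, Real.enorm_eq_ofReal hL0.le]
      gcongr
      have := eLpNorm_add_le (hc1.aestronglyMeasurable.sub u.memLp_toFun.1) u.memLp_toFun.1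
        (μ := volume) hP1
      rwa [sub_add_cancel] at this
  have hT : Tendsto (fun n => C *
      ((eLpNorm (mollify (ns n) u.grad - u.grad) (ENNReal.ofReal p) volume +
          eLpNorm u.grad (ENNReal.ofReal p) volume) +
        ENNReal.ofReal L * (eLpNorm (mollify (ns n) u.toFun - u.toFun) (ENNReal.ofReal p) volume +
          eLpNorm u.toFun (ENNReal.ofReal p) volume))) atTop
      (𝓝 (C * ((0 + eLpNorm u.grad (ENNReal.ofReal p) volume) +
        ENNReal.ofReal L * (0 + eLpNorm u.toFun (ENNReal.ofReal p) volume)))) := by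
    have t1 : Tendsto (fun n => eLpNorm (mollify (ns n) u.grad - u.grad) (ENNReal.ofReal p) volume)
        atTop (𝓝 0) := (tendsto_mollify hp u.memLp_grad).comp hns.tendsto_atTop
    have t2 : Tendsto (fun n => eLpNorm (mollify (ns n) u.toFun - u.toFun)
        (ENNReal.ofReal p) volume) atTop (𝓝 0) :=
      (tendsto_mollify hp u.memLp_toFun).comp hns.tendsto_atTop
    exact ENNReal.Tendsto.const_mul ((t1.add tendsto_const_nhds).add
      (ENNReal.Tendsto.const_mul (t2.add tendsto_const_nhds) (Or.inr ENNReal.ofReal_ne_top)))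
      (Or.inr ENNReal.coe_ne_top)
  rw [zero_add, zero_add] at hT
  refine (Lp.eLpNorm_lim_le_liminf_eLpNorm
    (fun n => (hs1 n).continuous.aestronglyMeasurable) _ hlim).trans ?_
  rw [← hT.liminf_eq]
  exact liminf_le_liminf (Eventually.of_forall hbound)

theorem SobolevFun.integrable_rpow (hp : 1 ≤ p) (u : SobolevFun N p) :
    Integrable (fun x => |u.toFun x| ^ p) volume := by
  have := u.memLp_toFun.integrable_norm_rpow (exponent_ne_zero hp) ENNReal.ofReal_ne_top
  rwa [ENNReal.toReal_ofReal (by linarith)] at this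

theorem SobolevFun.integrable_grad_rpow (hp : 1 ≤ p) (u : SobolevFun N p) :
    Integrable (fun x => ‖u.grad x‖ ^ p) volume := by
  have := u.memLp_grad.integrable_norm_rpow (exponent_ne_zero hp) ENNReal.ofReal_ne_top
  rwa [ENNReal.toReal_ofReal (by linarith)] at this

/-- The Sobolev embedding `W^{1,p} ⊂ L^{p^*}`. -/
theorem exists_sobolev_const (hp : 1 ≤ p) (hpN : p < N) : ∃ C > 0, ∀ u : SobolevFun N p,
    Integrable (fun x => |u.toFun x| ^ critExp N p) volume ∧
    (∫ x, |u.toFun x| ^ critExp N p) ^ (p / critExp N p) ≤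
      C * ((∫ x, ‖u.grad x‖ ^ p) + ∫ x, |u.toFun x| ^ p) := by
  obtain ⟨L, hL0, hL⟩ := exists_isBallCutoff N
  have hp0 : 0 < p := by linarith
  have hS := critExp_pos hp hpN
  set C := SNormLESNormFDerivOfEqConst ℝ (volume : Measure (E N)) p with hC
  set K : ℝ := (C + 1) * (1 + L) with hK
  have hK0 : 0 < K := by positivity
  refine ⟨K ^ p, by positivity, fun u => ?_⟩
  have h1 := u.eLpNorm_critExp_le hp hpN hL0 hL
  have hm : MemLp u.toFun (ENNReal.ofReal (critExp N p)) volume :=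
    ⟨u.memLp_toFun.1, h1.trans_lt (ENNReal.mul_lt_top ENNReal.coe_lt_top (ENNReal.add_lt_top.2
      ⟨u.memLp_grad.2, ENNReal.mul_lt_top ENNReal.ofReal_lt_top u.memLp_toFun.2⟩))⟩
  have hS0 : ENNReal.ofReal (critExp N p) ≠ 0 := by simpa using hS
  have hi := hm.integrable_norm_rpow hS0 ENNReal.ofReal_ne_top
  rw [ENNReal.toReal_ofReal hS.le] at hi
  refine ⟨hi, ?_⟩
  rw [hm.eLpNorm_eq_integral_rpow_norm hS0 ENNReal.ofReal_ne_top,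
    u.memLp_grad.eLpNorm_eq_integral_rpow_norm (exponent_ne_zero hp) ENNReal.ofReal_ne_top,
    u.memLp_toFun.eLpNorm_eq_integral_rpow_norm (exponent_ne_zero hp) ENNReal.ofReal_ne_top,
    ENNReal.toReal_ofReal hS.le, ENNReal.toReal_ofReal hp0.le] at h1
  simp only [Real.norm_eq_abs] at h1
  set A := ∫ x, ‖u.grad x‖ ^ p with hA
  set B := ∫ x, |u.toFun x| ^ p with hB
  set T := ∫ x, |u.toFun x| ^ critExp N p with hT
  have hA0 : 0 ≤ A := integral_nonneg fun x => by positivity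
  have hB0 : 0 ≤ B := integral_nonneg fun x => by positivity
  have hT0 : 0 ≤ T := integral_nonneg fun x => by positivity
  rw [← ENNReal.ofReal_mul hL0.le, ← ENNReal.ofReal_add (by positivity) (by positivity),
    ← ENNReal.ofReal_coe_nnreal, ← ENNReal.ofReal_mul (by positivity),
    ENNReal.ofReal_le_ofReal_iff (by positivity)] at h1
  have hAB : A ^ p⁻¹ ≤ (A + B) ^ p⁻¹ := by gcongr; linarith
  have hBB : B ^ p⁻¹ ≤ (A + B) ^ p⁻¹ := by gcongr; linarith
  have h2 : T ^ (critExp N p)⁻¹ ≤ K * (A + B) ^ p⁻¹ := by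
    have hC0 : (0 : ℝ) ≤ C := C.2
    have hX : 0 ≤ (A + B) ^ p⁻¹ := by positivity
    calc _ ≤ C * (A ^ p⁻¹ + L * B ^ p⁻¹) := h1
      _ ≤ (C + 1) * ((A + B) ^ p⁻¹ + L * (A + B) ^ p⁻¹) := by gcongr; linarith
      _ = _ := by rw [hK]; ring
  calc T ^ (p / critExp N p) = (T ^ (critExp N p)⁻¹) ^ p := by
        rw [← Real.rpow_mul hT0]; congr 1; field_simp
    _ ≤ (K * (A + B) ^ p⁻¹) ^ p := Real.rpow_le_rpow (by positivity) h2 hp0.le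
    _ = K ^ p * (A + B) := by
        rw [Real.mul_rpow hK0.le (by positivity), ← Real.rpow_mul (by positivity),
          inv_mul_cancel₀ hp0.ne', Real.rpow_one]

end Sobolev

end PLap

namespace PLap
open Filter Topology

/-! ### The penalization weight and integrability of the terms of the functional -/

theorem rpow_le_rpow_add_rpow {t α β κ : ℝ} (ht : 0 ≤ t) (hα : 0 < α) (h1 : α ≤ β) (h2 : β ≤ κ) :
    t ^ β ≤ t ^ α + t ^ κ := by
  rcases ht.eq_or_lt with rfl | ht
  · rw [Real.zero_rpow (by linarith), Real.zero_rpow (by linarith), Real.zero_rpow (by linarith)]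
    simp
  rcases le_total t 1 with h | h
  · have := Real.rpow_le_rpow_of_exponent_ge ht h h1
    have : 0 < t ^ κ := Real.rpow_pos_of_pos ht _
    linarith
  · have := Real.rpow_le_rpow_of_exponent_le h h2
    have : 0 < t ^ α := Real.rpow_pos_of_pos ht _
    linarith

/-- A crude form of Young's inequality. -/
theorem rpow_sub_one_mul_le {s t α : ℝ} (hs : 0 ≤ s) (ht : 0 ≤ t) (hα : 1 < α) :
    s ^ (α - 1) * t ≤ s ^ α + t ^ α := by
  have key : ∀ x : ℝ, 0 ≤ x → x ^ (α - 1) * x = x ^ α := fun x hx => by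
    rw [← Real.rpow_add_one' hx (by linarith), sub_add_cancel]
  rcases le_total s t with h | h
  · calc s ^ (α - 1) * t ≤ t ^ (α - 1) * t := by
          gcongr
      _ = t ^ α := key t ht
      _ ≤ _ := le_add_of_nonneg_left (by positivity)
  · calc s ^ (α - 1) * t ≤ s ^ (α - 1) * s := by gcongr
      _ = s ^ α := key s hs
      _ ≤ _ := le_add_of_nonneg_right (by positivity)

theorem abs_rpow_sub_two_mul_mul_self {α : ℝ} (hα : 1 < α) (t : ℝ) :
    |t| ^ (α - 2) * t * t = |t| ^ α := by
  rcases eq_or_ne t 0 with rfl | ht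
  · simp [Real.zero_rpow (by linarith : α ≠ 0)]
  have h := abs_pos.2 ht
  rw [mul_assoc, ← sq, ← sq_abs, ← Real.rpow_natCast, ← Real.rpow_add h]
  norm_num

theorem norm_rpow_sub_two_mul_inner_self {N : ℕ} {α : ℝ} (hα : 1 < α) (v : E N) :
    ‖v‖ ^ (α - 2) * ⟪v, v⟫ = ‖v‖ ^ α := by
  have := abs_rpow_sub_two_mul_mul_self hα ‖v‖
  rw [abs_norm] at this
  rw [real_inner_self_eq_norm_mul_norm, ← mul_assoc, this]

theorem abs_abs_rpow_sub_two_mul {α : ℝ} (hα : 1 < α) (t : ℝ) :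
    |(|t| ^ (α - 2) * t)| = |t| ^ (α - 1) := by
  rcases eq_or_ne t 0 with rfl | ht
  · simp [Real.zero_rpow (by linarith : α - 1 ≠ 0)]
  have h := abs_pos.2 ht
  rw [abs_mul, abs_of_nonneg (by positivity), ← Real.rpow_add_one h.ne']
  congr 1
  ring

theorem norm_rpow_sub_two_mul_norm {N : ℕ} {α : ℝ} (hα : 1 < α) (v : E N) :
    ‖v‖ ^ (α - 2) * ‖v‖ = ‖v‖ ^ (α - 1) := by
  have := abs_abs_rpow_sub_two_mul hα ‖v‖
  rwa [abs_norm, abs_of_nonneg (by positivity)] at this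

theorem SobolevFun.integrable_rpow_of_le {N : ℕ} {p : ℝ} (hp : 1 ≤ p) (hpN : p < N)
    (u : SobolevFun N p) {t : ℝ} (h1 : p ≤ t) (h2 : t ≤ critExp N p) :
    Integrable (fun x => |u.toFun x| ^ t) volume := by
  obtain ⟨C, -, hC⟩ := exists_sobolev_const hp hpN
  refine ((u.integrable_rpow hp).add (hC u).1).mono'
    (u.memLp_toFun.1.norm.aemeasurable.pow_const t).aestronglyMeasurable (ae_of_all _ fun x => ?_)
  rw [Real.norm_of_nonneg (by positivity)]
  exact rpow_le_rpow_add_rpow (abs_nonneg _) (by linarith) h1 h2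

namespace Data

variable {N : ℕ} {D : Data N} {a : ℝ} (hD : D.Admissible a)
include hD

theorem Admissible.monotone_profile : Monotone D.ζ :=
  monotone_of_deriv_nonneg (hD.profile.contDiff.differentiable one_ne_zero)
    hD.profile.deriv_nonneg

/-- The case distinction is immaterial because `ζ` vanishes at zero; this is what makes the weight
continuous. -/
theorem Admissible.ξ_eq (ε : ℝ) (x : E N) :
    D.ξ ε x = ε ^ (-D.γ) * D.ζ (Metric.infDist x (rescale ε D.Ω)) := by
  rw [ξ]
  split_ifs with h
  · rw [Metric.infDist_zero_of_mem h, hD.profile.eq_zero 0 le_rfl, mul_zero]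
  · rfl

theorem Admissible.continuous_ξ (ε : ℝ) : Continuous (D.ξ ε) := by
  rw [funext (hD.ξ_eq ε)]
  exact continuous_const.mul (hD.profile.contDiff.continuous.comp (Metric.continuous_infDist_pt _))

theorem Admissible.ξ_nonneg {ε : ℝ} (hε : 0 < ε) (x : E N) : 0 ≤ D.ξ ε x := by
  rw [hD.ξ_eq]
  exact mul_nonneg (by positivity) (hD.profile.nonneg _)

theorem Admissible.ξ_le {ε : ℝ} (hε : 0 < ε) (x : E N) : D.ξ ε x ≤ ε ^ (-D.γ) := by
  rw [hD.ξ_eq]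
  exact mul_le_of_le_one_right (by positivity) (hD.profile.le_one _)

theorem Admissible.integrable_ξ {ε : ℝ} (hε : 0 < ε) {g : E N → ℝ} (hg : Integrable g volume) :
    Integrable (fun x => D.ξ ε x * g x) volume :=
  hg.bdd_mul (hD.continuous_ξ ε).aestronglyMeasurable (ae_of_all _ fun x => by
    rw [Real.norm_of_nonneg (hD.ξ_nonneg hε x)]
    exact hD.ξ_le hε x)

theorem Admissible.potential_nonneg (x : E N) : 0 ≤ D.V x := by
  obtain ⟨-, a₀, b₀, h0, -, h⟩ := hD.potential
  linarith [(h x).1]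

theorem Admissible.integrable_potential (ε : ℝ) {g : E N → ℝ} (hg : Integrable g volume) :
    Integrable (fun x => D.V (ε • x) * g x) volume := by
  obtain ⟨hV, a₀, b₀, h0, -, h⟩ := hD.potential
  refine hg.bdd_mul (c := b₀)
    (hV.continuous.comp (continuous_const_smul ε)).aestronglyMeasurable (ae_of_all _ fun x => ?_)
  rw [Real.norm_of_nonneg (hD.potential_nonneg _)]
  exact (h _).2

variable {ε : ℝ} (hε : 0 < ε) (hε1 : ε ≤ 1)
include hε hε1

theorem Admissible.integrable_F (u : SobolevFun N D.p) :
    Integrable (fun x => D.F ε x (u.toFun x)) volume := by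
  refine ((u.integrable_rpow_of_le hD.one_lt_p.le hD.p_lt_dim hD.p_lt_r.le
    hD.r_lt_crit.le).const_mul (D.growthConst * ε ^ (-(critExp N D.p - D.r)))).mono'
    (hD.aestronglyMeasurable_F hε u.memLp_toFun.1) (ae_of_all _ fun x => ?_)
  rw [Real.norm_of_nonneg (hD.F_nonneg _ _)]
  exact hD.F_le hε hε1 _ _

theorem Admissible.integrable_f_mul (u w : SobolevFun N D.p) :
    Integrable (fun x => D.f ε x (u.toFun x) * w.toFun x) volume := by
  have hi := fun u : SobolevFun N D.p => u.integrable_rpow_of_le hD.one_lt_p.le hD.p_lt_dim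
    hD.p_lt_r.le hD.r_lt_crit.le
  have hK := hD.growthConst_pos
  have hS : 0 < critExp N D.p := critExp_pos hD.one_lt_p.le hD.p_lt_dim
  refine (((hi u).add (hi w)).const_mul (critExp N D.p * D.growthConst *
    ε ^ (-(critExp N D.p - D.r)))).mono'
    ((hD.aestronglyMeasurable_f hε u.memLp_toFun.1).mul w.memLp_toFun.1) (ae_of_all _ fun x => ?_)
  rw [norm_mul]
  calc _ ≤ critExp N D.p * D.growthConst * ε ^ (-(critExp N D.p - D.r)) *
        |u.toFun x| ^ (D.r - 1) * |w.toFun x| := by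
        gcongr
        · exact hD.abs_f_le hε hε1 _ _
        · exact le_rfl
    _ ≤ _ := by
        rw [mul_assoc]
        gcongr
        exact rpow_sub_one_mul_le (abs_nonneg _) (abs_nonneg _) hD.one_lt_r

/-! ### Energy bounds -/

omit hε hε1 in
theorem Admissible.dI_self (u : SobolevFun N D.p) : D.dI ε u u =
    (∫ x, (‖u.grad x‖ ^ D.p + D.V (ε • x) * |u.toFun x| ^ D.p))
      + D.excess ε u ^ (D.β - 1) * (∫ x, D.ξ ε x * |u.toFun x| ^ D.p)
      - ∫ x, u.toFun x * D.f ε x (u.toFun x) := by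
  simp only [dI, norm_rpow_sub_two_mul_inner_self hD.one_lt_p,
    abs_rpow_sub_two_mul_mul_self hD.one_lt_p, mul_comm (u.toFun _)]

/-- Critical points satisfy an Ambrosetti–Rabinowitz type inequality. -/
theorem Admissible.energy_inequality {u : SobolevFun N D.p} (hu : D.IsCriticalPoint ε u) {M : ℝ}
    (hM : D.I ε u ≤ M) :
    (1 / D.p - 1 / D.r) * (∫ x, (‖u.grad x‖ ^ D.p + D.V (ε • x) * |u.toFun x| ^ D.p))
      + (1 / (D.p * D.β) - 1 / D.r) * D.excess ε u ^ D.β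
      ≤ M + 1 / D.r * D.excess ε u ^ (D.β - 1) := by
  have hr : 0 < D.r := by linarith [hD.one_lt_r]
  have h1 := hu u
  rw [hD.dI_self] at h1
  have hF : D.r * ∫ x, D.F ε x (u.toFun x) ≤ ∫ x, u.toFun x * D.f ε x (u.toFun x) := by
    rw [← integral_const_mul]
    refine integral_mono ((hD.integrable_F hε hε1 u).const_mul _) ?_
      fun x => (hD.mul_f_mem hε x _).1
    simpa only [mul_comm] using hD.integrable_f_mul hε hε1 u u
  -- Where the excess `s` is positive the integral equals `s + 1`. Where `s = 0` both powers vanish,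
  -- because `β > 1`.
  have hs : D.excess ε u ^ (D.β - 1) * (∫ x, D.ξ ε x * |u.toFun x| ^ D.p)
      = D.excess ε u ^ D.β + D.excess ε u ^ (D.β - 1) := by
    have hβ := hD.one_lt_β
    rcases le_total (∫ x, D.ξ ε x * |u.toFun x| ^ D.p) 1 with h | h
    · have : D.excess ε u = 0 := max_eq_right (by linarith)
      rw [this, Real.zero_rpow (by linarith), Real.zero_rpow (by linarith)]
      simp
    · have h0 : D.excess ε u = (∫ x, D.ξ ε x * |u.toFun x| ^ D.p) - 1 :=
        max_eq_left (by linarith)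
      have h2 : (0 : ℝ) ≤ D.excess ε u := le_max_right _ _
      have h3 : D.excess ε u ^ D.β = D.excess ε u ^ (D.β - 1) * D.excess ε u := by
        rw [← Real.rpow_add_one' h2 (by linarith), sub_add_cancel]
      rw [h3]
      nth_rewrite 3 [h0]
      ring
  rw [hs] at h1
  rw [I, Q] at hM
  set A := ∫ x, (‖u.grad x‖ ^ D.p + D.V (ε • x) * |u.toFun x| ^ D.p)
  set B := ∫ x, D.F ε x (u.toFun x)
  set X := D.excess ε u ^ D.β
  set Y := D.excess ε u ^ (D.β - 1)
  have h4 : B ≤ 1 / D.r * (A + X + Y) := by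
    rw [one_div, ← div_eq_inv_mul, le_div_iff₀ hr]
    linarith
  linarith

omit hε hε1 in
-- Since `p < r` and `β < r / p`, both coefficients on the left of the energy inequality are
-- positive. The only bad term is of order `s^{β-1}` in the excess `s`, and is absorbed by `s^β`.
theorem Admissible.exists_energy_bound (M : ℝ) : ∃ C > 0, ∀ ε : ℝ, 0 < ε → ε ≤ 1 →
    ∀ u : SobolevFun N D.p, D.IsCriticalPoint ε u → D.I ε u ≤ M →
      (∫ x, ‖u.grad x‖ ^ D.p) ≤ C ∧ (∫ x, |u.toFun x| ^ D.p) ≤ C ∧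
      (∫ x, D.ξ ε x * |u.toFun x| ^ D.p) ≤ C := by
  have hp := hD.p_pos
  have hr : 0 < D.r := hp.trans hD.p_lt_r
  have hβ := hD.one_lt_β
  have hβ0 : 0 < D.β := by linarith
  obtain ⟨-, a₀, b₀, ha₀, -, hV⟩ := hD.potential
  set c₁ := 1 / D.p - 1 / D.r with hc₁
  set c₂ := 1 / (D.p * D.β) - 1 / D.r with hc₂
  have h1 : 0 < c₁ := sub_pos.2 (one_div_lt_one_div_of_lt hp hD.p_lt_r)
  have h2 : 0 < c₂ := by
    refine sub_pos.2 (one_div_lt_one_div_of_lt (by positivity) ?_)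
    have := hD.β_lt
    rw [lt_div_iff₀ hp] at this
    linarith
  -- Beyond this threshold `(1/r) s^{β-1}` is at most half of `c₂ s^β`; below it, it is bounded by
  -- its value at `T`.
  set T := 2 / (D.r * c₂) with hT
  have hT0 : 0 < T := by positivity
  -- The maximum with `1` keeps the constants positive when `M` is negative.
  set M' := max 1 (M + 1 / D.r * T ^ (D.β - 1)) with hM'
  have hM'0 : 0 < M' := by positivity
  refine ⟨M' / c₁ + M' / c₁ / a₀ + ((2 * M' / c₂) ^ D.β⁻¹ + 1), by positivity,
    fun ε hε hε1 u hu hM => ?_⟩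
  have hE := hD.energy_inequality hε hε1 hu hM
  set s := D.excess ε u with hs
  have hs0 : 0 ≤ s := le_max_right _ _
  have hY : 1 / D.r * s ^ (D.β - 1) ≤ 1 / D.r * T ^ (D.β - 1) + c₂ / 2 * s ^ D.β := by
    rcases le_total s T with h | h
    · have : 1 / D.r * s ^ (D.β - 1) ≤ 1 / D.r * T ^ (D.β - 1) := by
        gcongr
      have : 0 ≤ c₂ / 2 * s ^ D.β := by positivity
      linarith
    · have e1 : s ^ D.β = s ^ (D.β - 1) * s := by
        rw [← Real.rpow_add_one' hs0 (by linarith), sub_add_cancel]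
      have e2 : 1 / D.r ≤ c₂ / 2 * s := by
        have : 1 / D.r = c₂ / 2 * T := by rw [hT]; field_simp
        rw [this]
        gcongr
      have e3 : 0 ≤ s ^ (D.β - 1) := by positivity
      have : 0 ≤ 1 / D.r * T ^ (D.β - 1) := by positivity
      rw [e1]
      nlinarith
  have hMM : M + 1 / D.r * T ^ (D.β - 1) ≤ M' := le_max_right _ _
  have iG := u.integrable_grad_rpow hD.one_lt_p.le
  have iu := u.integrable_rpow hD.one_lt_p.le
  have iV := hD.integrable_potential ε iu
  set A := ∫ x, ‖u.grad x‖ ^ D.p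
  set B := ∫ x, |u.toFun x| ^ D.p
  have hA0 : 0 ≤ A := integral_nonneg fun x => by positivity
  have hB0 : 0 ≤ B := integral_nonneg fun x => by positivity
  have hVB : a₀ * B ≤ ∫ x, D.V (ε • x) * |u.toFun x| ^ D.p := by
    rw [← integral_const_mul]
    exact integral_mono (iu.const_mul _) iV fun x =>
      mul_le_mul_of_nonneg_right (hV _).1 (by positivity)
  rw [integral_add iG iV] at hE
  have hX0 : 0 ≤ s ^ D.β := by positivity
  have k1 : c₁ * (A + a₀ * B) + c₂ / 2 * s ^ D.β ≤ M' := by nlinarith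
  have q1 : 0 ≤ c₁ * (a₀ * B) := by positivity
  have q2 : 0 ≤ c₁ * A := by positivity
  have q3 : 0 ≤ c₂ / 2 * s ^ D.β := by positivity
  have r1 : A ≤ M' / c₁ := by rw [le_div_iff₀ h1]; nlinarith
  have r2 : B ≤ M' / c₁ / a₀ := by rw [le_div_iff₀ ha₀, le_div_iff₀ h1]; nlinarith
  have r3 : s ≤ (2 * M' / c₂) ^ D.β⁻¹ := by
    rw [Real.le_rpow_inv_iff_of_pos hs0 (by positivity) hβ0, le_div_iff₀ h2]
    nlinarith
  have r4 : (∫ x, D.ξ ε x * |u.toFun x| ^ D.p) - 1 ≤ s := le_max_left _ _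
  have t1 : 0 < M' / c₁ := by positivity
  have t2 : 0 < M' / c₁ / a₀ := by positivity
  have t3 : 0 ≤ (2 * M' / c₂) ^ D.β⁻¹ := by positivity
  refine ⟨by linarith, by linarith, by linarith⟩

omit hD hε hε1 in
theorem ball_subset_of_notMem_thickening {Ω : Set (E N)} {y x : E N} {δ : ℝ} (hΩ : Ω.Nonempty)
    (hy : y ∉ Metric.thickening δ Ω) (hx : ‖x - y‖ ≤ δ / 2) : δ / 2 ≤ Metric.infDist x Ω := by
  have h1 : δ ≤ Metric.infDist y Ω := by
    by_contra h
    exact hy ((Metric.mem_thickening_iff_infDist_lt hΩ).2 (not_le.1 h))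
  have h2 : Metric.infDist y Ω ≤ Metric.infDist x Ω + dist y x :=
    Metric.infDist_le_infDist_add_dist
  rw [dist_comm, dist_eq_norm] at h2
  linarith

omit hε hε1 in
/-- Away from `Ω_ε` critical points of bounded energy are small in `L^p`. -/
theorem Admissible.exists_outer_bound {δ : ℝ} (hδ : 0 < δ) (M : ℝ) : ∃ C > 0, ∀ ε : ℝ, 0 < ε →
    ε ≤ 1 → ∀ u : SobolevFun N D.p, D.IsCriticalPoint ε u → D.I ε u ≤ M →
      (∫ x, ‖u.grad x‖ ^ D.p) ≤ C ∧ (∫ x, |u.toFun x| ^ D.p) ≤ C ∧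
      ∀ y ∉ Metric.thickening δ (rescale ε D.Ω),
        ∫ x in Metric.closedBall y (δ / 2), |u.toFun x| ^ D.p ≤ C * ε ^ D.γ := by
  obtain ⟨C, hC, h⟩ := hD.exists_energy_bound M
  have hζ : 0 < D.ζ (δ / 2) := hD.profile.pos _ (by linarith)
  refine ⟨max C (C / D.ζ (δ / 2)), by positivity, fun ε hε hε1 u hu hM => ?_⟩
  obtain ⟨h1, h2, h3⟩ := h ε hε hε1 u hu hM
  refine ⟨h1.trans (le_max_left _ _), h2.trans (le_max_left _ _), fun y hy => ?_⟩
  have iu := u.integrable_rpow hD.one_lt_p.le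
  have iξ := hD.integrable_ξ hε iu
  have hne : (rescale ε D.Ω).Nonempty := by
    obtain ⟨z, hz⟩ := hD.domain.2.1.nonempty
    exact ⟨ε⁻¹ • z, by
      change ε • ε⁻¹ • z ∈ D.Ω
      rwa [smul_inv_smul₀ hε.ne']⟩
  have hpt : ∀ x ∈ Metric.closedBall y (δ / 2),
      ε ^ (-D.γ) * D.ζ (δ / 2) * |u.toFun x| ^ D.p ≤ D.ξ ε x * |u.toFun x| ^ D.p := by
    intro x hx
    rw [Metric.mem_closedBall, dist_eq_norm] at hx
    rw [hD.ξ_eq]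
    gcongr
    exact hD.monotone_profile (ball_subset_of_notMem_thickening hne hy hx)
  have h4 : ε ^ (-D.γ) * D.ζ (δ / 2) * ∫ x in Metric.closedBall y (δ / 2), |u.toFun x| ^ D.p
      ≤ C := by
    rw [← integral_const_mul]
    calc _ ≤ ∫ x in Metric.closedBall y (δ / 2), D.ξ ε x * |u.toFun x| ^ D.p :=
          setIntegral_mono_on (iu.integrableOn.const_mul _) iξ.integrableOn
            Metric.isClosed_closedBall.measurableSet hpt
      _ ≤ ∫ x, D.ξ ε x * |u.toFun x| ^ D.p :=
          setIntegral_le_integral iξ (ae_of_all _ fun x =>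
            mul_nonneg (hD.ξ_nonneg hε x) (by positivity))
      _ ≤ C := h3
  have hεγ : 0 < ε ^ D.γ := Real.rpow_pos_of_pos hε _
  rw [Real.rpow_neg hε.le, mul_assoc, inv_mul_le_iff₀ hεγ] at h4
  calc _ ≤ ε ^ D.γ * C / D.ζ (δ / 2) := by rw [le_div_iff₀ hζ]; linarith
    _ = C / D.ζ (δ / 2) * ε ^ D.γ := by ring
    _ ≤ _ := by gcongr; exact le_max_right _ _

/-! ### Symmetry -/

omit hε1 in
-- Every term of the first variation is odd in `u`. Hence one-sided estimates for critical points
-- give two-sided ones.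
theorem Admissible.isCriticalPoint_neg {u : SobolevFun N D.p} (hu : D.IsCriticalPoint ε u) :
    D.IsCriticalPoint ε u.neg := by
  intro w
  have h1 := hu w
  have he : D.excess ε u.neg = D.excess ε u := by
    simp [excess, SobolevFun.neg]
  rw [dI] at h1 ⊢
  rw [he]
  have e1 : ∀ x, ‖u.neg.grad x‖ ^ (D.p - 2) * ⟪u.neg.grad x, w.grad x⟫
      + D.V (ε • x) * (|u.neg.toFun x| ^ (D.p - 2) * u.neg.toFun x * w.toFun x)
      = -(‖u.grad x‖ ^ (D.p - 2) * ⟪u.grad x, w.grad x⟫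
      + D.V (ε • x) * (|u.toFun x| ^ (D.p - 2) * u.toFun x * w.toFun x)) := by
    intro x
    simp only [SobolevFun.neg, norm_neg, inner_neg_left, abs_neg]
    ring
  have e2 : ∀ x, D.ξ ε x * (|u.neg.toFun x| ^ (D.p - 2) * u.neg.toFun x * w.toFun x)
      = -(D.ξ ε x * (|u.toFun x| ^ (D.p - 2) * u.toFun x * w.toFun x)) := by
    intro x
    simp only [SobolevFun.neg, abs_neg]
    ring
  have e3 : ∀ x, D.f ε x (u.neg.toFun x) * w.toFun x = -(D.f ε x (u.toFun x) * w.toFun x) := by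
    intro x
    simp only [SobolevFun.neg, hD.f_neg hε]
    ring
  simp only [e1, e2, e3, integral_neg]
  linarith

end Data

end PLap

namespace PLap
open Filter Topology

/-! ### The local energy estimate on superlevel sets -/

theorem add_rpow_le_two_rpow_mul {s t α : ℝ} (hs : 0 ≤ s) (ht : 0 ≤ t) (hα : 0 < α) :
    (s + t) ^ α ≤ 2 ^ α * (s ^ α + t ^ α) := by
  have h1 : s + t ≤ 2 * max s t := by linarith [le_max_left s t, le_max_right s t]
  calc (s + t) ^ α ≤ (2 * max s t) ^ α := Real.rpow_le_rpow (by positivity) h1 hα.le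
    _ = 2 ^ α * (max s t) ^ α := Real.mul_rpow (by norm_num) (by positivity)
    _ ≤ _ := by
      gcongr
      rcases max_choice s t with h | h <;> rw [h]
      · exact le_add_of_nonneg_right (by positivity)
      · exact le_add_of_nonneg_left (by positivity)

/-- The absorption inequality of the Caccioppoli estimate. -/
theorem rpow_mul_pow_mul_le {X e b α : ℝ} {m : ℕ} (hX : 0 ≤ X) (he0 : 0 ≤ e) (he1 : e ≤ 1)
    (hb : 0 ≤ b) (hα : 1 < α) (hm : α ≤ m) :
    X ^ (α - 1) * (e ^ (m - 1) * b) ≤ 1 / 2 * (e ^ m * X ^ α) + (2 * b) ^ α := by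
  have hm1 : 1 ≤ m := by exact_mod_cast (hα.le.trans hm)
  have key : ∀ x : ℝ, 0 ≤ x → x ^ (α - 1) * x = x ^ α := fun x hx => by
    rw [← Real.rpow_add_one' hx (by linarith), sub_add_cancel]
  -- If `b ≤ eX/2`, the product is absorbed by the first term. Otherwise `eX ≤ 2b`, and `m ≥ α`
  -- gives `e^{m-1} ≤ e^{α-1}`, so that `X` appears only through `eX`.
  rcases le_total b (e * X / 2) with h | h
  · have e1 : X ^ (α - 1) * (e ^ (m - 1) * (e * X / 2)) = 1 / 2 * (e ^ m * X ^ α) := by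
      rw [← key X hX, ← pow_sub_one_mul (by omega : m ≠ 0) e]
      ring
    have : 0 ≤ (2 * b) ^ α := by positivity
    have : X ^ (α - 1) * (e ^ (m - 1) * b) ≤ X ^ (α - 1) * (e ^ (m - 1) * (e * X / 2)) := by
      gcongr
    linarith
  · have e1 : e ^ (m - 1) ≤ e ^ (α - 1) := by
      rcases he0.eq_or_lt with h0 | h0
      · rw [← h0, zero_pow (by
          have : 1 < m := by exact_mod_cast (hα.trans_le hm)
          omega)]
        positivity
      · rw [← Real.rpow_natCast]
        refine Real.rpow_le_rpow_of_exponent_ge h0 he1 ?_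
        rw [Nat.cast_sub hm1]
        simpa using hm
    have e2 : 0 ≤ 1 / 2 * (e ^ m * X ^ α) := by positivity
    calc X ^ (α - 1) * (e ^ (m - 1) * b) ≤ X ^ (α - 1) * (e ^ (α - 1) * b) := by gcongr
      _ = (e * X) ^ (α - 1) * b := by rw [Real.mul_rpow he0 hX]; ring
      _ ≤ (2 * b) ^ (α - 1) * (2 * b) :=
          mul_le_mul (Real.rpow_le_rpow (by positivity) (by linarith) (by linarith))
            (by linarith) hb (by positivity)
      _ = (2 * b) ^ α := key _ (by positivity)
      _ ≤ _ := by linarith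

/-- This is the pointwise Caccioppoli inequality, with `G` standing for the common gradient of `u`
and its truncation on the superlevel set. The derivative of `η^m` leaves a factor `η^{m-1}`, and
`rpow_mul_pow_mul_le` with `b = m L v / (R - s)` absorbs half of the main term. -/
theorem inner_gradient_pow_ge {N : ℕ} {η : E N → ℝ} {y : E N} {s R L p : ℝ} {m : ℕ}
    (hη : IsBallCutoff η y s R L) (hL : 0 ≤ L) (hsR : s < R) (hp : 1 < p) (hm : p ≤ m)
    (G x : E N) {v : ℝ} (hv : 0 ≤ v) :
    1 / 2 * (η x ^ m * ‖G‖ ^ p) - (Metric.closedBall y R).indicator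
        (fun _ => (2 * m * L) ^ p * ((R - s) ^ (-p) * v ^ p)) x
      ≤ ‖G‖ ^ (p - 2) * ⟪G, η x ^ m • G + v • gradient (fun x => η x ^ m) x⟫ := by
  have hRs : 0 < R - s := by linarith
  have hm2 : 1 < m := by exact_mod_cast (hp.trans_le hm)
  have hfd : fderiv ℝ (fun x => η x ^ m) x = (m * η x ^ (m - 1)) • fderiv ℝ η x := by
    have := ((hη.contDiff.differentiable (by simp) x).hasFDerivAt.pow m).fderiv
    simpa using this
  have h0 := hη.nonneg x
  rw [inner_add_right, inner_smul_right, inner_smul_right, real_inner_comm (gradient (fun x => η x ^ m) x) G, inner_gradient,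
    hfd, mul_add]
  have e1 : ‖G‖ ^ (p - 2) * (η x ^ m * ⟪G, G⟫) = η x ^ m * ‖G‖ ^ p := by
    rw [← norm_rpow_sub_two_mul_inner_self hp]; ring
  rw [e1]
  by_cases hx : x ∈ Metric.closedBall y R
  · rw [indicator_of_mem hx]
    have e2 : |‖G‖ ^ (p - 2) * (v * ((m * η x ^ (m - 1)) • fderiv ℝ η x) G)| ≤
        ‖G‖ ^ (p - 1) * (η x ^ (m - 1) * (m * L / (R - s) * v)) := by
      have h3 : |fderiv ℝ η x G| ≤ L / (R - s) * ‖G‖ :=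
        ((fderiv ℝ η x).le_opNorm G).trans (by gcongr; exact hη.norm_fderiv_le x)
      rw [← norm_rpow_sub_two_mul_norm hp]
      simp only [smul_apply, smul_eq_mul, abs_mul]
      rw [abs_of_nonneg (by positivity : 0 ≤ ‖G‖ ^ (p - 2)), abs_of_nonneg hv,
        abs_of_nonneg (by positivity : 0 ≤ η x ^ (m - 1)), Nat.abs_cast]
      calc _ ≤ ‖G‖ ^ (p - 2) * (v * (m * η x ^ (m - 1) * (L / (R - s) * ‖G‖))) := by gcongr
        _ = _ := by ring
    have e3 := rpow_mul_pow_mul_le (norm_nonneg G) h0 (hη.le_one x)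
      (by positivity : 0 ≤ m * L / (R - s) * v) hp hm
    have e4 : (2 * (m * L / (R - s) * v)) ^ p = (2 * m * L) ^ p * ((R - s) ^ (-p) * v ^ p) := by
      have : 2 * (m * L / (R - s) * v) = 2 * m * L * ((R - s)⁻¹ * v) := by ring
      rw [this, Real.mul_rpow (by positivity) (by positivity),
        Real.mul_rpow (by positivity) hv, Real.inv_rpow hRs.le, Real.rpow_neg hRs.le]
    rw [e4] at e3
    linarith [(abs_le.1 e2).1]
  · rw [indicator_of_notMem hx]
    rw [Metric.mem_closedBall, dist_eq_norm, not_le] at hx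
    rw [hη.eq_zero x hx.le, zero_pow (by omega), zero_pow (by omega)]
    simp

namespace Data

variable {N : ℕ} {D : Data N} {a : ℝ} (hD : D.Admissible a)
include hD

set_option maxHeartbeats 1000000 in
/-- A one-sided Sobolev–Caccioppoli estimate for the superlevel sets of critical points. -/
theorem Admissible.exists_level_estimate : ∃ C > 0, ∀ ε : ℝ, 0 < ε → ε ≤ 1 →
    ∀ u : SobolevFun N D.p, D.IsCriticalPoint ε u → ∀ (y : E N) (s R k : ℝ), 0 ≤ s → s < R →
      R - s ≤ 1 → 0 ≤ k →
      (∫ x in Metric.closedBall y s, max (u.toFun x - k) 0 ^ critExp N D.p)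
          ^ (D.p / critExp N D.p) ≤
        C * ((R - s) ^ (-D.p) * (∫ x in Metric.closedBall y R, max (u.toFun x - k) 0 ^ D.p) +
          ε ^ (-(critExp N D.p - D.r)) *
            ∫ x in Metric.closedBall y R, |u.toFun x| ^ (D.r - 1) * max (u.toFun x - k) 0) := by
  have hp := hD.one_lt_p
  have hp0 := hD.p_pos
  have hS := critExp_pos hp.le hD.p_lt_dim
  have hKg := hD.growthConst_pos
  obtain ⟨L, hL, hcut⟩ := exists_isBallCutoff N
  obtain ⟨CS, hCS, hSob⟩ := exists_sobolev_const hp.le hD.p_lt_dim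
  -- An integer power of the cut-off stays smooth, and `m ≥ p` is what the absorption inequality
  -- asks for.
  set m := ⌈D.p⌉₊ with hm
  have hpm : D.p ≤ m := Nat.le_ceil _
  have hm0 : m ≠ 0 := by
    rintro h
    rw [h] at hpm
    norm_num at hpm
    linarith
  set c := (2 * m * L) ^ D.p with hc
  have hc0 : 0 ≤ c := by positivity
  set K := critExp N D.p * D.growthConst with hK
  have hK0 : 0 < K := mul_pos hS hKg
  refine ⟨CS * (2 ^ D.p * 2 * (c + K) + 2 ^ D.p * c + 1), by positivity,
    fun ε hε hε1 u hu y s R k hs hsR hRs1 hk => ?_⟩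
  have hRs : 0 < R - s := by linarith
  obtain ⟨η, hη⟩ := hcut y s R hs hsR
  have hη0 := hη.nonneg
  have hη1 := hη.le_one
  set B := Metric.closedBall y R with hB
  have hBm : MeasurableSet B := Metric.isClosed_closedBall.measurableSet
  set v : E N → ℝ := fun x => max (u.toFun x - k) 0 with hv
  have hv0 : ∀ x, 0 ≤ v x := fun x => le_max_right _ _
  have hvu : ∀ x, v x ≤ |u.toFun x| := fun x =>
    max_le (by linarith [le_abs_self (u.toFun x)]) (abs_nonneg _)
  set χ : E N → ℝ := fun x => (Ioi k).indicator (fun _ => (1 : ℝ)) (u.toFun x) with hχ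
  have hψs : ContDiff ℝ ∞ fun x => η x ^ m := hη.contDiff.pow m
  have hψk : HasCompactSupport fun x => η x ^ m :=
    hη.hasCompactSupport.comp_left (g := fun t : ℝ => t ^ m) (zero_pow hm0)
  have hψ1 : ∀ x, η x ^ m ≤ 1 := fun x => pow_le_one₀ (hη0 x) (hη1 x)
  have hout : ∀ x, x ∉ B → η x = 0 := fun x hx => by
    rw [hB, Metric.mem_closedBall, dist_eq_norm, not_le] at hx
    exact hη.eq_zero x hx.le
  set vS : SobolevFun N D.p := u.posPart hp.le k hk with hvS
  set w : SobolevFun N D.p := vS.mulSmooth hp.le (fun x => η x ^ m) hψs hψk with hw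
  have hwf : ∀ x, w.toFun x = η x ^ m * v x := fun x => rfl
  have hwg : ∀ x, w.grad x = η x ^ m • (χ x • u.grad x) + v x • gradient (fun x => η x ^ m) x :=
    fun x => rfl
  -- integrability
  have iu := u.integrable_rpow hp.le
  have iG := u.integrable_grad_rpow hp.le
  have iv : Integrable (fun x => v x ^ D.p) volume := by
    have := vS.integrable_rpow hp.le
    refine this.congr (ae_of_all _ fun x => ?_)
    change |v x| ^ D.p = v x ^ D.p
    rw [abs_of_nonneg (hv0 x)]
  have ivB : Integrable (B.indicator fun x => v x ^ D.p) volume := iv.indicator hBm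
  have ir : Integrable (fun x => |u.toFun x| ^ D.r) volume :=
    u.integrable_rpow_of_le hp.le hD.p_lt_dim hD.p_lt_r.le hD.r_lt_crit.le
  have hvm : AEStronglyMeasurable v volume := vS.memLp_toFun.1
  have iru : Integrable (fun x => |u.toFun x| ^ (D.r - 1) * v x) volume := by
    refine ir.mono' ((u.memLp_toFun.1.norm.aemeasurable.pow_const _).aestronglyMeasurable.mul hvm)
      (ae_of_all _ fun x => ?_)
    rw [Real.norm_of_nonneg (mul_nonneg (by positivity) (hv0 x))]
    calc _ ≤ |u.toFun x| ^ (D.r - 1) * |u.toFun x| := by gcongr; exact hvu x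
      _ = _ := by rw [← Real.rpow_add_one' (abs_nonneg _) (by linarith [hD.one_lt_r]),
        sub_add_cancel]
  have iχG : Integrable (fun x => η x ^ m * (χ x * ‖u.grad x‖ ^ D.p)) volume := by
    have hm1 : AEStronglyMeasurable χ volume :=
      ((measurable_const.indicator measurableSet_Ioi).comp_aemeasurable
        u.memLp_toFun.1.aemeasurable).aestronglyMeasurable
    refine iG.mono' (hψs.continuous.aestronglyMeasurable.mul (hm1.mul iG.1))
      (ae_of_all _ fun x => ?_)
    have hχ1 : 0 ≤ χ x ∧ χ x ≤ 1 := by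
      rw [hχ]; simp only [indicator]; split_ifs <;> norm_num
    have := hη0 x
    rw [Real.norm_of_nonneg (mul_nonneg (by positivity) (mul_nonneg hχ1.1 (by positivity)))]
    calc _ ≤ 1 * (1 * ‖u.grad x‖ ^ D.p) := by gcongr; exacts [mul_nonneg hχ1.1 (by positivity), hψ1 x, hχ1.2]
      _ = _ := by ring
  -- the test function inequality
  have hint1 : Integrable (fun x => ‖u.grad x‖ ^ (D.p - 2) * ⟪u.grad x, w.grad x⟫) volume := by
    refine (iG.add (w.integrable_grad_rpow hp.le)).mono'
      (((u.memLp_grad.1.norm.aemeasurable.pow_const _).aestronglyMeasurable).mul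
        (u.memLp_grad.1.inner w.memLp_grad.1)) (ae_of_all _ fun x => ?_)
    rw [norm_mul, Real.norm_of_nonneg (by positivity)]
    calc _ ≤ ‖u.grad x‖ ^ (D.p - 2) * (‖u.grad x‖ * ‖w.grad x‖) := by
          gcongr; exact norm_inner_le_norm _ _
      _ = ‖u.grad x‖ ^ (D.p - 1) * ‖w.grad x‖ := by
          rw [← mul_assoc, norm_rpow_sub_two_mul_norm hp]
      _ ≤ _ := rpow_sub_one_mul_le (norm_nonneg _) (norm_nonneg _) hp
  have hint2 : Integrable (fun x => |u.toFun x| ^ (D.p - 2) * u.toFun x * w.toFun x) volume := by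
    refine (iu.add (w.integrable_rpow hp.le)).mono'
      ((((u.memLp_toFun.1.norm.aemeasurable.pow_const _).aestronglyMeasurable).mul
        u.memLp_toFun.1).mul w.memLp_toFun.1) (ae_of_all _ fun x => ?_)
    rw [norm_mul, Real.norm_eq_abs, abs_abs_rpow_sub_two_mul hp]
    exact rpow_sub_one_mul_le (abs_nonneg _) (abs_nonneg _) hp
  -- Where the test function is nonzero, `u > k ≥ 0`. Thus the potential and penalization terms have
  -- a favourable sign and disappear from the estimate, together with the unbounded weight `ε^{-γ}`.
  have hsign : ∀ x, 0 ≤ |u.toFun x| ^ (D.p - 2) * u.toFun x * w.toFun x := by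
    intro x
    rw [hwf]
    have := hη0 x
    rcases le_or_gt (u.toFun x) k with h | h
    · have : v x = 0 := max_eq_right (by linarith)
      rw [this]; simp
    · have := hv0 x
      have : 0 ≤ u.toFun x := by linarith
      positivity
  have hlow : ∀ x, 1 / 2 * (η x ^ m * (χ x * ‖u.grad x‖ ^ D.p)) -
      c * (R - s) ^ (-D.p) * B.indicator (fun x => v x ^ D.p) x ≤
      ‖u.grad x‖ ^ (D.p - 2) * ⟪u.grad x, w.grad x⟫ := by
    intro x
    rw [hwg]
    rcases le_or_gt (u.toFun x) k with h | h
    · have e1 : v x = 0 := max_eq_right (by linarith)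
      have e2 : χ x = 0 := indicator_of_notMem (by simpa using h) _
      have e3 : B.indicator (fun x => v x ^ D.p) x = 0 := by
        simp [indicator, e1, Real.zero_rpow hp0.ne']
      rw [e1, e2, e3]
      simp
    · have e2 : χ x = 1 := indicator_of_mem (by simpa using h) _
      have := inner_gradient_pow_ge hη hL.le hsR hp hpm (u.grad x) x (hv0 x)
      rw [e2, one_smul, one_mul]
      refine le_trans (le_of_eq ?_) this
      congr 1
      simp only [indicator]
      split_ifs
      · rw [hc, ← mul_assoc]
      · rw [mul_zero]
  have hup : ∀ x, D.f ε x (u.toFun x) * w.toFun x ≤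
      K * ε ^ (-(critExp N D.p - D.r)) *
        B.indicator (fun x => |u.toFun x| ^ (D.r - 1) * v x) x := by
    intro x
    rw [hwf]
    by_cases hx : x ∈ B
    · rw [indicator_of_mem hx]
      have h1 := hD.abs_f_le hε hε1 x (u.toFun x)
      have := hη0 x
      calc _ ≤ |D.f ε x (u.toFun x)| * (1 * v x) := by
            gcongr
            · exact le_abs_self _
            · exact hψ1 x
        _ ≤ (K * ε ^ (-(critExp N D.p - D.r)) * |u.toFun x| ^ (D.r - 1)) * (1 * v x) := by
            gcongr
        _ = _ := by ring
    · rw [hout x hx, zero_pow hm0]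
      simp [indicator, hx]
  have hcrit := hu w
  rw [dI, integral_add hint1 (hD.integrable_potential ε hint2)] at hcrit
  have b1 : 0 ≤ ∫ x, D.V (ε • x) * (|u.toFun x| ^ (D.p - 2) * u.toFun x * w.toFun x) :=
    integral_nonneg fun x => mul_nonneg (hD.potential_nonneg _) (hsign x)
  have b2 : 0 ≤ D.excess ε u ^ (D.β - 1) *
      ∫ x, D.ξ ε x * (|u.toFun x| ^ (D.p - 2) * u.toFun x * w.toFun x) :=
    mul_nonneg (Real.rpow_nonneg (le_max_right _ _) _)
      (integral_nonneg fun x => mul_nonneg (hD.ξ_nonneg hε _) (hsign x))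
  have b3 := integral_mono ((iχG.const_mul (1 / 2)).sub (ivB.const_mul (c * (R - s) ^ (-D.p))))
    hint1 hlow
  have b4 := integral_mono (hD.integrable_f_mul hε hε1 u w)
    ((iru.indicator hBm).const_mul (K * ε ^ (-(critExp N D.p - D.r)))) hup
  have b3' : (∫ x, (1 / 2 * (η x ^ m * (χ x * ‖u.grad x‖ ^ D.p)) -
      c * (R - s) ^ (-D.p) * B.indicator (fun x => v x ^ D.p) x)) =
      1 / 2 * (∫ x, η x ^ m * (χ x * ‖u.grad x‖ ^ D.p)) -
        c * (R - s) ^ (-D.p) * ∫ x in B, v x ^ D.p := by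
    rw [integral_sub (iχG.const_mul (1 / 2)) (ivB.const_mul _), integral_const_mul,
      integral_const_mul, integral_indicator hBm]
  have b5 := b3'.symm.le.trans b3
  rw [integral_const_mul, integral_indicator hBm] at b4
  set X := (R - s) ^ (-D.p) * ∫ x in B, v x ^ D.p with hX
  set Y := ε ^ (-(critExp N D.p - D.r)) * ∫ x in B, |u.toFun x| ^ (D.r - 1) * v x with hY
  set Z := ∫ x, η x ^ m * (χ x * ‖u.grad x‖ ^ D.p) with hZ
  have hX0 : 0 ≤ X := mul_nonneg (by positivity) (integral_nonneg fun x =>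
    Real.rpow_nonneg (hv0 x) _)
  have hY0 : 0 ≤ Y := mul_nonneg (by positivity) (integral_nonneg fun x =>
    mul_nonneg (by positivity) (hv0 x))
  have hZXY : Z ≤ 2 * (c * X + K * Y) := by
    rw [mul_assoc] at b4 b5
    linarith
  -- the Sobolev inequality for the localized truncation
  obtain ⟨iwS, hwS⟩ := hSob w
  have g1 : ∀ x, ‖w.grad x‖ ^ D.p ≤ 2 ^ D.p * (η x ^ m * (χ x * ‖u.grad x‖ ^ D.p)) +
      2 ^ D.p * (c * (R - s) ^ (-D.p)) * B.indicator (fun x => v x ^ D.p) x := by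
    intro x
    have h0 := hη0 x
    have hχ2 : ‖χ x • u.grad x‖ ^ D.p = χ x * ‖u.grad x‖ ^ D.p := by
      rw [hχ]; simp only [indicator]; split_ifs <;> simp [Real.zero_rpow hp0.ne']
    have hχ0 : 0 ≤ χ x * ‖u.grad x‖ ^ D.p := by rw [← hχ2]; positivity
    rw [hwg]
    have n1 : ‖η x ^ m • (χ x • u.grad x)‖ ^ D.p ≤ η x ^ m * (χ x * ‖u.grad x‖ ^ D.p) := by
      rw [norm_smul, Real.mul_rpow (norm_nonneg _) (norm_nonneg _), hχ2,
        Real.norm_of_nonneg (by positivity)]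
      gcongr
      exact Real.rpow_le_self_of_le_one (by positivity) (hψ1 x) hp.le
    have n2 : ‖v x • gradient (fun x => η x ^ m) x‖ ^ D.p ≤
        c * (R - s) ^ (-D.p) * B.indicator (fun x => v x ^ D.p) x := by
      have hfd : fderiv ℝ (fun x => η x ^ m) x = (m * η x ^ (m - 1)) • fderiv ℝ η x := by
        have := ((hη.contDiff.differentiable (by simp) x).hasFDerivAt.pow m).fderiv
        simpa using this
      rw [norm_smul, norm_gradient, hfd, norm_smul, Real.norm_of_nonneg (hv0 x),
        Real.norm_of_nonneg (by positivity)]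
      by_cases hx : x ∈ B
      · rw [indicator_of_mem hx]
        have h1 : v x * (m * η x ^ (m - 1) * ‖fderiv ℝ η x‖) ≤
            (2 * m * L) * ((R - s)⁻¹ * v x) := by
          calc _ ≤ v x * (m * 1 * (L / (R - s))) := by
                gcongr
                · exact pow_le_one₀ h0 (hη1 x)
                · exact hη.norm_fderiv_le x
            _ ≤ 2 * (v x * (m * 1 * (L / (R - s)))) := by
                have : 0 ≤ v x * (m * 1 * (L / (R - s))) := mul_nonneg (hv0 x) (by positivity)
                linarith
            _ = _ := by ring
        refine (Real.rpow_le_rpow (mul_nonneg (hv0 x) (by positivity)) h1 hp0.le).trans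
          (le_of_eq ?_)
        rw [Real.mul_rpow (by positivity) (mul_nonneg (by positivity) (hv0 x)),
          Real.mul_rpow (by positivity) (hv0 x), Real.inv_rpow hRs.le, Real.rpow_neg hRs.le, hc]
        ring
      · have hm1 : m - 1 ≠ 0 := by
          have : 1 < m := by exact_mod_cast (hp.trans_le hpm)
          omega
        rw [hout x hx, zero_pow hm1]
        simp [indicator, hx, Real.zero_rpow hp0.ne']
    calc _ ≤ (‖η x ^ m • (χ x • u.grad x)‖ + ‖v x • gradient (fun x => η x ^ m) x‖) ^ D.p :=
          Real.rpow_le_rpow (norm_nonneg _) (norm_add_le _ _) hp0.le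
      _ ≤ 2 ^ D.p * (‖η x ^ m • (χ x • u.grad x)‖ ^ D.p +
            ‖v x • gradient (fun x => η x ^ m) x‖ ^ D.p) :=
          add_rpow_le_two_rpow_mul (norm_nonneg _) (norm_nonneg _) hp0
      _ ≤ 2 ^ D.p * (η x ^ m * (χ x * ‖u.grad x‖ ^ D.p) +
            c * (R - s) ^ (-D.p) * B.indicator (fun x => v x ^ D.p) x) := by gcongr
      _ = _ := by ring
  have g2 := integral_mono (w.integrable_grad_rpow hp.le)
    ((iχG.const_mul (2 ^ D.p)).add (ivB.const_mul (2 ^ D.p * (c * (R - s) ^ (-D.p))))) g1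
  have g2' : (∫ x, (2 ^ D.p * (η x ^ m * (χ x * ‖u.grad x‖ ^ D.p)) +
      2 ^ D.p * (c * (R - s) ^ (-D.p)) * B.indicator (fun x => v x ^ D.p) x)) =
      2 ^ D.p * Z + 2 ^ D.p * c * X := by
    rw [integral_add (iχG.const_mul _) (ivB.const_mul _), integral_const_mul,
      integral_const_mul, integral_indicator hBm, hX, hZ]
    ring
  have g3 := g2.trans g2'.le
  have g4 : (∫ x, |w.toFun x| ^ D.p) ≤ X := by
    calc (∫ x, |w.toFun x| ^ D.p) ≤ ∫ x, B.indicator (fun x => v x ^ D.p) x := by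
          refine integral_mono (w.integrable_rpow hp.le) ivB fun x => ?_
          simp only
          rw [hwf]
          have := hη0 x
          by_cases hx : x ∈ B
          · rw [indicator_of_mem hx, abs_of_nonneg (mul_nonneg (by positivity) (hv0 x))]
            exact Real.rpow_le_rpow (mul_nonneg (by positivity) (hv0 x))
              (mul_le_of_le_one_left (hv0 x) (hψ1 x)) hp0.le
          · rw [hout x hx, zero_pow hm0]
            simp [indicator, hx, Real.zero_rpow hp0.ne']
      _ = ∫ x in B, v x ^ D.p := integral_indicator hBm
      -- Here `R - s ≤ 1` lets the zeroth-order term of the Sobolev inequality be merged with the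
      -- cut-off term.
      _ ≤ X := by
          refine le_mul_of_one_le_left (integral_nonneg fun x => Real.rpow_nonneg (hv0 x) _) ?_
          exact Real.one_le_rpow_of_pos_of_le_one_of_nonpos hRs hRs1 (by linarith)
  have g5 : (∫ x in Metric.closedBall y s, v x ^ critExp N D.p) ≤
      ∫ x, |w.toFun x| ^ critExp N D.p := by
    rw [← integral_indicator Metric.isClosed_closedBall.measurableSet]
    refine integral_mono_of_nonneg (ae_of_all _ fun x =>
      indicator_nonneg (fun x _ => Real.rpow_nonneg (hv0 x) _) x) iwS (ae_of_all _ fun x => ?_)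
    simp only
    by_cases hx : x ∈ Metric.closedBall y s
    · rw [indicator_of_mem hx, hwf]
      rw [Metric.mem_closedBall, dist_eq_norm] at hx
      rw [hη.eq_one x hx, one_pow, one_mul, abs_of_nonneg (hv0 x)]
    · rw [indicator_of_notMem hx]
      positivity
  have h2p : (0 : ℝ) ≤ 2 ^ D.p := by positivity
  calc _ ≤ (∫ x, |w.toFun x| ^ critExp N D.p) ^ (D.p / critExp N D.p) :=
        Real.rpow_le_rpow (integral_nonneg fun x => Real.rpow_nonneg (hv0 x) _) g5
          (by positivity)
    _ ≤ CS * ((2 ^ D.p * Z + 2 ^ D.p * c * X) + X) := hwS.trans (by gcongr)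
    _ ≤ CS * ((2 ^ D.p * (2 * (c * X + K * Y)) + 2 ^ D.p * c * X) + X) := by gcongr
    _ ≤ _ := by
        rw [mul_assoc CS]
        refine mul_le_mul_of_nonneg_left ?_ hCS.le
        -- These are exactly the surplus terms when the constant multiplies `X + Y`.
        have t1 : 0 ≤ 2 ^ D.p * (2 * (c * Y + K * X)) + 2 ^ D.p * c * Y + Y := by positivity
        linarith

end Data

end PLap

namespace PLap
open Filter Topology

/-! ### Improvement of the local decay rate -/

/-- Below height `s` the surplus power `r - p` is bounded by that of `s`; above it the missing power
`S - r` is. The free height replaces an interpolation inequality and is later optimized as a power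
of `ε`. -/
theorem rpow_le_split {s t p r S : ℝ} (hs : 0 < s) (ht : 0 ≤ t) (hp : 0 < p) (hpr : p ≤ r)
    (hrS : r ≤ S) : t ^ r ≤ s ^ (r - p) * t ^ p + s ^ (-(S - r)) * t ^ S := by
  rcases ht.eq_or_lt with rfl | ht
  · rw [Real.zero_rpow (by linarith)]
    positivity
  rcases le_total t s with h | h
  · have e : t ^ r = t ^ (r - p) * t ^ p := by rw [← Real.rpow_add ht]; congr 1; ring
    have : t ^ (r - p) * t ^ p ≤ s ^ (r - p) * t ^ p := by
      gcongr
    have : 0 ≤ s ^ (-(S - r)) * t ^ S := by positivity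
    linarith
  · have e : t ^ r = t ^ (-(S - r)) * t ^ S := by rw [← Real.rpow_add ht]; congr 1; ring
    have : t ^ (-(S - r)) * t ^ S ≤ s ^ (-(S - r)) * t ^ S := by
      gcongr ?_ * _
      exact Real.rpow_le_rpow_of_nonpos hs h (by linarith)
    have : 0 ≤ s ^ (r - p) * t ^ p := by positivity
    linarith

/-- The right-hand side minus `z` is affine in `z`, with value `e₀` at `z = 0` and `e₁` at `z = γ`.
The two hypotheses on `γ` say that these values are positive, so their minimum is a uniform gain on
`[0, γ]`. -/
theorem exists_exponent_gain {p r S γ : ℝ} (hp : 0 < p) (hpr : p < r) (hrS : r < S)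
    (h1 : S - p < γ) (h2 : S - r < γ * (r - p) / p) :
    ∃ g > 0, ∀ z, 0 ≤ z → z ≤ γ →
      z + g ≤ -(S - r) + (z * (S / p) - γ) / (S - p) * (r - p) + γ := by
  have hSp : 0 < S - p := by linarith
  have hγ : 0 < γ := by linarith
  set e₀ := (S - r) * (γ - (S - p)) / (S - p) with he₀
  set e₁ := γ * (r - p) / p - (S - r) with he₁
  have p0 : 0 < e₀ := div_pos (mul_pos (by linarith) (by linarith)) hSp
  have p1 : 0 < e₁ := by linarith
  refine ⟨min e₀ e₁, lt_min p0 p1, fun z hz0 hz1 => ?_⟩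
  have key : -(S - r) + (z * (S / p) - γ) / (S - p) * (r - p) + γ
      = z + ((1 - z / γ) * e₀ + z / γ * e₁) := by
    rw [he₀, he₁]
    field_simp
    ring
  rw [key]
  have q0 : 0 ≤ z / γ := by positivity
  have q1 : z / γ ≤ 1 := (div_le_one hγ).2 hz1
  have : min e₀ e₁ ≤ (1 - z / γ) * e₀ + z / γ * e₁ := by
    have a0 := mul_le_mul_of_nonneg_left (min_le_left e₀ e₁) (by linarith : 0 ≤ 1 - z / γ)
    have a1 := mul_le_mul_of_nonneg_left (min_le_right e₀ e₁) q0
    linarith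
  linarith

namespace Data

variable {N : ℕ} {D : Data N} {a : ℝ} (hD : D.Admissible a)
include hD

/-- The local estimate with both signs, at level zero. -/
theorem Admissible.exists_local_estimate : ∃ C > 0, ∀ ε : ℝ, 0 < ε → ε ≤ 1 →
    ∀ u : SobolevFun N D.p, D.IsCriticalPoint ε u → ∀ (y : E N) (s R : ℝ), 0 ≤ s → s < R →
      R - s ≤ 1 →
      (∫ x in Metric.closedBall y s, |u.toFun x| ^ critExp N D.p) ≤
        C * ((R - s) ^ (-D.p) * (∫ x in Metric.closedBall y R, |u.toFun x| ^ D.p) +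
          ε ^ (-(critExp N D.p - D.r)) * ∫ x in Metric.closedBall y R, |u.toFun x| ^ D.r)
            ^ (critExp N D.p / D.p) := by
  have hp := hD.one_lt_p
  have hp0 := hD.p_pos
  have hr := hD.one_lt_r
  have hS := critExp_pos hp.le hD.p_lt_dim
  obtain ⟨C, hC, h⟩ := hD.exists_level_estimate
  refine ⟨2 * C ^ (critExp N D.p / D.p), by positivity, fun ε hε hε1 u hu y s R hs hsR hRs => ?_⟩
  have hRs0 : 0 < R - s := by linarith
  set W := (R - s) ^ (-D.p) * (∫ x in Metric.closedBall y R, |u.toFun x| ^ D.p) +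
    ε ^ (-(critExp N D.p - D.r)) * ∫ x in Metric.closedBall y R, |u.toFun x| ^ D.r with hW
  have hW0 : 0 ≤ W := add_nonneg
    (mul_nonneg (by positivity) (integral_nonneg fun x => by positivity))
    (mul_nonneg (by positivity) (integral_nonneg fun x => by positivity))
  have hone : ∀ v : SobolevFun N D.p, D.IsCriticalPoint ε v →
      (∀ x, |v.toFun x| = |u.toFun x|) →
      (∫ x in Metric.closedBall y s, max (v.toFun x) 0 ^ critExp N D.p) ≤
        C ^ (critExp N D.p / D.p) * W ^ (critExp N D.p / D.p) := by
    intro v hv hvu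
    have hle : ∀ x, max (v.toFun x) 0 ≤ |u.toFun x| := fun x => by
      rw [← hvu]; exact max_le (le_abs_self _) (abs_nonneg _)
    have h1 := h ε hε hε1 v hv y s R 0 hs hsR hRs le_rfl
    simp only [sub_zero, hvu] at h1
    have m1 : (∫ x in Metric.closedBall y R, max (v.toFun x) 0 ^ D.p) ≤
        ∫ x in Metric.closedBall y R, |u.toFun x| ^ D.p := by
      refine integral_mono_of_nonneg (ae_of_all _ fun x => by positivity)
        (u.integrable_rpow hp.le).integrableOn (ae_of_all _ fun x => ?_)
      exact Real.rpow_le_rpow (le_max_right _ _) (hle x) hp0.le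
    have m2 : (∫ x in Metric.closedBall y R, |u.toFun x| ^ (D.r - 1) * max (v.toFun x) 0) ≤
        ∫ x in Metric.closedBall y R, |u.toFun x| ^ D.r := by
      refine integral_mono_of_nonneg (ae_of_all _ fun x => by positivity)
        (u.integrable_rpow_of_le hp.le hD.p_lt_dim hD.p_lt_r.le hD.r_lt_crit.le).integrableOn
        (ae_of_all _ fun x => ?_)
      calc _ ≤ |u.toFun x| ^ (D.r - 1) * |u.toFun x| :=
            mul_le_mul_of_nonneg_left (hle x) (by positivity)
        _ = _ := by rw [← Real.rpow_add_one' (abs_nonneg _) (by linarith), sub_add_cancel]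
    have h2 : (∫ x in Metric.closedBall y s, max (v.toFun x) 0 ^ critExp N D.p)
        ^ (D.p / critExp N D.p) ≤ C * W := h1.trans (by rw [hW]; gcongr)
    rw [← Real.mul_rpow hC.le hW0]
    have hT : 0 ≤ ∫ x in Metric.closedBall y s, max (v.toFun x) 0 ^ critExp N D.p :=
      integral_nonneg fun x => by positivity
    have h3 := Real.rpow_le_rpow (by positivity) h2 (by positivity : 0 ≤ critExp N D.p / D.p)
    rwa [← Real.rpow_mul hT, div_mul_div_cancel₀ hS.ne', div_self hp0.ne', Real.rpow_one] at h3
  have h1 := hone u hu fun x => rfl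
  have h2 := hone u.neg (hD.isCriticalPoint_neg hε hu) fun x => abs_neg _
  have iS := u.integrable_rpow_of_le hp.le hD.p_lt_dim (lt_critExp hp.le hD.p_lt_dim).le le_rfl
  have ipart : ∀ v : SobolevFun N D.p, (∀ x, |v.toFun x| = |u.toFun x|) →
      Integrable (fun x => max (v.toFun x) 0 ^ critExp N D.p) volume := by
    intro v hv
    refine iS.mono' ((v.memLp_toFun.1.aemeasurable.max aemeasurable_const).pow_const
      _).aestronglyMeasurable (ae_of_all _ fun x => ?_)
    rw [Real.norm_of_nonneg (by positivity), ← hv]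
    exact Real.rpow_le_rpow (le_max_right _ _) (max_le (le_abs_self _) (abs_nonneg _)) hS.le
  have hsum : (∫ x in Metric.closedBall y s, |u.toFun x| ^ critExp N D.p) =
      (∫ x in Metric.closedBall y s, max (u.toFun x) 0 ^ critExp N D.p) +
        ∫ x in Metric.closedBall y s, max (u.neg.toFun x) 0 ^ critExp N D.p := by
    rw [← integral_add (ipart u fun x => rfl).integrableOn
      (ipart u.neg fun x => abs_neg _).integrableOn]
    refine integral_congr_ae (ae_of_all _ fun x => ?_)
    change |u.toFun x| ^ critExp N D.p = max (u.toFun x) 0 ^ critExp N D.p +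
      max (-u.toFun x) 0 ^ critExp N D.p
    rcases le_total 0 (u.toFun x) with h0 | h0
    · rw [abs_of_nonneg h0, max_eq_left h0, max_eq_right (by linarith), Real.zero_rpow hS.ne',
        add_zero]
    · rw [abs_of_nonpos h0, max_eq_right h0, max_eq_left (by linarith), Real.zero_rpow hS.ne',
        zero_add]
  rw [hsum]
  linarith

/-- Away from `Ω_ε` critical points of bounded energy decay in `L^{p^*}` at the same rate as in
`L^p`. -/
theorem Admissible.exists_outer_crit_bound {ρ : ℝ} (hρ : 0 < ρ) (hρ1 : ρ ≤ 1) (M : ℝ) :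
    ∃ C > 0, ∀ ε : ℝ, 0 < ε → ε ≤ 1 → ∀ u : SobolevFun N D.p, D.IsCriticalPoint ε u →
      D.I ε u ≤ M → ∀ y ∉ Metric.thickening (2 * ρ) (rescale ε D.Ω),
        ∫ x in Metric.closedBall y (ρ / 2), |u.toFun x| ^ critExp N D.p ≤
          C * ε ^ (D.γ * (critExp N D.p / D.p)) := by
  have hp := hD.one_lt_p
  have hp0 := hD.p_pos
  have hS := critExp_pos hp.le hD.p_lt_dim
  have hpS := lt_critExp hp.le hD.p_lt_dim
  set S := critExp N D.p with hSdef
  obtain ⟨g, hg, hgain⟩ := exists_exponent_gain hp0 hD.p_lt_r hD.r_lt_crit hD.crit_sub_p_lt_γ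
    hD.crit_sub_r_lt
  obtain ⟨C₁, hC₁, hout⟩ := hD.exists_outer_bound (δ := 2 * ρ) (by positivity) M
  obtain ⟨CS, hCS, hSob⟩ := exists_sobolev_const hp.le hD.p_lt_dim
  obtain ⟨CL, hCL, hloc⟩ := hD.exists_local_estimate
  have hγ := hD.γ_pos
  -- After `n` steps the rate is `min (n g) γ`. The radii start at `ρ`, where the `L^p` decay is
  -- available, and stay above `ρ / 2`. The initial rate zero is the global Sobolev bound.
  have hind : ∀ n : ℕ, ∃ C > 0, ∀ ε : ℝ, 0 < ε → ε ≤ 1 → ∀ u : SobolevFun N D.p,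
      D.IsCriticalPoint ε u → D.I ε u ≤ M →
        ∀ y ∉ Metric.thickening (2 * ρ) (rescale ε D.Ω),
        ∫ x in Metric.closedBall y (ρ * (1 / 2 + 1 / 2 ^ (n + 1))), |u.toFun x| ^ S ≤
          C * ε ^ (min (n * g) D.γ * (S / D.p)) := by
    intro n
    induction n with
    | zero =>
      refine ⟨(CS * (C₁ + C₁)) ^ (S / D.p), by positivity, fun ε hε hε1 u hu hM y hy => ?_⟩
      obtain ⟨h1, h2, -⟩ := hout ε hε hε1 u hu hM
      obtain ⟨iS, h3⟩ := hSob u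
      have hT : 0 ≤ ∫ x, |u.toFun x| ^ S := integral_nonneg fun x => by positivity
      have h4 : (∫ x, |u.toFun x| ^ S) ^ (D.p / S) ≤ CS * (C₁ + C₁) :=
        h3.trans (by gcongr)
      have h5 := Real.rpow_le_rpow (by positivity) h4 (by positivity : 0 ≤ S / D.p)
      rw [← Real.rpow_mul hT, div_mul_div_cancel₀ hS.ne', div_self hp0.ne', Real.rpow_one] at h5
      have e0 : ε ^ (min (((0 : ℕ) : ℝ) * g) D.γ * (S / D.p)) = 1 := by
        rw [Nat.cast_zero, zero_mul, min_eq_left hγ.le, zero_mul, Real.rpow_zero]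
      rw [e0, mul_one]
      exact (setIntegral_le_integral iS (ae_of_all _ fun x => by positivity)).trans h5
    | succ n ih =>
      obtain ⟨C, hC, ih⟩ := ih
      set s := ρ * (1 / 2 + 1 / 2 ^ (n + 1 + 1)) with hs
      set R := ρ * (1 / 2 + 1 / 2 ^ (n + 1)) with hR
      have h2n : (1 : ℝ) ≤ 2 ^ n := one_le_pow₀ (by norm_num)
      have hRs : R - s = ρ / 2 ^ (n + 2) := by
        rw [hs, hR]; field_simp; ring
      have hRs0 : 0 < R - s := by rw [hRs]; positivity
      have hRs1 : R - s ≤ 1 := by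
        rw [hRs, div_le_one (by positivity), pow_add]
        linarith
      have hRρ : R ≤ ρ := by
        have : (1 : ℝ) / 2 ^ (n + 1) ≤ 1 / 2 := by
          rw [pow_succ]
          gcongr
          linarith
        rw [hR]
        nlinarith
      have hs0 : 0 ≤ s := by positivity
      set z := min ((n : ℝ) * g) D.γ with hz
      have hz0 : 0 ≤ z := le_min (by positivity) hγ.le
      have hz1 : z ≤ D.γ := min_le_right _ _
      set z' := min (((n + 1 : ℕ) : ℝ) * g) D.γ with hz'
      have hzz : z' ≤ z + g := by
        rw [hz', hz, min_add, Nat.cast_add_one]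
        refine min_le_min ?_ ?_ <;> linarith
      have hz'γ : z' ≤ D.γ := min_le_right _ _
      -- The splitting height is `ε^σ`, with `σ` (possibly negative) chosen so that the `L^p` and
      -- `L^S` contributions carry the same power of `ε`.
      set σ := (z * (S / D.p) - D.γ) / (S - D.p) with hσ
      have hσ' : σ * (S - D.p) = z * (S / D.p) - D.γ :=
        div_mul_cancel₀ _ (sub_pos.2 hpS).ne'
      have hexp := hgain z hz0 hz1
      set K := (R - s) ^ (-D.p) * C₁ + (C₁ + C) with hK
      have hK0 : 0 < K := by positivity
      refine ⟨CL * K ^ (S / D.p), by positivity, fun ε hε hε1 u hu hM y hy => ?_⟩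
      obtain ⟨-, -, h3⟩ := hout ε hε hε1 u hu hM
      have iu := u.integrable_rpow hp.le
      have ir := u.integrable_rpow_of_le hp.le hD.p_lt_dim hD.p_lt_r.le hD.r_lt_crit.le
      have iS := u.integrable_rpow_of_le hp.le hD.p_lt_dim hpS.le le_rfl
      have hA : ∫ x in Metric.closedBall y R, |u.toFun x| ^ D.p ≤ C₁ * ε ^ D.γ := by
        have := h3 y hy
        rw [mul_div_cancel_left₀ _ (two_ne_zero)] at this
        refine le_trans ?_ this
        exact setIntegral_mono_set iu.integrableOn (ae_of_all _ fun x => by positivity)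
          (Metric.closedBall_subset_closedBall hRρ).eventuallyLE
      have hB := ih ε hε hε1 u hu hM y hy
      have hsp : 0 < ε ^ σ := Real.rpow_pos_of_pos hε _
      have hR' : ∫ x in Metric.closedBall y R, |u.toFun x| ^ D.r ≤
          (ε ^ σ) ^ (D.r - D.p) * (C₁ * ε ^ D.γ) +
            (ε ^ σ) ^ (-(S - D.r)) * (C * ε ^ (z * (S / D.p))) := by
        calc _ ≤ ∫ x in Metric.closedBall y R, ((ε ^ σ) ^ (D.r - D.p) * |u.toFun x| ^ D.p +
              (ε ^ σ) ^ (-(S - D.r)) * |u.toFun x| ^ S) :=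
              integral_mono ir.integrableOn
                ((iu.integrableOn.const_mul _).add (iS.integrableOn.const_mul _)) fun x =>
                rpow_le_split hsp (abs_nonneg _) hp0 hD.p_lt_r.le hD.r_lt_crit.le
          _ = (ε ^ σ) ^ (D.r - D.p) * (∫ x in Metric.closedBall y R, |u.toFun x| ^ D.p) +
              (ε ^ σ) ^ (-(S - D.r)) * ∫ x in Metric.closedBall y R, |u.toFun x| ^ S := by
              rw [integral_add (iu.integrableOn.const_mul _) (iS.integrableOn.const_mul _),
                integral_const_mul, integral_const_mul]
          _ ≤ _ := by gcongr
      have hpow : ∀ e, z' ≤ e → ε ^ e ≤ ε ^ z' := fun e he =>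
        Real.rpow_le_rpow_of_exponent_ge hε hε1 he
      have hW : (R - s) ^ (-D.p) * (∫ x in Metric.closedBall y R, |u.toFun x| ^ D.p) +
          ε ^ (-(S - D.r)) * (∫ x in Metric.closedBall y R, |u.toFun x| ^ D.r) ≤ K * ε ^ z' := by
        have e1 : ε ^ (-(S - D.r)) * ((ε ^ σ) ^ (D.r - D.p) * (C₁ * ε ^ D.γ)) =
            C₁ * ε ^ (-(S - D.r) + σ * (D.r - D.p) + D.γ) := by
          rw [Real.rpow_add hε, Real.rpow_add hε, Real.rpow_mul hε.le σ]; ring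
        have e2 : ε ^ (-(S - D.r)) * ((ε ^ σ) ^ (-(S - D.r)) * (C * ε ^ (z * (S / D.p)))) =
            C * ε ^ (-(S - D.r) + σ * (D.r - D.p) + D.γ) := by
          have : -(S - D.r) + σ * (D.r - D.p) + D.γ =
              -(S - D.r) + σ * (-(S - D.r)) + z * (S / D.p) := by linarith
          rw [this, Real.rpow_add hε, Real.rpow_add hε, Real.rpow_mul hε.le σ]; ring
        calc _ ≤ (R - s) ^ (-D.p) * (C₁ * ε ^ D.γ) + ε ^ (-(S - D.r)) *
              ((ε ^ σ) ^ (D.r - D.p) * (C₁ * ε ^ D.γ) +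
                (ε ^ σ) ^ (-(S - D.r)) * (C * ε ^ (z * (S / D.p)))) := by gcongr
          _ = (R - s) ^ (-D.p) * (C₁ * ε ^ D.γ) +
              (C₁ + C) * ε ^ (-(S - D.r) + σ * (D.r - D.p) + D.γ) := by
              rw [mul_add, e1, e2]; ring
          _ ≤ (R - s) ^ (-D.p) * (C₁ * ε ^ z') + (C₁ + C) * ε ^ z' := by
              exact add_le_add (mul_le_mul_of_nonneg_left
                (mul_le_mul_of_nonneg_left (hpow _ hz'γ) hC₁.le) (by positivity))
                (mul_le_mul_of_nonneg_left (hpow _ (hzz.trans hexp)) (by positivity))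
          _ = K * ε ^ z' := by rw [hK]; ring
      refine (hloc ε hε hε1 u hu y s R hs0 (by linarith) hRs1).trans ?_
      rw [mul_assoc, Real.rpow_mul hε.le, ← Real.mul_rpow hK0.le (by positivity)]
      refine mul_le_mul_of_nonneg_left (Real.rpow_le_rpow (add_nonneg
        (mul_nonneg (by positivity) (integral_nonneg fun x => by positivity))
        (mul_nonneg (by positivity) (integral_nonneg fun x => by positivity))) hW
          (by positivity)) hCL.le
  -- The gain `g` depends on neither `ε` nor `u`, so neither does the number of steps needed to
  -- reach the rate `γ`.
  obtain ⟨n, hn⟩ := exists_nat_ge (D.γ / g)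
  obtain ⟨C, hC, h⟩ := hind n
  refine ⟨C, hC, fun ε hε hε1 u hu hM y hy => ?_⟩
  have h1 := h ε hε hε1 u hu hM y hy
  rw [min_eq_right ((div_le_iff₀ hg).1 hn)] at h1
  refine le_trans ?_ h1
  have iS := u.integrable_rpow_of_le hp.le hD.p_lt_dim hpS.le le_rfl
  refine setIntegral_mono_set iS.integrableOn (ae_of_all _ fun x => by positivity)
    (Metric.closedBall_subset_closedBall ?_).eventuallyLE
  have : (0 : ℝ) ≤ 1 / 2 ^ (n + 1) := by positivity
  nlinarith

end Data

end PLap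

namespace PLap
open Filter Topology

/-! ### De Giorgi iteration -/

/-- Fast geometric convergence for a superlinear recursion. -/
theorem le_geometric_of_rpow_le {X : ℕ → ℝ} {A C b e θ l : ℝ} (hX : ∀ j, 0 ≤ X j)
    (hA : 0 ≤ A) (hC : 0 < C) (he : 0 < e) (hb : 0 < b) (hθ : 0 < θ) (hl : 0 < l)
    (hbl : b * l = l ^ θ) (hAC : A * C ≤ (C * l) ^ θ) (h0 : X 0 ≤ C * e)
    (hrec : ∀ j, X (j + 1) ^ θ ≤ A * b ^ j * e ^ (θ - 1) * X j) (j : ℕ) :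
    X j ≤ C * e * l ^ j := by
  induction j with
  | zero => simpa using h0
  | succ j ih =>
    refine (Real.rpow_le_rpow_iff (hX _) (by positivity) hθ).1 ?_
    have e1 : e ^ θ = e ^ (θ - 1) * e := by
      rw [Real.rpow_sub_one he.ne']; field_simp
    have e2 : (l ^ j) ^ θ = (b * l) ^ j := by
      rw [hbl, ← Real.rpow_natCast, ← Real.rpow_natCast, ← Real.rpow_mul hl.le,
        ← Real.rpow_mul hl.le, mul_comm]
    calc X (j + 1) ^ θ ≤ A * b ^ j * e ^ (θ - 1) * X j := hrec j
      _ ≤ A * b ^ j * e ^ (θ - 1) * (C * e * l ^ j) := by gcongr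
      _ = A * C * (e ^ θ * (b * l) ^ j) := by rw [e1, mul_pow]; ring
      _ ≤ (C * l) ^ θ * (e ^ θ * (b * l) ^ j) := by gcongr
      _ = (C * e * l ^ (j + 1)) ^ θ := by
          rw [← e2, ← Real.mul_rpow he.le (by positivity), ← Real.mul_rpow (by positivity)
            (by positivity)]
          congr 1
          ring

/-- Truncations at increasing levels: Chebyshev-type bounds for the right-hand side of the level
estimate. -/
theorem level_bounds {t k p r S : ℝ} (hk : 0 < k) (hp : 0 < p) (hpr : p < r) (hr : 1 < r)
    (hrS : r < S) (j : ℕ) :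
    max (t - k * (1 - 1 / 2 ^ (j + 1))) 0 ^ p ≤
        2 ^ ((j + 1 : ℝ) * (S - p)) * k ^ (-(S - p)) * max (t - k * (1 - 1 / 2 ^ j)) 0 ^ S ∧
      |t| ^ (r - 1) * max (t - k * (1 - 1 / 2 ^ (j + 1))) 0 ≤
        2 ^ ((j + 2 : ℝ) * r + (j + 1 : ℝ) * (S - r)) * k ^ (-(S - r)) *
          max (t - k * (1 - 1 / 2 ^ j)) 0 ^ S := by
  set P : ℝ := 2 ^ (j + 1) with hP
  have hP0 : 0 < P := by positivity
  have hP1 : 1 ≤ P := one_le_pow₀ (by norm_num)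
  have hPj : (1 : ℝ) / 2 ^ j = 2 / P := by
    rw [hP, pow_succ]; field_simp
  rw [hPj]
  rcases le_or_gt t (k * (1 - 1 / P)) with h | h
  · rw [max_eq_right (by linarith : t - k * (1 - 1 / P) ≤ 0), Real.zero_rpow hp.ne', mul_zero]
    constructor <;> positivity
  set v := t - k * (1 - 2 / P) with hv
  have hkP : 0 < k / P := by positivity
  have e1 : k * (1 - 2 / P) = k - 2 * (k / P) := by ring
  have e2 : k * (1 - 1 / P) = k - k / P := by ring
  have hvk : k / P ≤ v := by rw [hv, e1]; rw [e2] at h; linarith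
  have hv0 : 0 < v := hkP.trans_le hvk
  have hw0 : 0 < t - k * (1 - 1 / P) := by linarith
  have hwv : t - k * (1 - 1 / P) ≤ v := by rw [hv, e1, e2]; linarith
  have ht0 : 0 ≤ t := by
    rw [e2] at h
    have : k / P ≤ k := div_le_self hk.le hP1
    linarith
  -- Above level `j + 1` the truncation `v` at level `j` is at least `k / P`. Hence `k ≤ P v`, and
  -- `t` itself is controlled by `v`.
  have htv : t ≤ 2 * P * v := by
    have h1 : k ≤ P * v := by rw [div_le_iff₀ hP0] at hvk; linarith
    have h2 : v ≤ P * v := le_mul_of_one_le_left hv0.le hP1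
    have h3 : t ≤ v + k := by rw [hv, e1]; linarith
    linarith
  rw [max_eq_left hw0.le, max_eq_left hv0.le, abs_of_nonneg ht0]
  have hPr : ∀ x : ℝ, P ^ x = 2 ^ ((j + 1 : ℝ) * x) := fun x => by
    rw [hP, ← Real.rpow_natCast, ← Real.rpow_mul (by norm_num)]
    push_cast
    rfl
  have key : ∀ q < S, v ^ q ≤ P ^ (S - q) * k ^ (-(S - q)) * v ^ S := by
    intro q hq
    have h1 : v ^ q = v ^ (-(S - q)) * v ^ S := by rw [← Real.rpow_add hv0]; congr 1; ring
    have h2 : v ^ (-(S - q)) ≤ (k / P) ^ (-(S - q)) :=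
      Real.rpow_le_rpow_of_nonpos hkP hvk (by linarith)
    have h3 : (k / P) ^ (-(S - q)) = P ^ (S - q) * k ^ (-(S - q)) := by
      rw [Real.div_rpow hk.le hP0.le, Real.rpow_neg hP0.le, div_inv_eq_mul, mul_comm]
    rw [h1, ← h3]
    gcongr
  constructor
  · rw [← hPr]
    exact (Real.rpow_le_rpow hw0.le hwv hp.le).trans (key p (by linarith))
  · have h2P : (2 * P) ^ r = 2 ^ ((j + 2 : ℝ) * r) := by
      have : 2 * P = 2 ^ ((j + 2 : ℕ) : ℝ) := by rw [Real.rpow_natCast, hP]; ring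
      rw [this, ← Real.rpow_mul (by norm_num)]
      push_cast
      rfl
    calc t ^ (r - 1) * (t - k * (1 - 1 / P)) ≤ (2 * P * v) ^ (r - 1) * (2 * P * v) := by
          have hwt : t - k * (1 - 1 / P) ≤ 2 * P * v := by
            have : v ≤ 2 * P * v := le_mul_of_one_le_left hv0.le (by linarith)
            linarith
          exact mul_le_mul (Real.rpow_le_rpow ht0 htv (by linarith)) hwt hw0.le (by positivity)
      _ = (2 * P) ^ r * v ^ r := by
          rw [← Real.rpow_add_one' (by positivity) (by linarith), sub_add_cancel,
            Real.mul_rpow (by positivity) hv0.le]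
      _ ≤ (2 * P) ^ r * (P ^ (S - r) * k ^ (-(S - r)) * v ^ S) := by
          gcongr
          exact key r hrS
      _ = _ := by
          rw [h2P, hPr, Real.rpow_add (by norm_num)]; ring

namespace Data

variable {N : ℕ} {D : Data N} {a : ℝ} (hD : D.Admissible a)
include hD

set_option maxHeartbeats 1000000 in
/-- A critical point which decays in `L^{p^*}` of a ball decays uniformly on a smaller ball. -/
theorem Admissible.exists_sup_bound {ρ : ℝ} (hρ : 0 < ρ) (hρ1 : ρ ≤ 1) {C₀ : ℝ} (hC₀ : 0 < C₀) :
    ∃ Λ > 0, ∀ ε : ℝ, 0 < ε → ε ≤ 1 → ∀ u : SobolevFun N D.p, D.IsCriticalPoint ε u → ∀ y,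
      (∫ x in Metric.closedBall y (ρ / 2), |u.toFun x| ^ critExp N D.p) ≤
        C₀ * ε ^ (D.γ * (critExp N D.p / D.p)) →
      ∀ᵐ x ∂volume.restrict (Metric.closedBall y (ρ / 4)), u.toFun x ≤ Λ * ε ^ (D.γ / D.p) := by
  have hp := hD.one_lt_p
  have hp0 := hD.p_pos
  have hr := hD.one_lt_r
  have hpr := hD.p_lt_r
  have hrS := hD.r_lt_crit
  have hS := critExp_pos hp.le hD.p_lt_dim
  have hpS := lt_critExp hp.le hD.p_lt_dim
  have hγ := hD.γ_pos
  have hsr := hD.crit_sub_r_lt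
  set S := critExp N D.p with hSdef
  obtain ⟨C, hC, hlev⟩ := hD.exists_level_estimate
  set θ := D.p / S with hθ
  have hθ0 : 0 < θ := by positivity
  have hθ1 : θ < 1 := (div_lt_one hS).2 hpS
  set b : ℝ := 2 ^ S with hb
  have hb0 : 0 < b := by positivity
  have hb1 : 1 < b := Real.one_lt_rpow (by norm_num) hS
  -- This is the positive solution of `b l = l^θ`, the ratio for which geometric decay is preserved
  -- by the recursion. It is below one because `b > 1` and `θ < 1`.
  set l : ℝ := b ^ (-(1 / (1 - θ))) with hl
  have hl0 : 0 < l := by positivity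
  have h1θ : 0 < 1 - θ := by linarith
  have hl1 : l < 1 := Real.rpow_lt_one_of_one_lt_of_neg hb1 (neg_lt_zero.2 (by positivity))
  have hbl : b * l = l ^ θ := by
    rw [hl, ← Real.rpow_mul hb0.le]
    nth_rewrite 1 [← Real.rpow_one b]
    rw [← Real.rpow_add hb0]
    congr 1
    field_simp
    ring
  set A₀ := C * (ρ ^ (-D.p) + 1) * 2 ^ (3 * S) with hA₀
  have hA₀0 : 0 < A₀ := by positivity
  -- A negative power of `Λ` multiplies the recursion constant, so a large `Λ` makes the initial
  -- mass small enough for the iteration. No `ε` enters this choice.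
  obtain ⟨Λ, hΛ1, hΛ⟩ : ∃ Λ : ℝ, 1 ≤ Λ ∧ A₀ * Λ ^ (-(S - D.r)) * C₀ ≤ (C₀ * l) ^ θ := by
    have h1 : Tendsto (fun Λ : ℝ => A₀ * Λ ^ (-(S - D.r)) * C₀) atTop (𝓝 (A₀ * 0 * C₀)) :=
      ((tendsto_rpow_neg_atTop (sub_pos.2 hrS)).const_mul A₀).mul_const C₀
    have h2 : A₀ * 0 * C₀ < (C₀ * l) ^ θ := by
      rw [mul_zero, zero_mul]
      positivity
    obtain ⟨Λ, h3, h4⟩ := ((h1.eventually_lt_const h2).and (eventually_ge_atTop 1)).exists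
    exact ⟨Λ, h4, h3.le⟩
  have hΛ0 : 0 < Λ := by linarith
  refine ⟨Λ, hΛ0, fun ε hε hε1 u hu y hX0 => ?_⟩
  set k := Λ * ε ^ (D.γ / D.p) with hk
  have hk0 : 0 < k := by positivity
  set e := ε ^ (D.γ * (S / D.p)) with he
  have he0 : 0 < e := by positivity
  have iS := u.integrable_rpow_of_le hp.le hD.p_lt_dim hpS.le le_rfl
  have ilev : ∀ κ, 0 ≤ κ → Integrable (fun x => max (u.toFun x - κ) 0 ^ S) volume := by
    intro κ hκ
    refine iS.mono' (((u.memLp_toFun.1.aemeasurable.sub_const κ).max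
      aemeasurable_const).pow_const _).aestronglyMeasurable (ae_of_all _ fun x => ?_)
    rw [Real.norm_of_nonneg (by positivity)]
    exact Real.rpow_le_rpow (le_max_right _ _)
      (max_le (by linarith [le_abs_self (u.toFun x)]) (abs_nonneg _)) hS.le
  have hkj : ∀ j : ℕ, 0 ≤ k * (1 - 1 / 2 ^ j) := fun j => by
    refine mul_nonneg hk0.le (sub_nonneg.2 ?_)
    rw [div_le_one (by positivity)]
    exact one_le_pow₀ (by norm_num)
  set X : ℕ → ℝ := fun j => ∫ x in Metric.closedBall y (ρ / 4 * (1 + 1 / 2 ^ j)),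
    max (u.toFun x - k * (1 - 1 / 2 ^ j)) 0 ^ S with hX
  have hXnn : ∀ j, 0 ≤ X j := fun j => integral_nonneg fun x => by positivity
  have hX00 : X 0 ≤ C₀ * e := by
    refine le_trans ?_ hX0
    simp only [hX, pow_zero, div_one, sub_self, mul_zero, sub_zero]
    rw [show ρ / 4 * (1 + 1) = ρ / 2 by ring]
    refine integral_mono_of_nonneg (ae_of_all _ fun x => by positivity) iS.integrableOn
      (ae_of_all _ fun x => ?_)
    exact Real.rpow_le_rpow (le_max_right _ _) (max_le (le_abs_self _) (abs_nonneg _)) hS.le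
  -- The level scales so that `ε^{γ/p}` to the power `-(S-p)` is exactly `e^{θ-1}`. The exponent of
  -- `Λ` is weakened to the one in `hk2`, using `Λ ≥ 1`.
  have hk1 : k ^ (-(S - D.p)) ≤ Λ ^ (-(S - D.r)) * e ^ (θ - 1) := by
    have e1 : (ε ^ (D.γ / D.p)) ^ (-(S - D.p)) = e ^ (θ - 1) := by
      rw [he, ← Real.rpow_mul hε.le, ← Real.rpow_mul hε.le, hθ]
      congr 1
      field_simp
      ring
    rw [hk, Real.mul_rpow hΛ0.le (by positivity), e1]
    gcongr
  -- After comparison of the exponents of `ε`, this amounts to `S - r ≤ γ (r-p)/p`: the loss in the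
  -- nonlinearity is no worse than the cut-off term.
  have hk2 : ε ^ (-(S - D.r)) * k ^ (-(S - D.r)) ≤ Λ ^ (-(S - D.r)) * e ^ (θ - 1) := by
    have e1 : e ^ (θ - 1) = ε ^ (-(D.γ * (S - D.p) / D.p)) := by
      rw [he, ← Real.rpow_mul hε.le, hθ]
      congr 1
      field_simp
      ring
    rw [hk, Real.mul_rpow hΛ0.le (by positivity), ← Real.rpow_mul hε.le, mul_left_comm,
      ← Real.rpow_add hε, e1]
    refine mul_le_mul_of_nonneg_left (Real.rpow_le_rpow_of_exponent_ge hε hε1 ?_) (by positivity)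
    have e2 : D.γ * (S - D.p) / D.p = D.γ * (D.r - D.p) / D.p + D.γ / D.p * (S - D.r) := by ring
    linarith
  have hrec : ∀ j, X (j + 1) ^ θ ≤ A₀ * Λ ^ (-(S - D.r)) * b ^ j * e ^ (θ - 1) * X j := by
    intro j
    have hgap : ρ / 4 * (1 + 1 / 2 ^ j) - ρ / 4 * (1 + 1 / 2 ^ (j + 1)) = ρ / 2 ^ (j + 3) := by
      field_simp
      ring
    have h2j : (1 : ℝ) ≤ 2 ^ (j + 3) := one_le_pow₀ (by norm_num)
    have hgap0 : 0 < ρ / 2 ^ (j + 3) := by positivity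
    have h1 := hlev ε hε hε1 u hu y (ρ / 4 * (1 + 1 / 2 ^ (j + 1))) (ρ / 4 * (1 + 1 / 2 ^ j))
      (k * (1 - 1 / 2 ^ (j + 1))) (by positivity) (by linarith)
      (by rw [hgap, div_le_one (by positivity)]; linarith) (hkj _)
    rw [hgap] at h1
    set B := Metric.closedBall y (ρ / 4 * (1 + 1 / 2 ^ j)) with hB
    have hlb := fun t => level_bounds (t := t) hk0 hp0 hpr hr hrS j
    have i1 : (∫ x in B, max (u.toFun x - k * (1 - 1 / 2 ^ (j + 1))) 0 ^ D.p) ≤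
        2 ^ ((j + 1 : ℝ) * (S - D.p)) * k ^ (-(S - D.p)) * X j := by
      rw [hX, ← integral_const_mul]
      exact integral_mono_of_nonneg (ae_of_all _ fun x => by positivity)
        ((ilev _ (hkj j)).integrableOn.const_mul _) (ae_of_all _ fun x => (hlb _).1)
    have i2 : (∫ x in B, |u.toFun x| ^ (D.r - 1) *
          max (u.toFun x - k * (1 - 1 / 2 ^ (j + 1))) 0) ≤
        2 ^ ((j + 2 : ℝ) * D.r + (j + 1 : ℝ) * (S - D.r)) * k ^ (-(S - D.r)) * X j := by
      rw [hX, ← integral_const_mul]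
      exact integral_mono_of_nonneg (ae_of_all _ fun x => by positivity)
        ((ilev _ (hkj j)).integrableOn.const_mul _) (ae_of_all _ fun x => (hlb _).2)
    have hj0 : (0 : ℝ) ≤ j := j.cast_nonneg
    have p0 : (2 : ℝ) ^ ((j + 3 : ℝ) * S) = 2 ^ (3 * S) * b ^ j := by
      rw [hb, ← Real.rpow_natCast, ← Real.rpow_mul (by norm_num), ← Real.rpow_add (by norm_num)]
      congr 1
      ring
    have p1 : (ρ / 2 ^ (j + 3)) ^ (-D.p) * 2 ^ ((j + 1 : ℝ) * (S - D.p)) ≤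
        ρ ^ (-D.p) * (2 ^ (3 * S) * b ^ j) := by
      rw [← p0, Real.div_rpow hρ.le (by positivity), Real.rpow_neg (by positivity : (0 : ℝ) ≤ 2 ^ _),
        div_inv_eq_mul, mul_assoc, ← Real.rpow_natCast, ← Real.rpow_mul (by norm_num),
        ← Real.rpow_add (by norm_num)]
      gcongr
      · norm_num
      · push_cast
        nlinarith
    have p2 : (2 : ℝ) ^ ((j + 2 : ℝ) * D.r + (j + 1 : ℝ) * (S - D.r)) ≤ 2 ^ (3 * S) * b ^ j := by
      rw [← p0]
      gcongr
      · norm_num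
      · nlinarith
    have hXj := hXnn j
    calc X (j + 1) ^ θ ≤ C * ((ρ / 2 ^ (j + 3)) ^ (-D.p) *
            (2 ^ ((j + 1 : ℝ) * (S - D.p)) * k ^ (-(S - D.p)) * X j) +
          ε ^ (-(S - D.r)) * (2 ^ ((j + 2 : ℝ) * D.r + (j + 1 : ℝ) * (S - D.r)) *
            k ^ (-(S - D.r)) * X j)) := h1.trans (by gcongr)
      _ = C * (((ρ / 2 ^ (j + 3)) ^ (-D.p) * 2 ^ ((j + 1 : ℝ) * (S - D.p))) *
            k ^ (-(S - D.p)) * X j +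
          2 ^ ((j + 2 : ℝ) * D.r + (j + 1 : ℝ) * (S - D.r)) *
            (ε ^ (-(S - D.r)) * k ^ (-(S - D.r))) * X j) := by ring
      _ ≤ C * ((ρ ^ (-D.p) * (2 ^ (3 * S) * b ^ j)) * (Λ ^ (-(S - D.r)) * e ^ (θ - 1)) * X j +
          (2 ^ (3 * S) * b ^ j) * (Λ ^ (-(S - D.r)) * e ^ (θ - 1)) * X j) := by gcongr
      _ = C * (ρ ^ (-D.p) + 1) * 2 ^ (3 * S) *
            (Λ ^ (-(S - D.r)) * b ^ j * e ^ (θ - 1) * X j) := by ring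
      _ = _ := by rw [hA₀]; ring
  have hdecay := le_geometric_of_rpow_le hXnn (by positivity) hC₀ he0 hb0 hθ0 hl0 hbl hΛ hX00 hrec
  -- The radii stay above `ρ / 4` and the levels below `k`, so the limiting quantity lies below
  -- every `X j`.
  have hle : ∀ j, (∫ x in Metric.closedBall y (ρ / 4), max (u.toFun x - k) 0 ^ S) ≤ X j := by
    intro j
    have h2 : (0 : ℝ) ≤ 1 / 2 ^ j := by positivity
    calc _ ≤ ∫ x in Metric.closedBall y (ρ / 4), max (u.toFun x - k * (1 - 1 / 2 ^ j)) 0 ^ S := by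
          refine integral_mono_of_nonneg (ae_of_all _ fun x => by positivity)
            (ilev _ (hkj j)).integrableOn (ae_of_all _ fun x => ?_)
          refine Real.rpow_le_rpow (le_max_right _ _) (max_le_max ?_ le_rfl) hS.le
          nlinarith
      _ ≤ X j := by
          refine setIntegral_mono_set (ilev _ (hkj j)).integrableOn
            (ae_of_all _ fun x => by positivity)
            (Metric.closedBall_subset_closedBall ?_).eventuallyLE
          nlinarith
  have hzero : (∫ x in Metric.closedBall y (ρ / 4), max (u.toFun x - k) 0 ^ S) = 0 := by
    refine le_antisymm ?_ (integral_nonneg fun x => by positivity)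
    have hlim : Tendsto (fun j : ℕ => C₀ * e * l ^ j) atTop (𝓝 (C₀ * e * 0)) :=
      (tendsto_pow_atTop_nhds_zero_of_lt_one hl0.le hl1).const_mul _
    rw [mul_zero] at hlim
    exact ge_of_tendsto' hlim fun j => (hle j).trans (hdecay j)
  rw [integral_eq_zero_iff_of_nonneg (fun x => by positivity)
    (ilev k hk0.le).integrableOn] at hzero
  filter_upwards [hzero] with x hx
  by_contra hcon
  have h3 : 0 < u.toFun x - k := by linarith [not_le.1 hcon]
  have h4 : max (u.toFun x - k) 0 ^ S = 0 := hx
  rw [max_eq_left h3.le] at h4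
  exact (Real.rpow_pos_of_pos h3 S).ne' h4

end Data

end PLap

/-! ### Covering the exterior region. -/

theorem lemma4p2 {N : ℕ} (D : PLap.Data N) (a : ℝ) (hD : D.Admissible a)
    (δ : ℝ) (hδ : 0 < δ) (M : ℝ) :
    ∃ C : ℝ, 0 < C ∧ ∀ ε : ℝ, 0 < ε → ε ≤ 1 → ∀ u : PLap.SobolevFun N D.p,
      D.IsCriticalPoint ε u → D.I ε u ≤ M →
        ∀ᵐ x : PLap.E N, x ∉ Metric.thickening δ (PLap.rescale ε D.Ω) →
          |u.toFun x| ≤ C * ε ^ (D.γ / D.p) := by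
  -- The local estimates need gaps between radii of at most one, and `2ρ ≤ δ` ensures that points
  -- outside the `δ`-neighbourhood are admissible centres.
  set ρ := min (δ / 2) 1 with hρ
  have hρ0 : 0 < ρ := by positivity
  obtain ⟨C₀, hC₀, h0⟩ := hD.exists_outer_crit_bound hρ0 (min_le_right _ _) M
  obtain ⟨Λ, hΛ, hsup⟩ := hD.exists_sup_bound hρ0 (min_le_right _ _) hC₀
  refine ⟨Λ, hΛ, fun ε hε hε1 u hu hM => ?_⟩
  have hδρ : 2 * ρ ≤ δ := by linarith [min_le_left (δ / 2) 1]
  rw [ae_iff]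
  -- Every point of the exceptional set is itself the centre of a good ball. Local nullity then
  -- suffices, which handles the uncountable family of centres.
  refine measure_null_of_locally_null _ fun y hy => ?_
  have hy1 : y ∉ Metric.thickening (2 * ρ) (PLap.rescale ε D.Ω) := fun h =>
    hy fun h' => absurd (Metric.thickening_mono hδρ _ h) h'
  have hb := h0 ε hε hε1 u hu hM y hy1
  have h1 := hsup ε hε hε1 u hu y hb
  have h2 := hsup ε hε hε1 u.neg (hD.isCriticalPoint_neg hε hu) y
    (by simpa only [PLap.SobolevFun.neg, abs_neg] using hb)
  rw [ae_restrict_iff' Metric.isClosed_closedBall.measurableSet] at h1 h2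
  refine ⟨_, Filter.inter_mem self_mem_nhdsWithin
    (mem_nhdsWithin_of_mem_nhds (Metric.closedBall_mem_nhds y (by positivity : 0 < ρ / 4))), ?_⟩
  refine measure_mono_null (fun x hx => ?_) (ae_iff.1 (h1.and h2))
  rintro hle
  refine hx.1 fun _ => abs_le.2 ⟨?_, (hle.1 hx.2)⟩
  have h3 : -u.toFun x ≤ Λ * ε ^ (D.γ / D.p) := hle.2 hx.2
  linarith
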